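/- Let $\omega\subset\mathbb{R}^2$ be a bounded domain with Lipschitz boundary, let $\Omega=\omega\times\mathbb{R}$ and $\Omega_1=\omega\times(-1,1)$, and write $x=(x',x_3)$ with $x'=(x_1,x_2)$. For $\alpha:\mathbb{R}\to\mathbb{R}$ put $A(x)=A_0(x',\alpha(x_3))$, where $$A_0(x',t)=\begin{pmatrix}1+x_2^2t^2 & -x_1x_2t^2 & -x_2t\\ -x_1x_2t^2 & 1+x_1^2t^2 & x_1t\\ -x_2t & x_1t & 1\end{pmatrix}.$$ Let $\widetilde H^{3/2}(\partial\Omega)$ be the space of traces on $\partial\Omega=\partial\omega\times\mathbb{R}$ of functions in $H^2(\Omega)$, with the quotient norm $\|g\|_{\widetilde H^{3/2}(\partial\Omega)}=\inf\{\|G\|_{H^2(\Omega)} : G\in H^2(\Omega),\ G=g \text{ on } \partial\Omega\}$. Say that $\Omega_1$ has the $H^2$-regularity property if the following holds for all $a>0$ and $M\ge 0$ with a constant $K=K(\omega,a,M)$: for every real symmetric matrix-valued function $B=(B_{ij})_{1\le i,j\le 3}$ on $\Omega_1$ with $\|B_{ij}\|_{W^{1,\infty}(\Omega_1)}\le M$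 and $B(x)\zeta\cdot\zeta\ge a|\zeta|^2$ for all $x\in\Omega_1$, $\zeta\in\mathbb{R}^3$, and every $F\in L^2(\Omega_1)$, the problem $\operatorname{div}(B\nabla w)=F$ in $\Omega_1$, $w=0$ on $\partial\Omega_1$, has a unique solution $w\in H^2(\Omega_1)$, and $\|w\|_{H^2(\Omega_1)}\le K\|F\|_{L^2(\Omega_1)}$. **Theorem.** Assume that $\Omega_1$ has the $H^2$-regularity property and that $\alpha\in C^{0,1}(\mathbb{R})$, that is, $\alpha$ is bounded and Lipschitz, with $\|\alpha\|_{C^{0,1}(\mathbb{R})}=\sup|\alpha|+\sup_{s\ne t}|\alpha(s)-\alpha(t)|/|s-t|$. Then for every $f\in\widetilde H^{3/2}(\partial\Omega)$ the boundary value problem $$\operatorname{div}(A\nabla u)=0\ \text{ in }\Omega,\qquad u=f\ \text{ on }\partial\Omega$$ (the equation in the sense of distributions, the boundary condition in the sense of traces) has a unique solution $u\in H^2(\Omega)$. Moreover there is a constant $C>0$, depending only on $\omega$ and on (an upper bound for) $\|\alpha\|_{C^{0,1}(\mathbb{R})}$, such that $$\|u\|_{H^2(\Omega)}\le C\,\|f\|_{\widetilde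 H^{3/2}(\partial\Omega)}.$$ -/

import Mathlib

open MeasureTheory Filter Topology Set
open scoped ENNReal NNReal Matrix

noncomputable section

namespace Waveguide

/-- The plane of the cross section variable `x' = (x₁, x₂)`. -/
abbrev E2 : Type := EuclideanSpace ℝ (Fin 2)

/-- The space of the variable `x = (x', x₃) = (x₁, x₂, x₃)`. -/
abbrev E3 : Type := EuclideanSpace ℝ (Fin 3)

/-- The point `(x', t)` of `ℝ³`. -/
def point (y : E2) (t : ℝ) : E3 := !₂[y 0, y 1, t]

/-- The cylinder `ω × I`. -/
def cylinder (ω : Set E2) (I : Set ℝ) : Set E3 :=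
  {x | (!₂[x 0, x 1] : E2) ∈ ω ∧ x 2 ∈ I}

/-- The infinite straight waveguide `Ω = ω × ℝ`. -/
def waveguide (ω : Set E2) : Set E3 := cylinder ω univ

/-- `ω` has a Lipschitz boundary: near each boundary point, in suitable Cartesian coordinates,
`ω` is the region strictly above the graph of a Lipschitz function of one variable. -/
def HasLipschitzBoundary (ω : Set E2) : Prop :=
  ∀ p ∈ frontier ω, ∃ (e : E2 ≃ᵃⁱ[ℝ] E2) (γ : ℝ → ℝ) (L : ℝ≥0) (r : ℝ),
    LipschitzWith L γ ∧ 0 < r ∧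
      ∀ x ∈ Metric.ball p r, (x ∈ ω ↔ γ (e x 0) < e x 1)

/-! ### Sobolev spaces on an open subset of `ℝ³` -/

/-- Classical partial derivative. -/
def partialDeriv (i : Fin 3) (φ : E3 → ℝ) (x : E3) : ℝ :=
  fderiv ℝ φ x (EuclideanSpace.single i 1)

/-- `φ ∈ C_c^∞(ℝ³)`. -/
def IsSmoothCompact (φ : E3 → ℝ) : Prop :=
  ContDiff ℝ ((⊤ : ℕ∞) : WithTop ℕ∞) φ ∧ HasCompactSupport φ

/-- `φ ∈ C_c^∞(U)`. -/
def IsTest (U : Set E3) (φ : E3 → ℝ) : Prop :=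
  IsSmoothCompact φ ∧ tsupport φ ⊆ U

/-- `v` is the `i`-th partial derivative of `u` on `U` in the sense of distributions
(both being locally integrable on `U`). -/
def HasWeakPartial (U : Set E3) (i : Fin 3) (u v : E3 → ℝ) : Prop :=
  LocallyIntegrableOn u U ∧ LocallyIntegrableOn v U ∧
    ∀ φ : E3 → ℝ, IsTest U φ →
      ∫ x in U, u x * partialDeriv i φ x = - ∫ x in U, v x * φ x

open Classical in
/-- The `i`-th weak partial derivative of `u` on the open set `U`; it is unique up to equality
almost everywhere on `U`, and we pick a representative. (It is `0` if `u` has none; every space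
below asks for its existence.) -/
def weakPartial (U : Set E3) (i : Fin 3) (u : E3 → ℝ) : E3 → ℝ :=
  if h : ∃ v, HasWeakPartial U i u v then h.choose else 0

/-- `u ∈ W^{1,p}(U)`. -/
def MemW1 (U : Set E3) (p : ℝ≥0∞) (u : E3 → ℝ) : Prop :=
  MemLp u p (volume.restrict U) ∧
    ∀ i, ∃ v, HasWeakPartial U i u v ∧ MemLp v p (volume.restrict U)

/-- `u ∈ H¹(U)`. -/
def MemH1 (U : Set E3) (u : E3 → ℝ) : Prop := MemW1 U 2 u

/-- `u ∈ H²(U)`. -/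
def MemH2 (U : Set E3) (u : E3 → ℝ) : Prop :=
  MemH1 U u ∧ ∀ i, MemH1 U (weakPartial U i u)

/-- The norm of `L²(U)`. -/
def L2Norm (U : Set E3) (u : E3 → ℝ) : ℝ≥0∞ := eLpNorm u 2 (volume.restrict U)

/-- The norm of `W^{1,∞}(U)`. -/
def W1inftyNorm (U : Set E3) (u : E3 → ℝ) : ℝ≥0∞ :=
  eLpNorm u ∞ (volume.restrict U) +
    ∑ i, eLpNorm (weakPartial U i u) ∞ (volume.restrict U)

/-- The norm of `H¹(U)`. -/
def H1Norm (U : Set E3) (u : E3 → ℝ) : ℝ≥0∞ :=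
  (L2Norm U u ^ 2 + ∑ i, L2Norm U (weakPartial U i u) ^ 2) ^ (1 / 2 : ℝ)

/-- The norm of `H²(U)`. -/
def H2Norm (U : Set E3) (u : E3 → ℝ) : ℝ≥0∞ :=
  (L2Norm U u ^ 2 + ∑ i, L2Norm U (weakPartial U i u) ^ 2 +
    ∑ i, ∑ j, L2Norm U (weakPartial U j (weakPartial U i u)) ^ 2) ^ (1 / 2 : ℝ)

/-- `u ∈ H¹₀(U)`, the closure of `C_c^∞(U)` in `H¹(U)`. -/
def MemH10 (U : Set E3) (u : E3 → ℝ) : Prop :=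
  MemH1 U u ∧ ∃ φ : ℕ → E3 → ℝ, (∀ n, IsTest U (φ n)) ∧
    Tendsto (fun n => H1Norm U (fun x => u x - φ n x)) atTop (𝓝 0)

/-! ### Equations in divergence form -/

/-- `div (A ∇u) = F` on `U` in the sense of distributions. -/
def DivEq (U : Set E3) (A : E3 → Matrix (Fin 3) (Fin 3) ℝ) (u F : E3 → ℝ) : Prop :=
  ∀ φ : E3 → ℝ, IsTest U φ →
    ∫ x in U, (A x *ᵥ fun j => weakPartial U j u x) ⬝ᵥ (fun i => partialDeriv i φ x)
      = - ∫ x in U, F x * φ x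

/-- The `H²`-regularity property of `U`: for every matrix-valued `B` with entries in
`W^{1,∞}(U)` that is uniformly elliptic with constant `a`, and every `F ∈ L²(U)`, the problem
`div (B ∇w) = F` in `U`, `w = 0` on `∂U`, has a unique solution `w ∈ H²(U)`, and
`‖w‖_{H²(U)} ≤ K ‖F‖_{L²(U)}` where `K` depends only on `U`, on `a` and on a bound `M` for the
`W^{1,∞}`-norms of the entries. For a real matrix, `B ζ · ζ̄ ≥ a |ζ|²` for all complex vectors `ζ`
says that `B` is symmetric with `B ζ · ζ ≥ a |ζ|²` for all real `ζ`. -/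
def HasH2Regularity (U : Set E3) : Prop :=
  ∀ (a : ℝ) (M : ℝ≥0), 0 < a → ∃ K : ℝ≥0, ∀ B : E3 → Matrix (Fin 3) (Fin 3) ℝ,
    (∀ x ∈ U, (B x).IsSymm ∧ ∀ ζ : Fin 3 → ℝ, a * (ζ ⬝ᵥ ζ) ≤ (B x *ᵥ ζ) ⬝ᵥ ζ) →
    (∀ i j, MemW1 U ∞ (fun x => B x i j) ∧ W1inftyNorm U (fun x => B x i j) ≤ M) →
    ∀ F : E3 → ℝ, MemLp F 2 (volume.restrict U) →
      ∃ w : E3 → ℝ, (MemH2 U w ∧ MemH10 U w ∧ DivEq U B w F) ∧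
        (∀ w' : E3 → ℝ, MemH2 U w' ∧ MemH10 U w' ∧ DivEq U B w' F →
          w' =ᵐ[volume.restrict U] w) ∧
        H2Norm U w ≤ K * L2Norm U F

/-- The matrix `A₀(x', t)`. -/
def conductivity₀ (y : E2) (t : ℝ) : Matrix (Fin 3) (Fin 3) ℝ :=
  !![1 + y 1 ^ 2 * t ^ 2, -(y 1 * y 0 * t ^ 2), -(y 1 * t);
     -(y 1 * y 0 * t ^ 2), 1 + y 0 ^ 2 * t ^ 2, y 0 * t;
     -(y 1 * t), y 0 * t, 1]

/-- The conductivity `A(x) = A₀(x', α(x₃))`. -/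
def conductivity (α : ℝ → ℝ) (x : E3) : Matrix (Fin 3) (Fin 3) ℝ :=
  conductivity₀ !₂[x 0, x 1] (α (x 2))

/-- The norm of `C^{0,1}(ℝ)`: supremum of `|α|` plus the best Lipschitz constant. -/
def C01Norm (α : ℝ → ℝ) : ℝ≥0∞ :=
  (⨆ t, ‖α t‖ₑ) + ⨆ (s : ℝ) (t : ℝ), edist (α s) (α t) / edist s t

/-! ### Traces on `∂Ω = ∂ω × ℝ` -/

/-- The surface measure of `∂Ω = ∂ω × ℝ`: arc length on `∂ω` times Lebesgue measure on `ℝ`. -/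
def surfaceMeasure (ω : Set E2) : Measure (E2 × ℝ) :=
  ((μH[1] : Measure E2).restrict (frontier ω)).prod volume

/-- `G = g` on `∂Ω` in the trace sense, for `G ∈ H¹(Ω)` and `g ∈ L²(∂Ω)`: the pair `(G, g)` is a
limit in `H¹(Ω) × L²(∂Ω)` of pairs `(φ|_Ω, φ|_∂Ω)` with `φ ∈ C_c^∞(ℝ³)`; that is, `g` is the image
of `G` under the continuous extension of `φ ↦ φ|_∂Ω`. -/
def HasTrace (ω : Set E2) (G : E3 → ℝ) (g : E2 × ℝ → ℝ) : Prop :=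
  MemH1 (waveguide ω) G ∧ MemLp g 2 (surfaceMeasure ω) ∧
    ∃ φ : ℕ → E3 → ℝ, (∀ n, IsSmoothCompact (φ n)) ∧
      Tendsto (fun n => H1Norm (waveguide ω) (fun x => G x - φ n x)) atTop (𝓝 0) ∧
      Tendsto (fun n => eLpNorm (fun q : E2 × ℝ => g q - φ n (point q.1 q.2)) 2
        (surfaceMeasure ω)) atTop (𝓝 0)

/-- `g ∈ H̃^{3/2}(∂Ω)`: `g` is the trace of a function in `H²(Ω)`. -/
def MemHTilde (ω : Set E2) (g : E2 × ℝ → ℝ) : Prop :=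
  ∃ G : E3 → ℝ, MemH2 (waveguide ω) G ∧ HasTrace ω G g

/-- The quotient norm of `H̃^{3/2}(∂Ω)`. -/
def HTildeNorm (ω : Set E2) (g : E2 × ℝ → ℝ) : ℝ≥0∞ :=
  ⨅ (G : E3 → ℝ) (_ : MemH2 (waveguide ω) G ∧ HasTrace ω G g), H2Norm (waveguide ω) G

/-- `u ∈ H²(Ω)` solves `div (A ∇u) = 0` in `Ω`, `u = f` on `∂Ω`. -/
def IsH2Solution (ω : Set E2) (α : ℝ → ℝ) (f : E2 × ℝ → ℝ) (u : E3 → ℝ) : Prop :=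
  MemH2 (waveguide ω) u ∧ DivEq (waveguide ω) (conductivity α) u 0 ∧ HasTrace ω u f

end Waveguide

end

open Waveguide

namespace Waveguide

/-! ### Test functions -/

/-! Existence. If `G` is an `H²` lift of the boundary values, then `F = div (A ∇G)` lies in `L²`,
because the entries of `A` are bounded and Lipschitz (`HasHess.exists_weakEq`). It remains to solve
`div (A ∇v) = F` with `v ∈ H¹₀(Ω)` and to show `v ∈ H²(Ω)`; then `u = G - v`. The form of `A` is `a²
+ b² + (z + X b - Y a)²` with `X = x₁ α`, `Y = x₂ α`, hence uniformly elliptic on the bounded cross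
section. Since `x₁` is bounded on `Ω`, a Poincaré inequality holds although `Ω` is unbounded, and
Lax–Milgram gives `v` (`exists_weak_solution`) together with an energy bound (`HasGrad0.energy_le`).

Regularity. A cutoff `θ(x₃)` turns `v` into `θ v`, which solves a Dirichlet problem in `ω × (-1,1)`
with right-hand side in `L²`, the commutator terms being of first order in `v`
(`exists_localized_weakEq`). The hypothesis supplies an `H²` solution of the same problem, and
uniqueness in `H¹₀` identifies the two (`HasH2Regularity.exists_local`). The bounds on the
coefficients are invariant under translation in `x₃`, so the estimate holds with one constant on
every slab `ω × (k-1, k+1)`. These slabs have bounded overlap: the local second derivatives glue,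
and the squared bounds sum to a global one (`exists_hasWeakPartial_of_slabs`,
`HasH2Regularity.exists_hasHess`).

Uniqueness. The difference of two solutions has zero trace. The delicate point is that zero trace
implies membership in `H¹₀(Ω)` (`HasGrad.hasGrad0_of_trace_zero`); this is where the Lipschitz
boundary enters. A one-dimensional trace inequality in graph charts gives `‖v‖² ≤ N ε² ‖∇v‖²` on the
`ε`-collar, with the gradient taken on a comparable collar, so that cutting `v` off near the
boundary costs only the energy of `v` in a shrinking collar. The energy estimate with zero
right-hand side then forces the difference to vanish.

Estimate. Every lift of `f` produces a solution bounded by that lift; by uniqueness all these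
solutions coincide, and the infimum over lifts gives the quotient norm.

Throughout, `HasGrad`, `HasGrad0` and `HasHess` carry the derivatives explicitly, which keeps the
chosen representatives in `weakPartial` out of the arguments. -/

lemma IsSmoothCompact.continuous {φ : E3 → ℝ} (h : IsSmoothCompact φ) : Continuous φ :=
  h.1.continuous

lemma IsSmoothCompact.differentiable {φ : E3 → ℝ} (h : IsSmoothCompact φ) :
    Differentiable ℝ φ :=
  h.1.differentiable (by simp)

lemma contDiff_partialDeriv {φ : E3 → ℝ} (h : ContDiff ℝ ((⊤ : ℕ∞) : WithTop ℕ∞) φ) (i : Fin 3) :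
    ContDiff ℝ ((⊤ : ℕ∞) : WithTop ℕ∞) (partialDeriv i φ) := by
  have h1 : ContDiff ℝ ((⊤ : ℕ∞) : WithTop ℕ∞) (fderiv ℝ φ) :=
    h.fderiv_right (by exact_mod_cast le_rfl)
  exact h1.clm_apply contDiff_const

lemma tsupport_partialDeriv_subset (φ : E3 → ℝ) (i : Fin 3) :
    tsupport (partialDeriv i φ) ⊆ tsupport φ :=
  tsupport_fderiv_apply_subset ℝ _

lemma IsSmoothCompact.partialDeriv {φ : E3 → ℝ} (h : IsSmoothCompact φ) (i : Fin 3) :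
    IsSmoothCompact (partialDeriv i φ) :=
  ⟨contDiff_partialDeriv h.1 i, h.2.mono' ((subset_tsupport _).trans
    (tsupport_partialDeriv_subset φ i))⟩

lemma IsTest.mono {U V : Set E3} {φ : E3 → ℝ} (h : IsTest U φ) (hUV : U ⊆ V) : IsTest V φ :=
  ⟨h.1, h.2.trans hUV⟩

lemma IsTest.partialDeriv {U : Set E3} {φ : E3 → ℝ} (h : IsTest U φ) (i : Fin 3) :
    IsTest U (partialDeriv i φ) :=
  ⟨h.1.partialDeriv i, (tsupport_partialDeriv_subset φ i).trans h.2⟩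

lemma IsSmoothCompact.mul_left {θ φ : E3 → ℝ} (hθ : ContDiff ℝ ((⊤ : ℕ∞) : WithTop ℕ∞) θ)
    (h : IsSmoothCompact φ) : IsSmoothCompact (fun x => θ x * φ x) :=
  ⟨hθ.mul h.1, h.2.mul_left⟩

lemma IsTest.mul_left {U : Set E3} {θ φ : E3 → ℝ} (hθ : ContDiff ℝ ((⊤ : ℕ∞) : WithTop ℕ∞) θ)
    (h : IsTest U φ) : IsTest U (fun x => θ x * φ x) :=
  ⟨h.1.mul_left hθ, (tsupport_mul_subset_right).trans h.2⟩

lemma partialDeriv_mul {f g : E3 → ℝ} {x : E3} (i : Fin 3) (hf : DifferentiableAt ℝ f x)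
    (hg : DifferentiableAt ℝ g x) :
    partialDeriv i (fun y => f y * g y) x = f x * partialDeriv i g x + partialDeriv i f x * g x := by
  have := (hf.hasFDerivAt.mul hg.hasFDerivAt).fderiv
  simp only [partialDeriv]
  erw [this]
  simp [mul_comm]

lemma partialDeriv_add {f g : E3 → ℝ} {x : E3} (i : Fin 3) (hf : DifferentiableAt ℝ f x)
    (hg : DifferentiableAt ℝ g x) :
    partialDeriv i (fun y => f y + g y) x = partialDeriv i f x + partialDeriv i g x := by
  have := (hf.hasFDerivAt.add hg.hasFDerivAt).fderiv
  simp only [partialDeriv]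
  erw [this]
  simp

lemma partialDeriv_const_mul {f : E3 → ℝ} {x : E3} (c : ℝ) (i : Fin 3)
    (hf : DifferentiableAt ℝ f x) :
    partialDeriv i (fun y => c * f y) x = c * partialDeriv i f x := by
  have := (hf.hasFDerivAt.const_mul c).fderiv
  simp only [partialDeriv]
  erw [this]
  simp

lemma abs_partialDeriv_le_of_lipschitz {f : E3 → ℝ} {L : ℝ≥0} (hf : LipschitzWith L f)
    (i : Fin 3) (x : E3) : |partialDeriv i f x| ≤ L := by
  have h1 := norm_fderiv_le_of_lipschitz ℝ (x₀ := x) hf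
  have h2 := (fderiv ℝ f x).le_opNorm (EuclideanSpace.single i 1)
  simp only [PiLp.norm_single, norm_one, mul_one] at h2
  exact h2.trans h1

lemma IsSmoothCompact.memLp {φ : E3 → ℝ} (h : IsSmoothCompact φ) (p : ℝ≥0∞) (μ : Measure E3)
    [IsFiniteMeasureOnCompacts μ] : MemLp φ p μ :=
  h.continuous.memLp_of_hasCompactSupport h.2

lemma IsSmoothCompact.lipschitz {φ : E3 → ℝ} (h : IsSmoothCompact φ) :
    ∃ C, LipschitzWith C φ :=
  ContDiff.lipschitzWith_of_hasCompactSupport h.2 h.1 (by simp)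

lemma IsSmoothCompact.bounded {φ : E3 → ℝ} (h : IsSmoothCompact φ) : ∃ C : ℝ, ∀ x, |φ x| ≤ C :=
  h.2.exists_bound_of_continuous h.continuous

/-! ### Local integrability -/

lemma _root_.MeasureTheory.LocallyIntegrableOn.integrable_mul_of_compact {U K : Set E3}
    {v ψ : E3 → ℝ} (hv : LocallyIntegrableOn v U) (hK : IsCompact K) (hKU : K ⊆ U)
    (hψ : AEStronglyMeasurable ψ) {C : ℝ} (hC : ∀ x, |ψ x| ≤ C) (h0 : ∀ x, x ∉ K → ψ x = 0) :
    Integrable (fun x => v x * ψ x) := by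
  have h1 : IntegrableOn v K := hv.integrableOn_compact_subset hKU hK
  have h2 : IntegrableOn (fun x => v x * ψ x) K :=
    h1.mul_bdd (c := C) hψ.restrict (Eventually.of_forall hC)
  rw [integrableOn_iff_integrable_of_support_subset] at h2
  · exact h2
  · intro x hx
    by_contra hxK
    exact hx (by simp [h0 x hxK])

lemma _root_.MeasureTheory.LocallyIntegrableOn.integrable_mul_test {U : Set E3}
    {v φ : E3 → ℝ} (hv : LocallyIntegrableOn v U) (hφ : IsTest U φ) :
    Integrable (fun x => v x * φ x) := by
  obtain ⟨C, hC⟩ := hφ.1.bounded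
  exact hv.integrable_mul_of_compact hφ.1.2 hφ.2 hφ.1.continuous.aestronglyMeasurable hC
    fun x hx => image_eq_zero_of_notMem_tsupport hx

lemma _root_.MeasureTheory.LocallyIntegrableOn.mul_bounded {U : Set E3} (hU : IsOpen U)
    {v ψ : E3 → ℝ} (hv : LocallyIntegrableOn v U) (hψ : AEStronglyMeasurable ψ)
    {C : ℝ} (hC : ∀ x, |ψ x| ≤ C) : LocallyIntegrableOn (fun x => v x * ψ x) U := by
  rw [locallyIntegrableOn_iff hU.isLocallyClosed] at hv ⊢
  intro K hKU hK
  exact (hv K hKU hK).mul_bdd (c := C) hψ.restrict (Eventually.of_forall hC)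

lemma _root_.MeasureTheory.LocallyIntegrableOn.congr_restrict {U : Set E3} (hU : IsOpen U)
    {v w : E3 → ℝ} (hv : LocallyIntegrableOn v U) (h : v =ᵐ[volume.restrict U] w) :
    LocallyIntegrableOn w U := by
  rw [locallyIntegrableOn_iff hU.isLocallyClosed] at hv ⊢
  intro K hKU hK
  exact (hv K hKU hK).congr (ae_restrict_of_ae_restrict_of_subset hKU h)

lemma _root_.MeasureTheory.MemLp.locallyIntegrableOn {U : Set E3} {v : E3 → ℝ} {p : ℝ≥0∞}
    (hv : MemLp v p (volume.restrict U)) (hp : 1 ≤ p) : LocallyIntegrableOn v U :=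
  locallyIntegrableOn_of_locallyIntegrable_restrict (hv.locallyIntegrable hp)

/-! ### Weak partial derivatives -/

section WeakPartial

variable {U V : Set E3} {i : Fin 3} {u v u' v' : E3 → ℝ}

/-- The difference of two candidates integrates to zero against every test function, so the
fundamental lemma of the calculus of variations applies. -/
lemma HasWeakPartial.unique (hU : IsOpen U) (h : HasWeakPartial U i u v)
    (h' : HasWeakPartial U i u v') : v =ᵐ[volume.restrict U] v' := by
  have key := hU.ae_eq_zero_of_integral_contDiff_smul_eq_zero (h.2.1.sub h'.2.1) (μ := volume) ?_
  · rw [Filter.EventuallyEq, ae_restrict_iff' hU.measurableSet]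
    filter_upwards [key] with x hx hxU
    exact sub_eq_zero.1 (hx hxU)
  · intro g hg hgc hgU
    have ht : IsTest U g := ⟨⟨hg, hgc⟩, hgU⟩
    have e1 := h.2.2 g ht
    have e2 := h'.2.2 g ht
    have i1 := (h.2.1.integrable_mul_test ht)
    have i2 := (h'.2.1.integrable_mul_test ht)
    have e3 : ∫ x, g x • (v - v') x = ∫ x in U, g x • (v - v') x := by
      rw [setIntegral_eq_integral_of_forall_compl_eq_zero]
      intro x hx
      have : g x = 0 := image_eq_zero_of_notMem_tsupport fun h => hx (hgU h)
      simp [this]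
    rw [e3]
    have e4 : ∫ x in U, g x • (v - v') x = ∫ x in U, (v x * g x - v' x * g x) := by
      congr 1; ext x; simp; ring
    rw [e4, integral_sub i1.integrableOn i2.integrableOn]
    linarith

lemma HasWeakPartial.congr (hU : IsOpen U) (h : HasWeakPartial U i u v)
    (hu : u =ᵐ[volume.restrict U] u') (hv : v =ᵐ[volume.restrict U] v') :
    HasWeakPartial U i u' v' := by
  refine ⟨h.1.congr_restrict hU hu, h.2.1.congr_restrict hU hv, fun φ hφ => ?_⟩
  have e1 : ∫ x in U, u' x * partialDeriv i φ x = ∫ x in U, u x * partialDeriv i φ x :=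
    integral_congr_ae (by filter_upwards [hu] with x hx; rw [hx])
  have e2 : ∫ x in U, v' x * φ x = ∫ x in U, v x * φ x :=
    integral_congr_ae (by filter_upwards [hv] with x hx; rw [hx])
  rw [e1, e2, h.2.2 φ hφ]

lemma HasWeakPartial.weakPartial (h : HasWeakPartial U i u v) :
    HasWeakPartial U i u (weakPartial U i u) := by
  have hex : ∃ v, HasWeakPartial U i u v := ⟨v, h⟩
  rw [Waveguide.weakPartial, dif_pos hex]
  exact hex.choose_spec

lemma HasWeakPartial.weakPartial_ae (hU : IsOpen U) (h : HasWeakPartial U i u v) :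
    Waveguide.weakPartial U i u =ᵐ[volume.restrict U] v :=
  h.weakPartial.unique hU h

lemma HasWeakPartial.add (h : HasWeakPartial U i u v) (h' : HasWeakPartial U i u' v') :
    HasWeakPartial U i (fun x => u x + u' x) (fun x => v x + v' x) := by
  refine ⟨h.1.add h'.1, h.2.1.add h'.2.1, fun φ hφ => ?_⟩
  simp only [add_mul]
  rw [integral_add (h.1.integrable_mul_test (hφ.partialDeriv i)).integrableOn
    (h'.1.integrable_mul_test (hφ.partialDeriv i)).integrableOn,
    integral_add (h.2.1.integrable_mul_test hφ).integrableOn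
    (h'.2.1.integrable_mul_test hφ).integrableOn, h.2.2 φ hφ, h'.2.2 φ hφ]
  ring

lemma HasWeakPartial.neg (h : HasWeakPartial U i u v) :
    HasWeakPartial U i (fun x => -u x) (fun x => -v x) := by
  refine ⟨h.1.neg, h.2.1.neg, fun φ hφ => ?_⟩
  simp only [neg_mul, integral_neg, h.2.2 φ hφ]

lemma HasWeakPartial.sub (h : HasWeakPartial U i u v) (h' : HasWeakPartial U i u' v') :
    HasWeakPartial U i (fun x => u x - u' x) (fun x => v x - v' x) := by
  simpa only [sub_eq_add_neg] using h.add h'.neg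

lemma HasWeakPartial.mono (h : HasWeakPartial U i u v)
    (hVU : V ⊆ U) : HasWeakPartial V i u v := by
  refine ⟨h.1.mono_set hVU, h.2.1.mono_set hVU, fun φ hφ => ?_⟩
  have key : ∀ (w ψ : E3 → ℝ), IsTest V ψ → ∫ x in V, w x * ψ x = ∫ x in U, w x * ψ x := by
    intro w ψ hψ
    rw [setIntegral_eq_integral_of_forall_compl_eq_zero,
      setIntegral_eq_integral_of_forall_compl_eq_zero]
    · intro x hx
      rw [image_eq_zero_of_notMem_tsupport fun h => hx (hVU (hψ.2 h)), mul_zero]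
    · intro x hx
      rw [image_eq_zero_of_notMem_tsupport fun h => hx (hψ.2 h), mul_zero]
  rw [key _ _ (hφ.partialDeriv i), key _ _ hφ, h.2.2 φ (hφ.mono hVU)]

end WeakPartial

/-! ### Lipschitz functions -/

lemma lineDeriv_eq_partialDeriv {φ : E3 → ℝ} (h : Differentiable ℝ φ) (i : Fin 3) (x : E3) :
    lineDeriv ℝ φ x (EuclideanSpace.single i 1) = partialDeriv i φ x :=
  (h x).lineDeriv_eq_fderiv

/-- Integration by parts between Lipschitz functions. Line derivatives replace `fderiv` because such
functions are differentiable only almost everywhere. This identity is the source of all the weak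
derivatives of explicit functions below. -/
lemma LipschitzWith.hasWeakPartial_lineDeriv {g : E3 → ℝ} {L : ℝ≥0} (hg : LipschitzWith L g)
    {ψ : E3 → ℝ} {D : ℝ≥0} (hψ : LipschitzWith D ψ) (hc : HasCompactSupport ψ)
    (i : Fin 3) :
    ∫ x, g x * lineDeriv ℝ ψ x (EuclideanSpace.single i 1) =
      - ∫ x, lineDeriv ℝ g x (EuclideanSpace.single i 1) * ψ x := by
  have := hg.integral_lineDeriv_mul_eq (μ := volume) hψ hc (EuclideanSpace.single i 1)
  rw [this, ← integral_neg]
  congr 1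
  ext x
  rw [lineDeriv_neg]
  ring


/-! ### Mollification of Lipschitz functions -/

/-- The convolution of `f` with the normalised bump function `ρ`. -/
noncomputable def mollify (ρ : ContDiffBump (0 : E3)) (f : E3 → ℝ) : E3 → ℝ :=
  MeasureTheory.convolution (ρ.normed volume) f (ContinuousLinearMap.lsmul ℝ ℝ) volume

lemma mollify_apply (ρ : ContDiffBump (0 : E3)) (f : E3 → ℝ) (x : E3) :
    mollify ρ f x = ∫ t, ρ.normed volume t * f (x - t) := rfl

section Mollify

variable {ρ : ContDiffBump (0 : E3)} {f : E3 → ℝ} {L : ℝ≥0}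

lemma integrable_mollify (ρ : ContDiffBump (0 : E3)) (hf : Continuous f) (x : E3) :
    Integrable fun t => ρ.normed volume t * f (x - t) := by
  apply Continuous.integrable_of_hasCompactSupport
  · exact ρ.continuous_normed.mul (by fun_prop)
  · exact ρ.hasCompactSupport_normed.mul_right

lemma contDiff_mollify (ρ : ContDiffBump (0 : E3)) (hf : Continuous f) :
    ContDiff ℝ ((⊤ : ℕ∞) : WithTop ℕ∞) (mollify ρ f) :=
  ρ.hasCompactSupport_normed.contDiff_convolution_left _ (ρ.contDiff_normed)
    hf.locallyIntegrable

lemma lipschitzWith_mollify (ρ : ContDiffBump (0 : E3)) (hf : LipschitzWith L f) :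
    LipschitzWith L (mollify ρ f) := by
  refine LipschitzWith.of_dist_le_mul fun x y => ?_
  rw [mollify_apply, mollify_apply, Real.dist_eq, ← integral_sub
    (integrable_mollify ρ hf.continuous x) (integrable_mollify ρ hf.continuous y)]
  have h1 : ∀ t, ‖ρ.normed volume t * f (x - t) - ρ.normed volume t * f (y - t)‖ ≤
      ρ.normed volume t * (L * dist x y) := by
    intro t
    rw [← mul_sub, norm_mul, Real.norm_of_nonneg (ρ.nonneg_normed t)]
    gcongr
    · exact ρ.nonneg_normed t
    · have := hf.dist_le_mul (x - t) (y - t)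
      rwa [dist_sub_right, Real.dist_eq] at this
  have h2 := norm_integral_le_of_norm_le (ρ.integrable_normed.mul_const (L * dist x y))
    (Eventually.of_forall h1)
  rwa [integral_mul_const, ρ.integral_normed, one_mul] at h2

lemma abs_mollify_sub_le (ρ : ContDiffBump (0 : E3)) (hf : LipschitzWith L f) (x : E3) :
    |mollify ρ f x - f x| ≤ L * ρ.rOut := by
  have := ρ.dist_normed_convolution_le (μ := volume) (g := f) (x₀ := x) (ε := L * ρ.rOut)
    hf.continuous.aestronglyMeasurable ?_
  · exact this
  · intro y hy
    exact (hf.dist_le_mul y x).trans (by gcongr; exact (Metric.mem_ball.1 hy).le)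

lemma support_mollify_subset (ρ : ContDiffBump (0 : E3)) (f : E3 → ℝ) :
    Function.support (mollify ρ f) ⊆ Metric.cthickening ρ.rOut (tsupport f) := by
  intro x hx
  by_contra hx'
  apply hx
  rw [mollify_apply]
  apply integral_eq_zero_of_ae
  refine Eventually.of_forall fun t => ?_
  by_cases ht : ρ.normed volume t = 0
  · simp [ht]
  · have ht' : t ∈ Metric.ball (0 : E3) ρ.rOut := by
      rw [← ρ.support_normed_eq (μ := volume)]; exact ht
    have : f (x - t) = 0 := by
      by_contra hne
      apply hx'
      refine Metric.mem_cthickening_of_dist_le x (x - t) _ _ (subset_tsupport _ hne) ?_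
      rw [dist_eq_norm]
      simpa using (mem_ball_zero_iff.1 ht').le
    simp [this]

/-- The derivative first falls on the bump function and is then moved back onto `f` by integration
by parts, which is legitimate for Lipschitz `f`. The reflection `t ↦ x - t` accounts for the sign
that cancels. -/
lemma partialDeriv_mollify (ρ : ContDiffBump (0 : E3)) (hf : LipschitzWith L f) (i : Fin 3)
    (x : E3) : partialDeriv i (mollify ρ f) x =
      mollify ρ (fun y => lineDeriv ℝ f y (EuclideanSpace.single i 1)) x := by
  have hρ : ContDiff ℝ ((⊤ : ℕ∞) : WithTop ℕ∞) (ρ.normed volume) := ρ.contDiff_normed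
  have hsc : IsSmoothCompact (ρ.normed volume) := ⟨hρ, ρ.hasCompactSupport_normed⟩
  have h1 := ρ.hasCompactSupport_normed.hasFDerivAt_convolution_left (μ := volume)
    (ContinuousLinearMap.lsmul ℝ ℝ) (hρ.of_le (by simp))
    (hf.continuous.locallyIntegrable (μ := volume)) x
  rw [partialDeriv, mollify, h1.fderiv, convolution]
  have hint : Integrable (fun t => ((ContinuousLinearMap.lsmul ℝ ℝ : ℝ →L[ℝ] ℝ →L[ℝ] ℝ).precompL E3
      (fderiv ℝ (ρ.normed volume) t)) (f (x - t)) : E3 → (E3 →L[ℝ] ℝ)) := by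
    have := (ρ.hasCompactSupport_normed (μ := volume)).fderiv (𝕜 := ℝ) |>.convolutionExists_left
      ((ContinuousLinearMap.lsmul ℝ ℝ : ℝ →L[ℝ] ℝ →L[ℝ] ℝ).precompL E3)
      (hρ.continuous_fderiv (by simp)) (hf.continuous.locallyIntegrable (μ := volume)) x
    exact this
  rw [ContinuousLinearMap.integral_apply hint]
  have hLip : LipschitzWith L (fun t => f (x - t)) := by
    refine LipschitzWith.of_dist_le_mul fun a b => ?_
    simpa [dist_eq_norm, norm_sub_rev] using hf.dist_le_mul (x - a) (x - b)
  obtain ⟨D, hD⟩ := hsc.lipschitz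
  have h2 := LipschitzWith.hasWeakPartial_lineDeriv hLip hD hsc.2 i
  have h3 : ∀ t, lineDeriv ℝ (fun t => f (x - t)) t (EuclideanSpace.single i 1) =
      - lineDeriv ℝ f (x - t) (EuclideanSpace.single i 1) := by
    intro t
    rw [← lineDeriv_neg]
    simp only [lineDeriv]
    congr 1
    ext s
    congr 1
    rw [smul_neg]; abel
  simp only [h3, neg_mul, integral_neg, neg_neg, lineDeriv_eq_partialDeriv hsc.differentiable] at h2
  rw [mollify_apply]
  calc _ = ∫ t, f (x - t) * partialDeriv i (ρ.normed volume) t := by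
        congr 1; ext t
        simp [ContinuousLinearMap.precompL_apply, partialDeriv, mul_comm]
    _ = _ := by rw [h2]; congr 1; ext t; ring

end Mollify

/-- A Lipschitz function on `ℝ³` is a uniform limit of smooth functions with the same Lipschitz
constant. -/
lemma exists_contDiff_lipschitz_approx {f : E3 → ℝ} {L : ℝ≥0} (hf : LipschitzWith L f) {δ : ℝ}
    (hδ : 0 < δ) : ∃ g : E3 → ℝ, ContDiff ℝ ((⊤ : ℕ∞) : WithTop ℕ∞) g ∧ LipschitzWith L g ∧
      ∀ x, |g x - f x| ≤ δ := by
  have hr : 0 < δ / (L + 1) := by positivity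
  let ρ : ContDiffBump (0 : E3) := ⟨δ / (L + 1) / 2, δ / (L + 1), by positivity, by linarith⟩
  refine ⟨mollify ρ f, contDiff_mollify ρ hf.continuous, lipschitzWith_mollify ρ hf, fun x => ?_⟩
  refine (abs_mollify_sub_le ρ hf x).trans ?_
  change L * (δ / (L + 1)) ≤ δ
  rw [mul_div_assoc', div_le_iff₀ (by positivity)]
  nlinarith [L.2]

/-! ### The product rule with a Lipschitz factor -/

lemma abs_lineDeriv_le_of_lipschitz {f : E3 → ℝ} {L : ℝ≥0} (hf : LipschitzWith L f)
    (i : Fin 3) (x : E3) : |lineDeriv ℝ f x (EuclideanSpace.single i 1)| ≤ L := by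
  have := norm_lineDeriv_le_of_lipschitz ℝ (x₀ := x) (v := EuclideanSpace.single i (1:ℝ)) hf
  simpa using this

/-- The defining identity of weak derivatives holds for Lipschitz test functions. -/
lemma HasWeakPartial.integral_lipschitz_test {U : Set E3} (hU : IsOpen U) {i : Fin 3}
    {w w' ψ : E3 → ℝ} (h : HasWeakPartial U i w w') {L : ℝ≥0} (hψ : LipschitzWith L ψ)
    (hc : HasCompactSupport ψ) (hs : tsupport ψ ⊆ U) :
    ∫ x, w x * lineDeriv ℝ ψ x (EuclideanSpace.single i 1) = - ∫ x, w' x * ψ x := by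
  -- Mollification radii `δ / (n + 1)` keep the supports in one compact neighbourhood `K ⊆ U` of the
  -- support of `ψ`, so every mollification is an admissible test function.
  obtain ⟨δ, hδ, hδU⟩ := IsCompact.exists_cthickening_subset_open hc hU hs
  set K := Metric.cthickening δ (tsupport ψ) with hKdef
  have hK : IsCompact K := IsCompact.cthickening hc
  let r : ℕ → ℝ := fun n => δ / (n + 1)
  have hr : ∀ n, 0 < r n := fun n => by positivity
  have hrδ : ∀ n, r n ≤ δ := fun n => div_le_self hδ.le (by linarith [n.cast_nonneg (α := ℝ)])
  let ρ : ℕ → ContDiffBump (0 : E3) := fun n => ⟨r n / 2, r n, by have := hr n; positivity,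
    by have := hr n; linarith⟩
  have hρ0 : Tendsto (fun n => (ρ n).rOut) atTop (𝓝 0) :=
    tendsto_const_div_atTop_nhds_zero_nat δ |>.comp (tendsto_add_atTop_nat 1) |>.congr
      fun n => by simp [ρ, r]
  have hsupp : ∀ n, tsupport (mollify (ρ n) ψ) ⊆ K := fun n =>
    closure_minimal ((support_mollify_subset _ _).trans
      (Metric.cthickening_mono (hrδ n) _)) hK.isClosed
  have htest : ∀ n, IsTest U (mollify (ρ n) ψ) := fun n =>
    ⟨⟨contDiff_mollify _ hψ.continuous, hK.of_isClosed_subset (isClosed_tsupport _) (hsupp n)⟩,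
      (hsupp n).trans hδU⟩
  obtain ⟨C, hC⟩ := hc.exists_bound_of_continuous hψ.continuous
  have hm := stronglyMeasurable_lineDeriv (𝕜 := ℝ) (v := EuclideanSpace.single i (1:ℝ))
    hψ.continuous
  have hbd : ∀ n x, |mollify (ρ n) ψ x| ≤ C + L * δ := by
    intro n x
    have h1 := abs_mollify_sub_le (ρ n) hψ x
    have h2 : |ψ x| ≤ C := hC x
    have h3 : (L : ℝ) * (ρ n).rOut ≤ L * δ := by gcongr; exact hrδ n
    calc _ = |(mollify (ρ n) ψ x - ψ x) + ψ x| := by ring_nf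
      _ ≤ _ := (abs_add_le _ _).trans (by linarith)
  have hwK : Integrable (K.indicator fun x => w x) :=
    (h.1.integrableOn_compact_subset hδU hK).integrable_indicator hK.measurableSet
  have hwK' : Integrable (K.indicator fun x => w' x) :=
    (h.2.1.integrableOn_compact_subset hδU hK).integrable_indicator hK.measurableSet
  have hfull : ∀ n, ∫ x, w x * partialDeriv i (mollify (ρ n) ψ) x =
      - ∫ x, w' x * mollify (ρ n) ψ x := by
    intro n
    have := h.2.2 _ (htest n)
    rwa [setIntegral_eq_integral_of_forall_compl_eq_zero,
      setIntegral_eq_integral_of_forall_compl_eq_zero] at this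
    · intro x hx
      rw [image_eq_zero_of_notMem_tsupport fun h => hx ((htest n).2 h), mul_zero]
    · intro x hx
      rw [image_eq_zero_of_notMem_tsupport fun h => hx (((htest n).partialDeriv i).2 h), mul_zero]
  have hlim1 : Tendsto (fun n => ∫ x, w x * partialDeriv i (mollify (ρ n) ψ) x) atTop
      (𝓝 (∫ x, w x * lineDeriv ℝ ψ x (EuclideanSpace.single i 1))) := by
    refine tendsto_integral_of_dominated_convergence
      (fun x => ‖K.indicator (fun x => w x) x‖ * L) ?_ (hwK.norm.mul_const _) ?_ ?_
    · intro n
      exact (h.1.integrable_mul_test ((htest n).partialDeriv i)).aestronglyMeasurable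
    · intro n
      refine Eventually.of_forall fun x => ?_
      by_cases hx : x ∈ K
      · rw [norm_mul, indicator_of_mem hx]
        gcongr
        exact abs_partialDeriv_le_of_lipschitz (lipschitzWith_mollify _ hψ) i x
      · rw [image_eq_zero_of_notMem_tsupport (f := partialDeriv i (mollify (ρ n) ψ))
          fun h => hx (hsupp n (tsupport_partialDeriv_subset _ _ h))]
        simp [indicator_of_notMem hx]
    · have hli : LocallyIntegrable
          (fun x => lineDeriv ℝ ψ x (EuclideanSpace.single i (1:ℝ))) (volume : Measure E3) := by
        refine (continuous_const (y := (L:ℝ))).locallyIntegrable.mono hm.aestronglyMeasurable ?_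
        refine Eventually.of_forall fun x => ?_
        simpa using abs_lineDeriv_le_of_lipschitz hψ i x
      -- The derivative of the mollification is the mollification of the derivative; it converges
      -- almost everywhere by Lebesgue differentiation, for which the ratio of outer to inner radius
      -- must stay bounded (here it is `2`).
      filter_upwards [ContDiffBump.ae_convolution_tendsto_right_of_locallyIntegrable (K := 2)
        hρ0 (Eventually.of_forall fun n => by change r n ≤ 2 * (r n / 2); linarith) hli] with x hx
      simp only [partialDeriv_mollify _ hψ]
      exact hx.const_mul (w x)
  have hlim2 : Tendsto (fun n => ∫ x, w' x * mollify (ρ n) ψ x) atTop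
      (𝓝 (∫ x, w' x * ψ x)) := by
    refine tendsto_integral_of_dominated_convergence
      (fun x => ‖K.indicator (fun x => w' x) x‖ * (C + L * δ)) ?_ (hwK'.norm.mul_const _) ?_ ?_
    · intro n
      exact (h.2.1.integrable_mul_test (htest n)).aestronglyMeasurable
    · intro n
      refine Eventually.of_forall fun x => ?_
      by_cases hx : x ∈ K
      · rw [norm_mul, indicator_of_mem hx]
        gcongr
        exact hbd n x
      · rw [image_eq_zero_of_notMem_tsupport (f := mollify (ρ n) ψ) fun h => hx (hsupp n h)]
        simp [indicator_of_notMem hx]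
    · refine Eventually.of_forall fun x => ?_
      exact (ContDiffBump.convolution_tendsto_right_of_continuous hρ0 hψ.continuous x).const_mul _
  exact tendsto_nhds_unique hlim1 (hlim2.neg.congr fun n => (hfull n).symm)

/-- The weak product rule with a factor that is Lipschitz on the open set `U`. -/
lemma exists_lipschitz_mul_hasWeakPartial {U : Set E3} (hU : IsOpen U) {g : E3 → ℝ} {L : ℝ≥0}
    (hg : LipschitzOnWith L g U) (i : Fin 3) :
    ∃ g' : E3 → ℝ, Measurable g' ∧ (∀ x, |g' x| ≤ L) ∧ ∀ w w', HasWeakPartial U i w w' →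
      HasWeakPartial U i (fun x => g x * w x) (fun x => g x * w' x + g' x * w x) := by
  -- A Lipschitz extension to all of `ℝ³` makes the derivative of the factor measurable and defined
  -- everywhere, and independent of the function `w` that it multiplies.
  obtain ⟨G, hG, hgG⟩ := hg.extend_real
  have hm := stronglyMeasurable_lineDeriv (𝕜 := ℝ) (v := EuclideanSpace.single i (1:ℝ))
    hG.continuous
  refine ⟨fun x => lineDeriv ℝ G x (EuclideanSpace.single i 1), hm.measurable,
    abs_lineDeriv_le_of_lipschitz hG i, fun w w' h => ?_⟩
  have main : HasWeakPartial U i (fun x => G x * w x)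
      (fun x => G x * w' x + lineDeriv ℝ G x (EuclideanSpace.single i 1) * w x) := by
    have l1 : LocallyIntegrableOn (fun x => G x * w x) U :=
      h.1.continuousOn_mul hG.continuous.continuousOn hU.isLocallyClosed
    have l2 : LocallyIntegrableOn (fun x => G x * w' x) U :=
      h.2.1.continuousOn_mul hG.continuous.continuousOn hU.isLocallyClosed
    have l3 : LocallyIntegrableOn
        (fun x => lineDeriv ℝ G x (EuclideanSpace.single i 1) * w x) U := by
      have := h.1.mul_bounded hU hm.aestronglyMeasurable (abs_lineDeriv_le_of_lipschitz hG i)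
      simpa only [mul_comm] using this
    refine ⟨l1, l2.add l3, fun φ hφ => ?_⟩
    obtain ⟨D, hD⟩ := hφ.1.lipschitz
    obtain ⟨B, hB⟩ := hφ.1.bounded
    obtain ⟨BG, hBG⟩ := hφ.1.2.exists_bound_of_continuousOn hG.continuous.continuousOn
    have hBG' : ∀ x ∈ tsupport φ, |G x| ≤ BG := hBG
    -- the Lipschitz test function
    have hψ : ∃ D', LipschitzWith D' (fun x => G x * φ x) := by
      refine ⟨Real.toNNReal (|BG| * D + L * |B|), LipschitzWith.of_dist_le_mul fun x y => ?_⟩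
      rw [Real.coe_toNNReal _ (by positivity)]
      have key : ∀ x y, x ∈ tsupport φ → dist (G x * φ x) (G y * φ y) ≤
          (|BG| * D + L * |B|) * dist x y := by
        intro x y hx
        rw [Real.dist_eq]
        calc |G x * φ x - G y * φ y| = |G x * (φ x - φ y) + (G x - G y) * φ y| := by ring_nf
          _ ≤ |G x| * |φ x - φ y| + |G x - G y| * |φ y| := by
            rw [← abs_mul, ← abs_mul]; exact abs_add_le _ _
          _ ≤ |BG| * (D * dist x y) + L * dist x y * |B| := by
            have a1 := hD.dist_le_mul x y
            have a2 := hG.dist_le_mul x y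
            rw [Real.dist_eq] at a1 a2
            have a3 := (hBG' x hx).trans (le_abs_self _)
            have a4 := (hB y).trans (le_abs_self _)
            gcongr
          _ = _ := by ring
      by_cases hx : x ∈ tsupport φ
      · exact key x y hx
      by_cases hy : y ∈ tsupport φ
      · rw [dist_comm, dist_comm x y]; exact key y x hy
      · rw [image_eq_zero_of_notMem_tsupport hx, image_eq_zero_of_notMem_tsupport hy]
        simp only [mul_zero, dist_self]; positivity
    obtain ⟨D', hD'⟩ := hψ
    have hsub : tsupport (fun x => G x * φ x) ⊆ tsupport φ := tsupport_mul_subset_right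
    have hid := h.integral_lipschitz_test hU hD' hφ.1.2.mul_left (hsub.trans hφ.2)
    have hae : ∀ᵐ x : E3, lineDeriv ℝ (fun x => G x * φ x) x (EuclideanSpace.single i 1) =
        G x * partialDeriv i φ x + lineDeriv ℝ G x (EuclideanSpace.single i 1) * φ x := by
      filter_upwards [hG.ae_lineDifferentiableAt (μ := volume) (EuclideanSpace.single i 1)] with x hx
      have h1 := hx.hasLineDerivAt
      have h2 := ((hφ.1.differentiable x).hasFDerivAt.hasLineDerivAt (EuclideanSpace.single i 1))
      have h3 := HasDerivAt.mul h1 h2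
      simp only [zero_smul, add_zero] at h3
      have h4 : HasLineDerivAt ℝ (fun x => G x * φ x) (lineDeriv ℝ G x (EuclideanSpace.single i 1)
          * φ x + G x * (fderiv ℝ φ x) (EuclideanSpace.single i 1)) x
          (EuclideanSpace.single i 1) := h3
      rw [h4.lineDeriv, partialDeriv]; ring
    have e1 : ∫ x, w x * lineDeriv ℝ (fun x => G x * φ x) x (EuclideanSpace.single i 1) =
        (∫ x, G x * w x * partialDeriv i φ x) +
          ∫ x, lineDeriv ℝ G x (EuclideanSpace.single i 1) * w x * φ x := by
      rw [← integral_add (l1.integrable_mul_test (hφ.partialDeriv i)) (l3.integrable_mul_test hφ)]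
      refine integral_congr_ae ?_
      filter_upwards [hae] with x hx
      rw [hx]; ring
    have z : ∀ (v ψ : E3 → ℝ), IsTest U ψ → ∫ x in U, v x * ψ x = ∫ x, v x * ψ x := by
      intro v ψ hψ
      rw [setIntegral_eq_integral_of_forall_compl_eq_zero]
      intro x hx
      rw [image_eq_zero_of_notMem_tsupport fun h => hx (hψ.2 h), mul_zero]
    rw [z _ _ (hφ.partialDeriv i), z _ _ hφ]
    simp only [add_mul]
    rw [integral_add (l2.integrable_mul_test hφ) (l3.integrable_mul_test hφ)]
    have e2 : ∫ x, w' x * (G x * φ x) = ∫ x, G x * w' x * φ x := by congr 1; ext x; ring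
    rw [e1, e2] at hid
    linarith
  refine main.congr hU ?_ ?_ <;>
  · filter_upwards [ae_restrict_mem hU.measurableSet] with x hx
    rw [hgG hx]


/-! ### `L²` norms -/

section L2

variable {U V : Set E3} {f g : E3 → ℝ}

lemma L2Norm_sq (U : Set E3) (f : E3 → ℝ) : L2Norm U f ^ 2 = ∫⁻ x in U, ‖f x‖ₑ ^ 2 := by
  rw [L2Norm, eLpNorm_eq_lintegral_rpow_enorm_toReal (by simp) (by simp), ← ENNReal.rpow_natCast,
    ← ENNReal.rpow_mul]
  simp

lemma L2Norm_sq_eq_ofReal (hf : MemLp f 2 (volume.restrict U)) :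
    L2Norm U f ^ 2 = ENNReal.ofReal (∫ x in U, f x ^ 2) := by
  rw [L2Norm_sq, ofReal_integral_eq_lintegral_ofReal hf.integrable_sq
    (Eventually.of_forall fun x => sq_nonneg _)]
  congr 1
  ext x
  rw [Real.enorm_eq_ofReal_abs, ← ENNReal.ofReal_pow (abs_nonneg _), sq_abs]

lemma L2Norm_congr (h : f =ᵐ[volume.restrict U] g) : L2Norm U f = L2Norm U g :=
  eLpNorm_congr_ae h

lemma L2Norm_mono_set (h : V ⊆ U) (f : E3 → ℝ) : L2Norm V f ≤ L2Norm U f :=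
  eLpNorm_mono_measure _ (Measure.restrict_mono h le_rfl)

lemma L2Norm_add_le (hf : AEStronglyMeasurable f (volume.restrict U))
    (hg : AEStronglyMeasurable g (volume.restrict U)) :
    L2Norm U (fun x => f x + g x) ≤ L2Norm U f + L2Norm U g :=
  eLpNorm_add_le hf hg (by norm_num)

lemma L2Norm_sub_le (hf : AEStronglyMeasurable f (volume.restrict U))
    (hg : AEStronglyMeasurable g (volume.restrict U)) :
    L2Norm U (fun x => f x - g x) ≤ L2Norm U f + L2Norm U g :=
  eLpNorm_sub_le hf hg (by norm_num)

lemma L2Norm_sub_comm (U : Set E3) (f g : E3 → ℝ) :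
    L2Norm U (fun x => f x - g x) = L2Norm U (fun x => g x - f x) :=
  eLpNorm_sub_comm f g 2 _

lemma L2Norm_mul_le (hU : MeasurableSet U) {c : ℝ≥0} (hf : ∀ x ∈ U, |f x| ≤ c) :
    L2Norm U (fun x => f x * g x) ≤ c * L2Norm U g := by
  have := eLpNorm_le_nnreal_smul_eLpNorm_of_ae_le_mul (μ := volume.restrict U)
    (f := fun x => f x * g x) (g := g) (c := c) ?_ 2
  · simpa [L2Norm, ENNReal.smul_def] using this
  · filter_upwards [ae_restrict_mem hU] with x hx
    rw [nnnorm_mul]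
    gcongr
    exact_mod_cast hf x hx

lemma L2Norm_eq_zero_iff (hf : AEStronglyMeasurable f (volume.restrict U)) :
    L2Norm U f = 0 ↔ f =ᵐ[volume.restrict U] 0 :=
  eLpNorm_eq_zero_iff hf (by simp)

/-- By Cauchy–Schwarz, `L²` convergence of one factor gives `L¹` convergence of the product. -/
lemma tendsto_integral_mul_of_L2 {h : E3 → ℝ} {k : ℕ → E3 → ℝ}
    (hg : MemLp g 2 (volume.restrict U)) (hh : MemLp h 2 (volume.restrict U))
    (hk : ∀ n, MemLp (k n) 2 (volume.restrict U))
    (hlim : Tendsto (fun n => L2Norm U (fun x => h x - k n x)) atTop (𝓝 0)) :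
    Tendsto (fun n => ∫ x in U, g x * k n x) atTop (𝓝 (∫ x in U, g x * h x)) := by
  refine tendsto_integral_of_L1' (fun x => g x * h x) (hg.integrable_mul hh).1
    (Eventually.of_forall fun n => hg.integrable_mul (hk n)) ?_
  have hbound : ∀ n, eLpNorm ((fun x => g x * k n x) - fun x => g x * h x) 1 (volume.restrict U) ≤
      L2Norm U g * L2Norm U (fun x => h x - k n x) := by
    intro n
    have := eLpNorm_smul_le_mul_eLpNorm (p := 2) (q := 2) (r := 1) (hh.sub (hk n)).1 hg.1
    rw [← eLpNorm_neg]
    refine le_trans (le_of_eq ?_) this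
    congr 1
    ext x
    simp only [Pi.neg_apply, Pi.sub_apply, Pi.smul_apply', smul_eq_mul]
    ring
  refine tendsto_of_tendsto_of_tendsto_of_le_of_le tendsto_const_nhds ?_ (fun _ => zero_le) hbound
  have := ENNReal.Tendsto.const_mul (a := L2Norm U g) hlim (Or.inr hg.2.ne)
  simpa using this

end L2

/-! ### Functions with square integrable gradient -/

/-- `u ∈ H¹(U)` with gradient `p`. -/
structure HasGrad (U : Set E3) (u : E3 → ℝ) (p : Fin 3 → E3 → ℝ) : Prop where
  memLp : MemLp u 2 (volume.restrict U)
  memLp_grad : ∀ i, MemLp (p i) 2 (volume.restrict U)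
  weak : ∀ i, HasWeakPartial U i u (p i)

/-- The sequence `φ` of smooth functions converges in `H¹(U)` to `u`, whose gradient is `p`. -/
def H1Tendsto (U : Set E3) (φ : ℕ → E3 → ℝ) (u : E3 → ℝ) (p : Fin 3 → E3 → ℝ) : Prop :=
  Tendsto (fun n => L2Norm U (fun x => u x - φ n x)) atTop (𝓝 0) ∧
    ∀ i, Tendsto (fun n => L2Norm U (fun x => p i x - partialDeriv i (φ n) x)) atTop (𝓝 0)

/-- `u ∈ H¹₀(U)` with gradient `p`. -/
structure HasGrad0 (U : Set E3) (u : E3 → ℝ) (p : Fin 3 → E3 → ℝ) : Prop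
    extends HasGrad U u p where
  exists_seq : ∃ φ : ℕ → E3 → ℝ, (∀ n, IsTest U (φ n)) ∧ H1Tendsto U φ u p

section HasGrad

variable {U V : Set E3} {u u' : E3 → ℝ} {p p' : Fin 3 → E3 → ℝ}

lemma HasGrad.memH1 (h : HasGrad U u p) : MemH1 U u :=
  ⟨h.memLp, fun i => ⟨p i, h.weak i, h.memLp_grad i⟩⟩

lemma MemH1.hasGrad (hU : IsOpen U) (h : MemH1 U u) :
    HasGrad U u (fun i => weakPartial U i u) where
  memLp := h.1
  memLp_grad i := by
    obtain ⟨v, hv, hv2⟩ := h.2 i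
    exact (memLp_congr_ae (hv.weakPartial_ae hU)).2 hv2
  weak i := (h.2 i).choose_spec.1.weakPartial

lemma HasGrad.weakPartial_ae (hU : IsOpen U) (h : HasGrad U u p) (i : Fin 3) :
    weakPartial U i u =ᵐ[volume.restrict U] p i :=
  (h.weak i).weakPartial_ae hU

lemma HasGrad.congr (hU : IsOpen U) (h : HasGrad U u p) (hu : u =ᵐ[volume.restrict U] u')
    (hp : ∀ i, p i =ᵐ[volume.restrict U] p' i) : HasGrad U u' p' where
  memLp := (memLp_congr_ae hu).1 h.memLp
  memLp_grad i := (memLp_congr_ae (hp i)).1 (h.memLp_grad i)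
  weak i := (h.weak i).congr hU hu (hp i)

lemma HasGrad.sub (h : HasGrad U u p) (h' : HasGrad U u' p') :
    HasGrad U (fun x => u x - u' x) (fun i x => p i x - p' i x) where
  memLp := h.memLp.sub h'.memLp
  memLp_grad i := (h.memLp_grad i).sub (h'.memLp_grad i)
  weak i := (h.weak i).sub (h'.weak i)

lemma HasGrad.mono (h : HasGrad U u p) (hVU : V ⊆ U) : HasGrad V u p where
  memLp := h.memLp.mono_measure (Measure.restrict_mono hVU le_rfl)
  memLp_grad i := (h.memLp_grad i).mono_measure (Measure.restrict_mono hVU le_rfl)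
  weak i := (h.weak i).mono hVU

lemma IsSmoothCompact.hasWeakPartial {φ : E3 → ℝ} (h : IsSmoothCompact φ) (U : Set E3)
    (i : Fin 3) : HasWeakPartial U i φ (Waveguide.partialDeriv i φ) := by
  refine ⟨h.continuous.locallyIntegrable.locallyIntegrableOn U,
    (h.partialDeriv i).continuous.locallyIntegrable.locallyIntegrableOn U, fun ψ hψ => ?_⟩
  obtain ⟨C, hC⟩ := h.lipschitz
  obtain ⟨D, hD⟩ := hψ.1.lipschitz
  have key := LipschitzWith.hasWeakPartial_lineDeriv hC hD hψ.1.2 i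
  simp only [lineDeriv_eq_partialDeriv h.differentiable,
    lineDeriv_eq_partialDeriv hψ.1.differentiable] at key
  have z : ∀ (v φ : E3 → ℝ), IsTest U φ → ∫ x in U, v x * φ x = ∫ x, v x * φ x := by
    intro v φ hφ
    rw [setIntegral_eq_integral_of_forall_compl_eq_zero]
    intro x hx
    rw [image_eq_zero_of_notMem_tsupport fun h => hx (hφ.2 h), mul_zero]
  rw [z _ _ (hψ.partialDeriv i), z _ _ hψ, key]

lemma IsSmoothCompact.hasGrad {φ : E3 → ℝ} (h : IsSmoothCompact φ) (U : Set E3) :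
    HasGrad U φ (fun i => Waveguide.partialDeriv i φ) where
  memLp := h.memLp _ _
  memLp_grad i := (h.partialDeriv i).memLp _ _
  weak i := h.hasWeakPartial U i

lemma HasGrad.H1Norm_eq (hU : IsOpen U) (h : HasGrad U u p) :
    H1Norm U u = (L2Norm U u ^ 2 + ∑ i, L2Norm U (p i) ^ 2) ^ (1 / 2 : ℝ) := by
  rw [H1Norm]
  congr 2
  exact Finset.sum_congr rfl fun i _ => by rw [L2Norm_congr (h.weakPartial_ae hU i)]

/-- Bridges the norm of the definitions, with its square root and chosen derivatives, and the
componentwise convergence that the proofs use. -/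
lemma HasGrad.H1Norm_tendsto_iff (hU : IsOpen U) (h : HasGrad U u p) {φ : ℕ → E3 → ℝ}
    (hφ : ∀ n, IsSmoothCompact (φ n)) :
    Tendsto (fun n => H1Norm U (fun x => u x - φ n x)) atTop (𝓝 0) ↔ H1Tendsto U φ u p := by
  have e : ∀ n, H1Norm U (fun x => u x - φ n x) = (L2Norm U (fun x => u x - φ n x) ^ 2 +
      ∑ i, L2Norm U (fun x => p i x - partialDeriv i (φ n) x) ^ 2) ^ (1 / 2 : ℝ) :=
    fun n => (h.sub ((hφ n).hasGrad U)).H1Norm_eq hU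
  have sqrt_sq : ∀ a : ℝ≥0∞, (a ^ 2) ^ (1 / 2 : ℝ) = a := fun a => by
    rw [← ENNReal.rpow_natCast, ← ENNReal.rpow_mul]; simp
  simp only [e]
  constructor
  · intro ht
    refine ⟨?_, fun i => ?_⟩
    · refine tendsto_of_tendsto_of_tendsto_of_le_of_le tendsto_const_nhds ht
        (fun _ => zero_le) fun n => ?_
      conv_lhs => rw [← sqrt_sq (L2Norm U (fun x => u x - φ n x))]
      gcongr
      exact le_self_add
    · refine tendsto_of_tendsto_of_tendsto_of_le_of_le tendsto_const_nhds ht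
        (fun _ => zero_le) fun n => ?_
      conv_lhs => rw [← sqrt_sq (L2Norm U (fun x => p i x - partialDeriv i (φ n) x))]
      gcongr
      refine le_trans ?_ le_add_self
      exact Finset.single_le_sum (f := fun i => L2Norm U (fun x => p i x -
        partialDeriv i (φ n) x) ^ 2) (fun _ _ => zero_le) (Finset.mem_univ i)
  · rintro ⟨h1, h2⟩
    have h3 := (ENNReal.Tendsto.pow (n := 2) h1).add
      (tendsto_finsetSum Finset.univ fun i _ => ENNReal.Tendsto.pow (n := 2) (h2 i))
    have h4 := (ENNReal.continuous_rpow_const (y := (1 / 2 : ℝ))).tendsto _ |>.comp h3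
    simpa [Function.comp_def] using h4

lemma MemH10.hasGrad0 (hU : IsOpen U) (h : MemH10 U u) (hp : HasGrad U u p) : HasGrad0 U u p := by
  obtain ⟨h1, φ, hφ, hl⟩ := h
  exact ⟨hp, φ, hφ, (hp.H1Norm_tendsto_iff hU fun n => (hφ n).1).1 hl⟩

lemma HasGrad.hasGrad0_of_forall (h : HasGrad U u p)
    (happ : ∀ ε : ℝ≥0∞, 0 < ε → ∃ φ, IsTest U φ ∧ L2Norm U (fun x => u x - φ x) ≤ ε ∧
      ∀ i, L2Norm U (fun x => p i x - partialDeriv i φ x) ≤ ε) : HasGrad0 U u p := by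
  refine ⟨h, ?_⟩
  choose φ h1 h2 h3 using fun n : ℕ => happ ((n : ℝ≥0∞) + 1)⁻¹ (by simp)
  have ht : Tendsto (fun n : ℕ => ((n : ℝ≥0∞) + 1)⁻¹) atTop (𝓝 0) := by
    have := ENNReal.tendsto_inv_nat_nhds_zero.comp (tendsto_add_atTop_nat 1)
    simpa [Function.comp_def] using this
  exact ⟨φ, h1, tendsto_of_tendsto_of_tendsto_of_le_of_le tendsto_const_nhds ht
    (fun _ => zero_le) h2, fun i => tendsto_of_tendsto_of_tendsto_of_le_of_le
    tendsto_const_nhds ht (fun _ => zero_le) fun n => h3 n i⟩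

lemma H1Tendsto.add {φ φ' : ℕ → E3 → ℝ} (hφ : ∀ n, IsSmoothCompact (φ n))
    (hφ' : ∀ n, IsSmoothCompact (φ' n)) (hu : HasGrad U u p) (hu' : HasGrad U u' p')
    (h : H1Tendsto U φ u p) (h' : H1Tendsto U φ' u' p') :
    H1Tendsto U (fun n x => φ n x + φ' n x) (fun x => u x + u' x)
      (fun i x => p i x + p' i x) := by
  have sq : ∀ {a b c : ℕ → ℝ≥0∞}, Tendsto a atTop (𝓝 0) → Tendsto b atTop (𝓝 0) →
      (∀ n, c n ≤ a n + b n) → Tendsto c atTop (𝓝 0) := fun ha hb hc =>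
    tendsto_of_tendsto_of_tendsto_of_le_of_le tendsto_const_nhds (by simpa using ha.add hb)
      (fun _ => zero_le) hc
  refine ⟨sq h.1 h'.1 fun n => ?_, fun i => sq (h.2 i) (h'.2 i) fun n => ?_⟩
  · refine le_trans (le_of_eq ?_) (L2Norm_add_le (hu.memLp.sub ((hφ n).memLp 2 _)).1
      (hu'.memLp.sub ((hφ' n).memLp 2 _)).1)
    congr 1; ext x; simp; ring
  · refine le_trans (le_of_eq ?_) (L2Norm_add_le
      ((hu.memLp_grad i).sub (((hφ n).partialDeriv i).memLp 2 _)).1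
      ((hu'.memLp_grad i).sub (((hφ' n).partialDeriv i).memLp 2 _)).1)
    congr 1; ext x
    rw [partialDeriv_add i ((hφ n).differentiable x) ((hφ' n).differentiable x)]
    simp; ring

lemma H1Tendsto.neg {φ : ℕ → E3 → ℝ} (hφ : ∀ n, IsSmoothCompact (φ n))
    (h : H1Tendsto U φ u p) :
    H1Tendsto U (fun n x => -1 * φ n x) (fun x => -1 * u x) (fun i x => -1 * p i x) := by
  refine ⟨h.1.congr fun n => ?_, fun i => (h.2 i).congr fun n => ?_⟩
  · rw [L2Norm_sub_comm]; congr 1; ext x; ring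
  · rw [L2Norm_sub_comm]; congr 1; ext x
    rw [partialDeriv_const_mul _ _ ((hφ n).differentiable x)]; ring

lemma HasGrad.neg_one_mul (h : HasGrad U u p) :
    HasGrad U (fun x => -1 * u x) (fun i x => -1 * p i x) where
  memLp := h.memLp.const_mul _
  memLp_grad i := (h.memLp_grad i).const_mul _
  weak i := by simpa using (h.weak i).neg

lemma IsSmoothCompact.add {φ φ' : E3 → ℝ} (h : IsSmoothCompact φ) (h' : IsSmoothCompact φ') :
    IsSmoothCompact (fun x => φ x + φ' x) :=
  ⟨h.1.add h'.1, h.2.add h'.2⟩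

lemma IsSmoothCompact.const_mul {φ : E3 → ℝ} (h : IsSmoothCompact φ) (c : ℝ) :
    IsSmoothCompact (fun x => c * φ x) :=
  ⟨contDiff_const.mul h.1, h.2.mul_left⟩

lemma IsTest.add {φ φ' : E3 → ℝ} (h : IsTest U φ) (h' : IsTest U φ') :
    IsTest U (fun x => φ x + φ' x) :=
  ⟨h.1.add h'.1, (tsupport_add φ φ').trans (union_subset h.2 h'.2)⟩

lemma IsTest.const_mul {φ : E3 → ℝ} (h : IsTest U φ) (c : ℝ) :
    IsTest U (fun x => c * φ x) :=
  h.mul_left contDiff_const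

lemma IsSmoothCompact.sub {φ φ' : E3 → ℝ} (h : IsSmoothCompact φ) (h' : IsSmoothCompact φ') :
    IsSmoothCompact (fun x => φ x - φ' x) := by
  simpa only [neg_one_mul, ← sub_eq_add_neg] using h.add (h'.const_mul (-1))

lemma IsTest.sub {φ φ' : E3 → ℝ} (h : IsTest U φ) (h' : IsTest U φ') :
    IsTest U (fun x => φ x - φ' x) := by
  simpa only [neg_one_mul, ← sub_eq_add_neg] using h.add (h'.const_mul (-1))

lemma H1Tendsto.sub {φ φ' : ℕ → E3 → ℝ} (hφ : ∀ n, IsSmoothCompact (φ n))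
    (hφ' : ∀ n, IsSmoothCompact (φ' n)) (hu : HasGrad U u p) (hu' : HasGrad U u' p')
    (h : H1Tendsto U φ u p) (h' : H1Tendsto U φ' u' p') :
    H1Tendsto U (fun n x => φ n x - φ' n x) (fun x => u x - u' x)
      (fun i x => p i x - p' i x) := by
  have := H1Tendsto.add hφ (fun n => (hφ' n).const_mul (-1)) hu hu'.neg_one_mul h (h'.neg hφ')
  simpa only [neg_one_mul, ← sub_eq_add_neg] using this

lemma HasGrad0.sub (h : HasGrad0 U u p) (h' : HasGrad0 U u' p') :
    HasGrad0 U (fun x => u x - u' x) (fun i x => p i x - p' i x) := by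
  refine ⟨h.toHasGrad.sub h'.toHasGrad, ?_⟩
  obtain ⟨φ, hφ, hl⟩ := h.exists_seq
  obtain ⟨φ', hφ', hl'⟩ := h'.exists_seq
  exact ⟨_, fun n => (hφ n).sub (hφ' n), H1Tendsto.sub (fun n => (hφ n).1) (fun n => (hφ' n).1)
    h.toHasGrad h'.toHasGrad hl hl'⟩

end HasGrad

/-! ### The Poincaré inequality -/

/-- Integrating `∂₁(x₁ φ) φ` by parts gives `∫ φ² = -2 ∫ x₁ φ ∂₁φ`. Young's inequality bounds the
right side by `½ ∫ φ² + 2 R² ∫ (∂₁φ)²`, and the first term is absorbed. Only `x₁` has to be bounded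
on the support, so the inequality is available in the infinite waveguide. -/
lemma IsSmoothCompact.integral_sq_le {φ : E3 → ℝ} (h : IsSmoothCompact φ) {R : ℝ}
    (hR : ∀ x, φ x ≠ 0 → |x 0| ≤ R) :
    ∫ x, φ x ^ 2 ≤ 4 * R ^ 2 * ∫ x, Waveguide.partialDeriv 0 φ x ^ 2 := by
  have hcoord : ∀ x : E3, HasFDerivAt (fun x : E3 => x 0)
      (EuclideanSpace.proj (0 : Fin 3) : E3 →L[ℝ] ℝ) x :=
    fun x => (EuclideanSpace.proj (0 : Fin 3) : E3 →L[ℝ] ℝ).hasFDerivAt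
  have hsm : ContDiff ℝ ((⊤ : ℕ∞) : WithTop ℕ∞) (fun x : E3 => x 0) :=
    (EuclideanSpace.proj (0 : Fin 3) : E3 →L[ℝ] ℝ).contDiff
  have hxφ : IsSmoothCompact (fun x => x 0 * φ x) := h.mul_left hsm
  have hd : ∀ x, Waveguide.partialDeriv 0 (fun x => x 0 * φ x) x =
      x 0 * Waveguide.partialDeriv 0 φ x + φ x := by
    intro x
    rw [partialDeriv_mul 0 (hcoord x).differentiableAt (h.differentiable x)]
    have : Waveguide.partialDeriv 0 (fun x : E3 => x 0) x = 1 := by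
      rw [Waveguide.partialDeriv, (hcoord x).fderiv]; simp
    rw [this, one_mul]
  have ibp := (hxφ.hasWeakPartial univ 0).2.2 φ ⟨h, subset_univ _⟩
  simp only [setIntegral_univ, hd] at ibp
  have m1 := h.memLp 2 (volume : Measure E3)
  have m2 := (h.partialDeriv 0).memLp 2 (volume : Measure E3)
  have m3 := hxφ.memLp 2 (volume : Measure E3)
  have i1 : Integrable (fun x => x 0 * φ x * Waveguide.partialDeriv 0 φ x) := m3.integrable_mul m2
  have e1 : ∫ x : E3, (x 0 * Waveguide.partialDeriv 0 φ x + φ x) * φ x =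
      (∫ x : E3, x 0 * φ x * Waveguide.partialDeriv 0 φ x) + ∫ x, φ x ^ 2 := by
    rw [← integral_add i1 m1.integrable_sq]
    congr 1; ext x; ring
  rw [e1] at ibp
  have hle : - (2 * ∫ x : E3, x 0 * φ x * Waveguide.partialDeriv 0 φ x) ≤
      ∫ x, (1 / 2 * φ x ^ 2 + 2 * R ^ 2 * Waveguide.partialDeriv 0 φ x ^ 2) := by
    rw [← integral_const_mul, ← integral_neg]
    refine integral_mono (i1.const_mul 2).neg
      ((m1.integrable_sq.const_mul _).add (m2.integrable_sq.const_mul _)) fun x => ?_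
    by_cases hx : φ x = 0
    · simp only [hx]
      have : 0 ≤ R ^ 2 * Waveguide.partialDeriv 0 φ x ^ 2 := by positivity
      simp only [mul_zero, zero_mul, neg_zero]
      nlinarith
    · have h1 : x 0 ^ 2 ≤ R ^ 2 := sq_le_sq' (by linarith [abs_le.1 (hR x hx)]) (abs_le.1 (hR x hx)).2
      have h2 : x 0 ^ 2 * Waveguide.partialDeriv 0 φ x ^ 2 ≤
          R ^ 2 * Waveguide.partialDeriv 0 φ x ^ 2 := by gcongr
      have h3 := sq_nonneg (φ x + 2 * x 0 * Waveguide.partialDeriv 0 φ x)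
      dsimp only
      nlinarith
  rw [integral_add (m1.integrable_sq.const_mul _) (m2.integrable_sq.const_mul _),
    integral_const_mul, integral_const_mul] at hle
  nlinarith

lemma IsTest.L2Norm_eq {U : Set E3} {φ : E3 → ℝ} (h : IsTest U φ) :
    L2Norm U φ = L2Norm univ φ := by
  rw [L2Norm, L2Norm, eLpNorm_restrict_eq_of_support_subset ((subset_tsupport φ).trans h.2),
    Measure.restrict_univ]

lemma IsTest.poincare {U : Set E3} {R : ℝ≥0} (hR : ∀ x ∈ U, |x 0| ≤ R) {φ : E3 → ℝ}
    (h : IsTest U φ) : L2Norm U φ ≤ 2 * R * L2Norm U (Waveguide.partialDeriv 0 φ) := by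
  rw [h.L2Norm_eq, (h.partialDeriv 0).L2Norm_eq]
  rw [← ENNReal.pow_le_pow_left_iff two_ne_zero, mul_pow,
    L2Norm_sq_eq_ofReal (h.1.memLp _ _), L2Norm_sq_eq_ofReal ((h.1.partialDeriv 0).memLp _ _)]
  have := h.1.integral_sq_le (R := R) fun x hx => hR x (h.2 (subset_tsupport _ hx))
  simp only [setIntegral_univ]
  refine (ENNReal.ofReal_le_ofReal this).trans (le_of_eq ?_)
  rw [ENNReal.ofReal_mul (by positivity)]
  congr 1
  rw [show (2 * (R : ℝ≥0∞)) ^ 2 = ((4 * R ^ 2 : ℝ≥0) : ℝ≥0∞) by push_cast; ring]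
  rw [← ENNReal.ofReal_coe_nnreal]; simp

lemma HasGrad0.poincare {U : Set E3} {R : ℝ≥0} (hR : ∀ x ∈ U, |x 0| ≤ R) {u : E3 → ℝ}
    {p : Fin 3 → E3 → ℝ} (h : HasGrad0 U u p) : L2Norm U u ≤ 2 * R * L2Norm U (p 0) := by
  obtain ⟨φ, hφ, hl⟩ := h.exists_seq
  -- Both sides are compared with the approximating test function; the error terms vanish in the
  -- limit.
  have key : ∀ n, L2Norm U u ≤ L2Norm U (fun x => u x - φ n x) +
      2 * R * (L2Norm U (fun x => p 0 x - partialDeriv 0 (φ n) x) + L2Norm U (p 0)) := by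
    intro n
    have m1 := (hφ n).1.memLp 2 (volume.restrict U)
    have m2 := ((hφ n).1.partialDeriv 0).memLp 2 (volume.restrict U)
    calc L2Norm U u = L2Norm U (fun x => (u x - φ n x) + φ n x) := by simp
      _ ≤ L2Norm U (fun x => u x - φ n x) + L2Norm U (φ n) :=
        L2Norm_add_le (h.memLp.sub m1).1 m1.1
      _ ≤ _ := by
        gcongr
        refine ((hφ n).poincare hR).trans ?_
        gcongr
        calc L2Norm U (partialDeriv 0 (φ n)) = L2Norm U (fun x => p 0 x -
              (p 0 x - partialDeriv 0 (φ n) x)) := by simp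
          _ ≤ _ := by
            rw [add_comm]
            exact L2Norm_sub_le (h.memLp_grad 0).1 ((h.memLp_grad 0).sub m2).1
  have lim := hl.1.add (ENNReal.Tendsto.const_mul (a := 2 * R)
    ((hl.2 0).add (tendsto_const_nhds (x := L2Norm U (p 0)))) (Or.inr (by finiteness)))
  simpa using ge_of_tendsto' lim key


lemma _root_.MeasureTheory.MemLp.integrable_mul_two {μ : Measure E3} {f g : E3 → ℝ}
    (hf : MemLp f 2 μ) (hg : MemLp g 2 μ) : Integrable (fun x => f x * g x) μ :=
  hf.integrable_mul hg

/-! ### Bounded Lipschitz coefficients -/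

/-- `g` is bounded by `c` and Lipschitz with constant `c` on `U`. -/
def BLip (U : Set E3) (c : ℝ≥0) (g : E3 → ℝ) : Prop :=
  (∀ x ∈ U, |g x| ≤ c) ∧ LipschitzOnWith c g U

namespace BLip

variable {U V : Set E3} {c d : ℝ≥0} {f g w : E3 → ℝ} {q : ℝ≥0∞}

lemma mono_const (h : BLip U c g) (hcd : c ≤ d) : BLip U d g :=
  ⟨fun x hx => (h.1 x hx).trans (by exact_mod_cast hcd), h.2.weaken hcd⟩

lemma mono_set (h : BLip U c g) (hVU : V ⊆ U) : BLip V c g :=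
  ⟨fun x hx => h.1 x (hVU hx), h.2.mono hVU⟩

lemma mul (hf : BLip U c f) (hg : BLip U d g) : BLip U (2 * c * d) (fun x => f x * g x) := by
  constructor
  · intro x hx
    rw [abs_mul]
    have h1 := hf.1 x hx
    have h2 := hg.1 x hx
    calc |f x| * |g x| ≤ c * d := by gcongr
      _ ≤ _ := by push_cast; nlinarith [mul_nonneg c.2 d.2]
  · refine LipschitzOnWith.of_dist_le_mul fun x hx y hy => ?_
    have h1 := hf.1 x hx
    have h2 := hg.1 y hy
    have h3 := hf.2.dist_le_mul x hx y hy
    have h4 := hg.2.dist_le_mul x hx y hy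
    rw [Real.dist_eq] at h3 h4 ⊢
    calc |f x * g x - f y * g y| = |f x * (g x - g y) + (f x - f y) * g y| := by ring_nf
      _ ≤ |f x| * |g x - g y| + |f x - f y| * |g y| := by
        rw [← abs_mul, ← abs_mul]; exact abs_add_le _ _
      _ ≤ c * (d * dist x y) + c * dist x y * d := by gcongr
      _ = _ := by push_cast; ring

lemma add (hf : BLip U c f) (hg : BLip U d g) : BLip U (c + d) (fun x => f x + g x) := by
  constructor
  · intro x hx
    refine (abs_add_le _ _).trans ?_
    push_cast
    exact add_le_add (hf.1 x hx) (hg.1 x hx)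
  · refine LipschitzOnWith.of_dist_le_mul fun x hx y hy => ?_
    have h3 := hf.2.dist_le_mul x hx y hy
    have h4 := hg.2.dist_le_mul x hx y hy
    rw [Real.dist_eq] at h3 h4 ⊢
    calc |f x + g x - (f y + g y)| = |(f x - f y) + (g x - g y)| := by ring_nf
      _ ≤ |f x - f y| + |g x - g y| := abs_add_le _ _
      _ ≤ _ := by push_cast; linarith

lemma neg (hf : BLip U c f) : BLip U c (fun x => -f x) := by
  constructor
  · intro x hx
    rw [abs_neg]; exact hf.1 x hx
  · refine LipschitzOnWith.of_dist_le_mul fun x hx y hy => ?_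
    rw [dist_neg_neg]; exact hf.2.dist_le_mul x hx y hy

lemma const (U : Set E3) (r : ℝ) : BLip U ‖r‖₊ (fun _ => r) :=
  ⟨fun _ _ => le_rfl, (LipschitzWith.const' r).weaken zero_le |>.lipschitzOnWith⟩

lemma sum {ι : Type*} (s : Finset ι) {f : ι → E3 → ℝ} (hf : ∀ i ∈ s, BLip U c (f i)) :
    BLip U (s.card * c) (fun x => ∑ i ∈ s, f i x) := by
  classical
  induction s using Finset.induction_on with
  | empty => simpa using (const U 0).mono_const (d := 0) (by simp)
  | insert a s ha ih =>
    simp only [Finset.sum_insert ha, Finset.card_insert_of_notMem ha]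
    have := (hf a (by simp)).add (ih fun i hi => hf i (by simp [hi]))
    refine this.mono_const (le_of_eq ?_)
    push_cast; ring

lemma aestronglyMeasurable (hU : MeasurableSet U) (h : BLip U c g) :
    AEStronglyMeasurable g (volume.restrict U) :=
  h.2.continuousOn.aestronglyMeasurable hU

lemma memLp_mul (hU : MeasurableSet U) (h : BLip U c g) (hw : MemLp w q (volume.restrict U)) :
    MemLp (fun x => g x * w x) q (volume.restrict U) := by
  refine MemLp.of_le_mul (c := c) hw ((h.aestronglyMeasurable hU).mul hw.1) ?_
  filter_upwards [ae_restrict_mem hU] with x hx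
  rw [norm_mul]
  gcongr
  exact h.1 x hx

lemma L2Norm_mul_le (hU : MeasurableSet U) (h : BLip U c g) :
    L2Norm U (fun x => g x * w x) ≤ c * L2Norm U w :=
  Waveguide.L2Norm_mul_le hU h.1

/-- The weak product rule for a bounded Lipschitz factor. -/
lemma exists_hasWeakPartial_mul (hU : IsOpen U) (h : BLip U c g) (i : Fin 3) :
    ∃ g' : E3 → ℝ, Measurable g' ∧ (∀ x, |g' x| ≤ c) ∧ ∀ w w', HasWeakPartial U i w w' →
      HasWeakPartial U i (fun x => g x * w x) (fun x => g x * w' x + g' x * w x) :=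
  exists_lipschitz_mul_hasWeakPartial hU h.2 i

/-- Makes admissible coefficients eligible for `HasH2Regularity`. The factor `4` counts the function
and its three derivatives. -/
lemma memW1_top (hU : IsOpen U) (h : BLip U c g) : MemW1 U ∞ g ∧ W1inftyNorm U g ≤ 4 * c := by
  -- The weak derivative of `g` is read off from the product rule applied to `g * 1`.
  have hone : ∀ i, HasWeakPartial U i (fun _ => (1 : ℝ)) (fun _ => 0) := by
    intro i
    refine ⟨(continuous_const.locallyIntegrable).locallyIntegrableOn U,
      (continuous_const.locallyIntegrable).locallyIntegrableOn U, fun φ hφ => ?_⟩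
    obtain ⟨D, hD⟩ := hφ.1.lipschitz
    have key := LipschitzWith.hasWeakPartial_lineDeriv
      (LipschitzWith.const (α := E3) (1 : ℝ)) hD hφ.1.2 i
    have hz : ∀ x, lineDeriv ℝ (fun _ : E3 => (1 : ℝ)) x (EuclideanSpace.single i 1) = 0 :=
      fun x => by simp [lineDeriv]
    simp only [lineDeriv_eq_partialDeriv hφ.1.differentiable, one_mul, hz, zero_mul,
      integral_zero, neg_zero] at key ⊢
    rw [setIntegral_eq_integral_of_forall_compl_eq_zero, key]
    intro x hx
    exact image_eq_zero_of_notMem_tsupport fun h => hx ((hφ.partialDeriv i).2 h)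
  have hg : MemLp g ∞ (volume.restrict U) := by
    refine memLp_top_of_bound (h.aestronglyMeasurable hU.measurableSet) c ?_
    filter_upwards [ae_restrict_mem hU.measurableSet] with x hx
    exact h.1 x hx
  have hgn : eLpNorm g ∞ (volume.restrict U) ≤ c := by
    rw [eLpNorm_exponent_top]
    refine eLpNormEssSup_le_of_ae_nnnorm_bound ?_
    filter_upwards [ae_restrict_mem hU.measurableSet] with x hx
    exact_mod_cast h.1 x hx
  have hd : ∀ i, ∃ v, HasWeakPartial U i g v ∧ Measurable v ∧ ∀ x, |v x| ≤ c := by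
    intro i
    obtain ⟨g', hm, hb, hw⟩ := h.exists_hasWeakPartial_mul hU i
    refine ⟨g', ?_, hm, hb⟩
    simpa using hw _ _ (hone i)
  refine ⟨⟨hg, fun i => ?_⟩, ?_⟩
  · obtain ⟨v, hv, hm, hb⟩ := hd i
    exact ⟨v, hv, memLp_top_of_bound hm.aestronglyMeasurable c (Eventually.of_forall hb)⟩
  · have hi : ∀ i, eLpNorm (weakPartial U i g) ∞ (volume.restrict U) ≤ c := by
      intro i
      obtain ⟨v, hv, hm, hb⟩ := hd i
      rw [eLpNorm_congr_ae (hv.weakPartial_ae hU), eLpNorm_exponent_top]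
      exact eLpNormEssSup_le_of_ae_nnnorm_bound
        (Eventually.of_forall fun x => by exact_mod_cast hb x)
    calc W1inftyNorm U g ≤ c + ∑ i : Fin 3, (c : ℝ≥0∞) :=
          add_le_add hgn (Finset.sum_le_sum fun i _ => hi i)
      _ = _ := by simp; ring

end BLip

/-! ### Weak form of the equation -/

/-- `A` is symmetric and elliptic with constant `a` on `U`, with entries that are bounded by `c`
and Lipschitz with constant `c`. -/
structure Admissible (U : Set E3) (a : ℝ) (c : ℝ≥0) (A : E3 → Matrix (Fin 3) (Fin 3) ℝ) :
    Prop where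
  symm : ∀ x ∈ U, (A x).IsSymm
  blip : ∀ i j, BLip U c (fun x => A x i j)
  coercive : ∀ x ∈ U, ∀ ζ : Fin 3 → ℝ, a * (ζ ⬝ᵥ ζ) ≤ (A x *ᵥ ζ) ⬝ᵥ ζ

/-- The flux `A p`. -/
def flux (A : E3 → Matrix (Fin 3) (Fin 3) ℝ) (p : Fin 3 → E3 → ℝ) (i : Fin 3) (x : E3) : ℝ :=
  ∑ j, A x i j * p j x

/-- `div (A p) = F` on `U` in the sense of distributions. -/
def WeakEq (U : Set E3) (A : E3 → Matrix (Fin 3) (Fin 3) ℝ) (p : Fin 3 → E3 → ℝ)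
    (F : E3 → ℝ) : Prop :=
  ∀ φ : E3 → ℝ, IsTest U φ →
    ∑ i, ∫ x in U, flux A p i x * partialDeriv i φ x = - ∫ x in U, F x * φ x

section WeakEq

variable {U V : Set E3} {a : ℝ} {c : ℝ≥0} {A : E3 → Matrix (Fin 3) (Fin 3) ℝ}
  {u v : E3 → ℝ} {p q : Fin 3 → E3 → ℝ} {F G : E3 → ℝ}

lemma Admissible.mono (hA : Admissible U a c A) (h : V ⊆ U) : Admissible V a c A where
  symm x hx := hA.symm x (h hx)
  blip i j := (hA.blip i j).mono_set h
  coercive x hx := hA.coercive x (h hx)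

lemma Admissible.memLp_flux (hA : Admissible U a c A) (hU : IsOpen U)
    (hp : ∀ i, MemLp (p i) 2 (volume.restrict U)) (i : Fin 3) :
    MemLp (flux A p i) 2 (volume.restrict U) :=
  memLp_finsetSum _ fun j _ => (hA.blip i j).memLp_mul hU.measurableSet (hp j)

/-- Exchanges the chosen weak derivatives in the equation for any explicit gradient. -/
lemma Admissible.divEq_iff (hA : Admissible U a c A) (hU : IsOpen U) (h : HasGrad U u p) :
    DivEq U A u F ↔ WeakEq U A p F := by
  refine forall_congr' fun φ => forall_congr' fun hφ => ?_
  have e : ∫ x in U, (A x *ᵥ fun j => weakPartial U j u x) ⬝ᵥ (fun i => partialDeriv i φ x) =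
      ∑ i, ∫ x in U, flux A p i x * partialDeriv i φ x := by
    rw [← integral_finsetSum]
    · refine integral_congr_ae ?_
      filter_upwards [ae_all_iff.2 fun i => h.weakPartial_ae hU i] with x hx
      simp only [dotProduct, Matrix.mulVec, flux, hx]
    · intro i _
      exact (hA.memLp_flux hU h.memLp_grad i).integrable_mul_two ((hφ.partialDeriv i).1.memLp _ _)
  rw [e]

lemma Admissible.flux_sub (A : E3 → Matrix (Fin 3) (Fin 3) ℝ) (p q : Fin 3 → E3 → ℝ)
    (i : Fin 3) (x : E3) : flux A (fun i x => p i x - q i x) i x = flux A p i x - flux A q i x := by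
  simp only [flux, mul_sub, Finset.sum_sub_distrib]

lemma WeakEq.sub (hA : Admissible U a c A) (hU : IsOpen U)
    (hp : ∀ i, MemLp (p i) 2 (volume.restrict U)) (hq : ∀ i, MemLp (q i) 2 (volume.restrict U))
    (hF : MemLp F 2 (volume.restrict U)) (hG : MemLp G 2 (volume.restrict U))
    (h : WeakEq U A p F) (h' : WeakEq U A q G) :
    WeakEq U A (fun i x => p i x - q i x) (fun x => F x - G x) := by
  intro φ hφ
  have e1 : ∀ i, ∫ x in U, flux A (fun i x => p i x - q i x) i x * partialDeriv i φ x =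
      (∫ x in U, flux A p i x * partialDeriv i φ x) -
        ∫ x in U, flux A q i x * partialDeriv i φ x := by
    intro i
    have m := (hφ.partialDeriv i).1.memLp 2 (volume.restrict U)
    rw [← integral_sub ((hA.memLp_flux hU hp i).integrable_mul_two m)
      ((hA.memLp_flux hU hq i).integrable_mul_two m)]
    congr 1; ext x
    rw [Admissible.flux_sub]
    ring
  have m := hφ.1.memLp 2 (volume.restrict U)
  have e2 : ∫ x in U, (F x - G x) * φ x = (∫ x in U, F x * φ x) - ∫ x in U, G x * φ x := by
    rw [← integral_sub (hF.integrable_mul_two m) (hG.integrable_mul_two m)]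
    congr 1; ext x; ring
  simp only [e1, e2, Finset.sum_sub_distrib, h φ hφ, h' φ hφ]
  ring

/-- A solution in `H¹₀` may be tested against itself. -/
lemma HasGrad0.energy_eq (hA : Admissible U a c A) (hU : IsOpen U) (h : HasGrad0 U u p)
    (hF : MemLp F 2 (volume.restrict U)) (heq : WeakEq U A q F)
    (hq : ∀ i, MemLp (q i) 2 (volume.restrict U)) :
    ∑ i, ∫ x in U, flux A q i x * p i x = - ∫ x in U, F x * u x := by
  obtain ⟨φ, hφ, hl⟩ := h.exists_seq
  have l1 : Tendsto (fun n => ∑ i, ∫ x in U, flux A q i x * partialDeriv i (φ n) x) atTop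
      (𝓝 (∑ i, ∫ x in U, flux A q i x * p i x)) :=
    tendsto_finsetSum _ fun i _ => tendsto_integral_mul_of_L2 (hA.memLp_flux hU hq i)
      (h.memLp_grad i) (fun n => ((hφ n).partialDeriv i).1.memLp _ _) (hl.2 i)
  have l2 := (tendsto_integral_mul_of_L2 hF h.memLp (fun n => (hφ n).1.memLp _ _) hl.1).neg
  exact tendsto_nhds_unique l1 (l2.congr fun n => (heq _ (hφ n)).symm)

/-- The solution is tested against itself: ellipticity bounds the energy from below, and Young and
Poincaré bound the right-hand side so that half of the energy can be absorbed. -/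
lemma HasGrad0.energy_le (hA : Admissible U a c A) (hU : IsOpen U) (ha : 0 < a) {R : ℝ≥0}
    (hR0 : 0 < R) (hR : ∀ x ∈ U, |x 0| ≤ R) (h : HasGrad0 U u p)
    (hF : MemLp F 2 (volume.restrict U)) (heq : WeakEq U A p F) :
    ∑ i, L2Norm U (p i) ^ 2 ≤ ENNReal.ofReal (4 * R ^ 2 / a ^ 2) * L2Norm U F ^ 2 := by
  have hE := h.energy_eq hA hU hF heq h.memLp_grad
  have hsum : ∑ i, L2Norm U (p i) ^ 2 = ENNReal.ofReal (∑ i, ∫ x in U, p i x ^ 2) := by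
    rw [ENNReal.ofReal_sum_of_nonneg fun i _ => integral_nonneg fun x => sq_nonneg _]
    exact Finset.sum_congr rfl fun i _ => L2Norm_sq_eq_ofReal (h.memLp_grad i)
  have hP : ∫ x in U, u x ^ 2 ≤ 4 * R ^ 2 * ∑ i, ∫ x in U, p i x ^ 2 := by
    have h1 := pow_le_pow_left₀ zero_le (h.poincare hR) 2
    rw [mul_pow, L2Norm_sq_eq_ofReal h.memLp, L2Norm_sq_eq_ofReal (h.memLp_grad 0),
      show (2 * (R : ℝ≥0∞)) ^ 2 = ENNReal.ofReal (4 * R ^ 2) by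
        rw [ENNReal.ofReal_mul (by norm_num), ENNReal.ofReal_pow (by positivity)]
        simp [mul_pow]; norm_num,
      ← ENNReal.ofReal_mul (by positivity), ENNReal.ofReal_le_ofReal_iff (by positivity)] at h1
    refine h1.trans ?_
    gcongr
    exact Finset.single_le_sum (f := fun i => ∫ x in U, p i x ^ 2)
      (fun i _ => integral_nonneg fun x => sq_nonneg _) (Finset.mem_univ 0)
  have hco : a * ∑ i, ∫ x in U, p i x ^ 2 ≤ ∑ i, ∫ x in U, flux A p i x * p i x := by
    rw [← integral_finsetSum _ fun i _ => (h.memLp_grad i).integrable_sq,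
      ← integral_finsetSum _ fun i _ =>
        (hA.memLp_flux hU h.memLp_grad i).integrable_mul_two (h.memLp_grad i), ← integral_const_mul]
    refine setIntegral_mono_on ?_ ?_ hU.measurableSet fun x hx => ?_
    · exact (integrable_finsetSum _ fun i _ => (h.memLp_grad i).integrable_sq).const_mul _
    · exact integrable_finsetSum _ fun i _ =>
        (hA.memLp_flux hU h.memLp_grad i).integrable_mul_two (h.memLp_grad i)
    · have := hA.coercive x hx (fun i => p i x)
      simpa only [dotProduct, Matrix.mulVec, flux, sq] using this
  -- The weight `a / (8 R²)` is chosen so that Poincaré with constant `4 R²` turns the last term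
  -- into `a / 2` times the squared norm of the gradient.
  have hY : - ∫ x in U, F x * u x ≤ 2 * R ^ 2 / a * (∫ x in U, F x ^ 2) +
      a / (8 * R ^ 2) * ∫ x in U, u x ^ 2 := by
    rw [← integral_neg, ← integral_const_mul, ← integral_const_mul,
      ← integral_add (hF.integrable_sq.const_mul _) (h.memLp.integrable_sq.const_mul _)]
    refine integral_mono (hF.integrable_mul_two h.memLp).neg
      ((hF.integrable_sq.const_mul _).add (h.memLp.integrable_sq.const_mul _)) fun x => ?_
    have hR' : (0 : ℝ) < R := hR0
    have := sq_nonneg (4 * R ^ 2 * F x + a * u x)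
    have e : 2 * R ^ 2 / a * F x ^ 2 + a / (8 * R ^ 2) * u x ^ 2 + F x * u x =
        (4 * R ^ 2 * F x + a * u x) ^ 2 / (8 * R ^ 2 * a) := by
      field_simp; ring
    have : 0 ≤ (4 * R ^ 2 * F x + a * u x) ^ 2 / (8 * R ^ 2 * a) := by positivity
    linarith
  rw [hsum, L2Norm_sq_eq_ofReal hF, ← ENNReal.ofReal_mul (by positivity)]
  refine ENNReal.ofReal_le_ofReal ?_
  set P := ∑ i, ∫ x in U, p i x ^ 2
  set I := ∫ x in U, F x ^ 2
  have hR' : (0 : ℝ) < R := hR0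
  have h1 : a / (8 * R ^ 2) * ∫ x in U, u x ^ 2 ≤ a / 2 * P := by
    calc _ ≤ a / (8 * R ^ 2) * (4 * R ^ 2 * P) := by gcongr
      _ = _ := by field_simp; ring
  have h2 : a / 2 * P ≤ 2 * R ^ 2 / a * I := by linarith
  calc P = 2 / a * (a / 2 * P) := by field_simp
    _ ≤ 2 / a * (2 * R ^ 2 / a * I) := by gcongr
    _ = _ := by field_simp; ring

lemma HasGrad0.L2Norm_le (hA : Admissible U a c A) (hU : IsOpen U) (ha : 0 < a) {R : ℝ≥0}
    (hR0 : 0 < R) (hR : ∀ x ∈ U, |x 0| ≤ R) (h : HasGrad0 U u p)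
    (hF : MemLp F 2 (volume.restrict U)) (heq : WeakEq U A p F) :
    L2Norm U u ^ 2 ≤ (2 * R) ^ 2 * (ENNReal.ofReal (4 * R ^ 2 / a ^ 2) * L2Norm U F ^ 2) := by
  have h1 := pow_le_pow_left₀ zero_le (h.poincare hR) 2
  rw [mul_pow] at h1
  refine h1.trans ?_
  gcongr
  refine le_trans ?_ (h.energy_le hA hU ha hR0 hR hF heq)
  exact Finset.single_le_sum (f := fun i => L2Norm U (p i) ^ 2) (fun _ _ => zero_le)
    (Finset.mem_univ 0)

/-- Uniqueness of weak solutions in `H¹₀`. -/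
lemma HasGrad0.ae_eq (hA : Admissible U a c A) (hU : IsOpen U) (ha : 0 < a) {R : ℝ≥0}
    (hR0 : 0 < R) (hR : ∀ x ∈ U, |x 0| ≤ R) (h : HasGrad0 U u p) (h' : HasGrad0 U v q)
    (hF : MemLp F 2 (volume.restrict U)) (heq : WeakEq U A p F) (heq' : WeakEq U A q F) :
    u =ᵐ[volume.restrict U] v := by
  have hs := WeakEq.sub hA hU h.memLp_grad h'.memLp_grad hF hF heq heq'
  have := (h.sub h').L2Norm_le hA hU ha hR0 hR (hF.sub hF) hs
  simp only [sub_self] at this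
  have h0 : L2Norm U (fun x => u x - v x) = 0 := by
    have z : L2Norm U 0 = 0 := eLpNorm_zero
    change _ ≤ _ * (_ * L2Norm U 0 ^ 2) at this
    rw [z] at this
    simpa using this
  replace h0 := (L2Norm_eq_zero_iff (h.sub h').memLp.1).1 h0
  filter_upwards [h0] with x hx
  exact sub_eq_zero.1 hx

end WeakEq


/-! ### Existence of weak solutions -/

/-- The Lax–Milgram theorem on the closure of a subspace. -/
lemma exists_mem_closure_of_coercive {H : Type*} [NormedAddCommGroup H] [InnerProductSpace ℝ H]
    [CompleteSpace H] (S : Submodule ℝ H) (b : H →L[ℝ] H →L[ℝ] ℝ) {κ : ℝ} (hκ : 0 < κ)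
    (hb : ∀ s ∈ S, κ * ‖s‖ ^ 2 ≤ b s s) (ℓ : H →L[ℝ] ℝ) :
    ∃ v ∈ S.topologicalClosure, ∀ s ∈ S, b v s = ℓ s := by
  set V := S.topologicalClosure
  have : CompleteSpace V := S.isClosed_topologicalClosure.completeSpace_coe
  -- Coercivity is a closed condition, so it passes from `S` to its closure.
  have hbV : ∀ s ∈ V, κ * ‖s‖ ^ 2 ≤ b s s := by
    intro s hs
    refine closure_minimal (t := {s | κ * ‖s‖ ^ 2 ≤ b s s}) hb ?_ hs
    exact isClosed_le (by fun_prop) (by fun_prop)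
  let B : V →L[ℝ] V →L[ℝ] ℝ := b.bilinearComp V.subtypeL V.subtypeL
  have hB : IsCoercive B := ⟨κ, hκ, fun v => by
    have := hbV v v.2
    simpa [B, mul_assoc, sq] using this⟩
  let w : V := (InnerProductSpace.toDual ℝ V).symm (ℓ.comp V.subtypeL)
  let v : V := hB.continuousLinearEquivOfBilin.symm w
  refine ⟨v, v.2, fun s hs => ?_⟩
  have h1 := hB.continuousLinearEquivOfBilin_apply v ⟨s, S.le_topologicalClosure hs⟩
  simp only [v, ContinuousLinearEquiv.apply_symm_apply] at h1
  have h2 : inner ℝ w ⟨s, S.le_topologicalClosure hs⟩ =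
    (ℓ.comp V.subtypeL) ⟨s, S.le_topologicalClosure hs⟩ :=
      InnerProductSpace.toDual_symm_apply
  rw [h2] at h1
  exact h1.symm

/-! ### Inner products and multiplication operators on L². -/

section Lp

variable {μ : Measure E3}

lemma inner_toLp {f g : E3 → ℝ} (hf : MemLp f 2 μ) (hg : MemLp g 2 μ) :
    inner ℝ (hf.toLp f) (hg.toLp g) = ∫ x, f x * g x ∂μ := by
  rw [L2.inner_def]
  refine integral_congr_ae ?_
  filter_upwards [hf.coeFn_toLp, hg.coeFn_toLp] with x h1 h2
  rw [h1, h2]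
  simp [mul_comm]

/-- Multiplication by a bounded function, as an operator on `L²`. -/
noncomputable def mulL2 {g : E3 → ℝ} {c : ℝ≥0} (hg : AEStronglyMeasurable g μ)
    (hb : ∀ᵐ x ∂μ, |g x| ≤ c) : Lp ℝ 2 μ →L[ℝ] Lp ℝ 2 μ :=
  LinearMap.mkContinuous
    { toFun := fun f => (MemLp.of_le_mul (c := c) (f := fun x => g x * f x) (Lp.memLp f)
        (hg.mul (Lp.memLp f).1) (by
          filter_upwards [hb] with x hx
          rw [norm_mul]; gcongr; exact hx)).toLp _
      map_add' := fun f f' => by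
        rw [← MemLp.toLp_add]
        refine (MemLp.toLp_eq_toLp_iff _ _).2 ?_
        filter_upwards [Lp.coeFn_add f f'] with x hx
        simp only [hx, Pi.add_apply]; ring
      map_smul' := fun r f => by
        rw [RingHom.id_apply, ← MemLp.toLp_const_smul]
        refine (MemLp.toLp_eq_toLp_iff _ _).2 ?_
        filter_upwards [Lp.coeFn_smul r f] with x hx
        simp only [hx, Pi.smul_apply, smul_eq_mul]; ring } c (fun f => by
    refine Lp.norm_le_mul_norm_of_ae_le_mul ?_
    simp only [LinearMap.coe_mk, AddHom.coe_mk]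
    filter_upwards [MemLp.coeFn_toLp (MemLp.of_le_mul (c := c) (f := fun x => g x * f x)
      (Lp.memLp f) (hg.mul (Lp.memLp f).1) (by
          filter_upwards [hb] with x hx
          rw [norm_mul]; gcongr; exact hx)), hb] with x hx hbx
    rw [hx, norm_mul]; gcongr; exact hbx)

lemma mulL2_ae {g : E3 → ℝ} {c : ℝ≥0} (hg : AEStronglyMeasurable g μ)
    (hb : ∀ᵐ x ∂μ, |g x| ≤ c) (f : Lp ℝ 2 μ) : mulL2 hg hb f =ᵐ[μ] fun x => g x * f x :=
  MemLp.coeFn_toLp (MemLp.of_le_mul (c := c) (f := fun x => g x * f x)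
      (Lp.memLp f) (hg.mul (Lp.memLp f).1) (by
          filter_upwards [hb] with x hx
          rw [norm_mul]; gcongr; exact hx))

lemma inner_Lp (f g : Lp ℝ 2 μ) : inner ℝ f g = ∫ x, f x * g x ∂μ := by
  rw [L2.inner_def]
  congr 1; ext x; simp [mul_comm]

lemma L2Norm_sub_toLp {U : Set E3} {f g : E3 → ℝ} (hf : MemLp f 2 (volume.restrict U))
    (hg : MemLp g 2 (volume.restrict U)) :
    L2Norm U (fun x => f x - g x) = ‖hf.toLp f - hg.toLp g‖ₑ := by
  rw [← MemLp.toLp_sub, Lp.enorm_toLp]; rfl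

end Lp

/-! ### H¹₀(U) as a closure in L²(U)⁴. -/

section Existence

variable {U : Set E3}

/-- An `H¹` limit of test functions belongs to `H¹₀`. -/
lemma HasGrad0.of_tendsto {u : E3 → ℝ} {p : Fin 3 → E3 → ℝ}
    (hu : MemLp u 2 (volume.restrict U)) (hp : ∀ i, MemLp (p i) 2 (volume.restrict U))
    {φ : ℕ → E3 → ℝ} (hφ : ∀ n, IsTest U (φ n)) (hl : H1Tendsto U φ u p) : HasGrad0 U u p := by
  refine ⟨⟨hu, hp, fun i => ⟨hu.locallyIntegrableOn (by norm_num),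
    (hp i).locallyIntegrableOn (by norm_num), fun ψ hψ => ?_⟩⟩, φ, hφ, hl⟩
  -- The integration by parts formula of the approximating functions survives in the limit, so the
  -- limit of the gradients is the weak gradient of the limit.
  have l1 := tendsto_integral_mul_of_L2 ((hψ.partialDeriv i).1.memLp 2 _) hu
    (fun n => (hφ n).1.memLp 2 _) hl.1
  have l2 := (tendsto_integral_mul_of_L2 (hψ.1.memLp 2 _) (hp i)
    (fun n => ((hφ n).partialDeriv i).1.memLp 2 _) (hl.2 i)).neg
  have e : ∀ n, -∫ x in U, ψ x * partialDeriv i (φ n) x =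
      ∫ x in U, partialDeriv i ψ x * φ n x := by
    intro n
    have := ((hφ n).1.hasWeakPartial U i).2.2 ψ hψ
    simp only [mul_comm (ψ _), mul_comm (partialDeriv i ψ _)]
    exact this.symm
  have := tendsto_nhds_unique l1 (l2.congr e)
  simpa only [mul_comm] using this

/-- The pair of a test function and its gradient, in `L²(U)⁴`. -/
noncomputable def testVec (U : Set E3) {φ : E3 → ℝ} (hφ : IsTest U φ) :
    PiLp 2 (fun _ : Fin 4 => Lp ℝ 2 (volume.restrict U)) :=
  WithLp.toLp 2 (Fin.cons ((hφ.1.memLp 2 (volume.restrict U)).toLp φ)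
    fun i => ((hφ.partialDeriv i).1.memLp 2 (volume.restrict U)).toLp (partialDeriv i φ))

lemma testVec_zero {φ : E3 → ℝ} (hφ : IsTest U φ) :
    testVec U hφ 0 = (hφ.1.memLp 2 (volume.restrict U)).toLp φ := rfl

lemma testVec_succ {φ : E3 → ℝ} (hφ : IsTest U φ) (i : Fin 3) :
    testVec U hφ i.succ =
      ((hφ.partialDeriv i).1.memLp 2 (volume.restrict U)).toLp (partialDeriv i φ) := rfl

lemma testVec_add {φ ψ : E3 → ℝ} (hφ : IsTest U φ) (hψ : IsTest U ψ) :
    testVec U (hφ.add hψ) = testVec U hφ + testVec U hψ := by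
  refine PiLp.ext fun k => ?_
  rw [PiLp.add_apply]
  refine Fin.cases ?_ (fun i => ?_) k
  · rw [testVec_zero, testVec_zero, testVec_zero, ← MemLp.toLp_add]; rfl
  · rw [testVec_succ, testVec_succ, testVec_succ, ← MemLp.toLp_add]
    refine (MemLp.toLp_eq_toLp_iff _ _).2 (Eventually.of_forall fun x => ?_)
    exact partialDeriv_add i (hφ.1.differentiable x) (hψ.1.differentiable x)

lemma testVec_const_mul {φ : E3 → ℝ} (hφ : IsTest U φ) (r : ℝ) :
    testVec U (hφ.const_mul r) = r • testVec U hφ := by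
  refine PiLp.ext fun k => ?_
  rw [PiLp.smul_apply]
  refine Fin.cases ?_ (fun i => ?_) k
  · rw [testVec_zero, testVec_zero, ← MemLp.toLp_const_smul]; rfl
  · rw [testVec_succ, testVec_succ, ← MemLp.toLp_const_smul]
    refine (MemLp.toLp_eq_toLp_iff _ _).2 (Eventually.of_forall fun x => ?_)
    exact partialDeriv_const_mul r i (hφ.1.differentiable x)

/-- The subspace of `L²(U)⁴` formed by the test functions with their gradients. -/
noncomputable def testSubmodule (U : Set E3) :
    Submodule ℝ (PiLp 2 (fun _ : Fin 4 => Lp ℝ 2 (volume.restrict U))) where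
  carrier := {x | ∃ (φ : E3 → ℝ) (hφ : IsTest U φ), x = testVec U hφ}
  zero_mem' := by
    have h0 : IsTest U (fun _ => 0) := ⟨⟨contDiff_const, HasCompactSupport.zero⟩, by simp⟩
    exact ⟨_, h0.const_mul 0, by rw [testVec_const_mul h0, zero_smul]⟩
  add_mem' := by
    rintro _ _ ⟨φ, hφ, rfl⟩ ⟨ψ, hψ, rfl⟩
    exact ⟨_, hφ.add hψ, (testVec_add hφ hψ).symm⟩
  smul_mem' := by
    rintro r _ ⟨φ, hφ, rfl⟩
    exact ⟨_, hφ.const_mul r, (testVec_const_mul hφ r).symm⟩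

/-- `H¹₀(U)` is realised as the closure in `L²(U)⁴` of the vectors `(φ, ∇φ)`. The bilinear form
makes sense on all of `L²(U)⁴` but is coercive only on that closure, by Poincaré;
`HasGrad0.of_tendsto` then recognises the last three components of the Lax–Milgram solution as the
gradient of the first. -/
lemma exists_weak_solution {a : ℝ} {c : ℝ≥0} {A : E3 → Matrix (Fin 3) (Fin 3) ℝ}
    (hA : Admissible U a c A) (hU : IsOpen U) (ha : 0 < a) {R : ℝ≥0}
    (hR : ∀ x ∈ U, |x 0| ≤ R) {F : E3 → ℝ} (hF : MemLp F 2 (volume.restrict U)) :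
    ∃ u p, HasGrad0 U u p ∧ WeakEq U A p F := by
  have hAm : ∀ i j, AEStronglyMeasurable (fun x => A x i j) (volume.restrict U) :=
    fun i j => (hA.blip i j).aestronglyMeasurable hU.measurableSet
  have hAb : ∀ i j, ∀ᵐ x ∂(volume.restrict U), |A x i j| ≤ c := fun i j => by
    filter_upwards [ae_restrict_mem hU.measurableSet] with x hx
    exact (hA.blip i j).1 x hx
  let pr : Fin 4 → PiLp 2 (fun _ : Fin 4 => Lp ℝ 2 (volume.restrict U)) →L[ℝ]
    Lp ℝ 2 (volume.restrict U) := fun k => PiLp.proj 2 _ k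
  let b : PiLp 2 (fun _ : Fin 4 => Lp ℝ 2 (volume.restrict U)) →L[ℝ]
      PiLp 2 (fun _ : Fin 4 => Lp ℝ 2 (volume.restrict U)) →L[ℝ] ℝ :=
    ∑ i : Fin 3, ∑ j : Fin 3, (innerSL ℝ).bilinearComp
      ((mulL2 (hAm i j) (hAb i j)).comp (pr j.succ)) (pr i.succ)
  have hb : ∀ x φ (hφ : IsTest U φ), b x (testVec U hφ) =
      ∑ i, ∫ y in U, flux A (fun j => x j.succ) i y * partialDeriv i φ y := by
    intro x φ hφ
    simp only [b, _root_.sum_apply, ContinuousLinearMap.bilinearComp_apply]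
    refine Finset.sum_congr rfl fun i _ => ?_
    have hm : ∀ j, MemLp (fun y => A y i j * x j.succ y) 2 (volume.restrict U) := fun j =>
      (hA.blip i j).memLp_mul hU.measurableSet (Lp.memLp _)
    have hd := (hφ.partialDeriv i).1.memLp 2 (volume.restrict U)
    simp only [flux, Finset.sum_mul]
    rw [integral_finsetSum _ fun j _ => (hm j).integrable_mul_two hd]
    refine Finset.sum_congr rfl fun j _ => ?_
    change inner ℝ (mulL2 (hAm i j) (hAb i j) (x j.succ)) (hd.toLp _) = _
    rw [inner_Lp]
    refine integral_congr_ae ?_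
    filter_upwards [mulL2_ae (hAm i j) (hAb i j) (x j.succ), hd.coeFn_toLp] with y h1 h2
    rw [h1, h2]
  let ℓ : PiLp 2 (fun _ : Fin 4 => Lp ℝ 2 (volume.restrict U)) →L[ℝ] ℝ :=
    -((innerSL ℝ (hF.toLp F)).comp (pr 0))
  have hℓ : ∀ φ (hφ : IsTest U φ), ℓ (testVec U hφ) = - ∫ y in U, F y * φ y := by
    intro φ hφ
    change - inner ℝ (hF.toLp F) ((hφ.1.memLp 2 (volume.restrict U)).toLp φ) = _
    rw [inner_toLp]
  -- Poincaré gives `‖φ‖² + ‖∇φ‖² ≤ (4 R² + 1) ‖∇φ‖²`, hence the constant.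
  have hcoer : ∀ s ∈ testSubmodule U, a / (4 * R ^ 2 + 1) * ‖s‖ ^ 2 ≤ b s s := by
    rintro _ ⟨φ, hφ, rfl⟩
    have h0 := hφ.1.memLp 2 (volume.restrict U)
    have hd := fun i => (hφ.partialDeriv i).1.memLp 2 (volume.restrict U)
    have hn : ‖testVec U hφ‖ ^ 2 = (∫ y in U, φ y ^ 2) +
        ∑ i, ∫ y in U, partialDeriv i φ y ^ 2 := by
      rw [PiLp.norm_sq_eq_of_L2, Fin.sum_univ_succ]
      congr 1
      · change ‖h0.toLp φ‖ ^ 2 = _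
        rw [← real_inner_self_eq_norm_sq, inner_toLp]
        simp only [sq]
      · refine Finset.sum_congr rfl fun i _ => ?_
        change ‖(hd i).toLp _‖ ^ 2 = _
        rw [← real_inner_self_eq_norm_sq, inner_toLp]
        simp only [sq]
    rw [hn, hb]
    have hflux : ∑ i, ∫ y in U, flux A (fun j => (testVec U hφ) j.succ) i y *
        partialDeriv i φ y = ∑ i, ∫ y in U, flux A (fun j => partialDeriv j φ) i y *
          partialDeriv i φ y := by
      refine Finset.sum_congr rfl fun i _ => integral_congr_ae ?_
      filter_upwards [ae_all_iff.2 fun j => (hd j).coeFn_toLp] with y hy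
      congr 1
      exact Finset.sum_congr rfl fun j _ => congrArg _ (hy j)
    rw [hflux]
    have hco : a * ∑ i, ∫ x in U, partialDeriv i φ x ^ 2 ≤
        ∑ i, ∫ x in U, flux A (fun j => partialDeriv j φ) i x * partialDeriv i φ x := by
      rw [← integral_finsetSum _ fun i _ => (hd i).integrable_sq,
        ← integral_finsetSum _ fun i _ =>
          (hA.memLp_flux hU hd i).integrable_mul_two (hd i), ← integral_const_mul]
      refine setIntegral_mono_on ?_ ?_ hU.measurableSet fun x hx => ?_
      · exact (integrable_finsetSum _ fun i _ => (hd i).integrable_sq).const_mul _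
      · exact integrable_finsetSum _ fun i _ =>
          (hA.memLp_flux hU hd i).integrable_mul_two (hd i)
      · have := hA.coercive x hx (fun i => partialDeriv i φ x)
        simpa only [dotProduct, Matrix.mulVec, flux, sq] using this
    refine le_trans ?_ hco
    have hP := hφ.1.integral_sq_le (R := R) fun x hx => hR x (hφ.2 (subset_tsupport _ hx))
    have z : ∀ ψ, IsTest U ψ → ∫ x in U, ψ x ^ 2 = ∫ x, ψ x ^ 2 := by
      intro ψ hψ
      rw [setIntegral_eq_integral_of_forall_compl_eq_zero]
      intro x hx
      rw [image_eq_zero_of_notMem_tsupport fun h => hx (hψ.2 h)]; simp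
    rw [← z _ hφ, ← z _ (hφ.partialDeriv 0)] at hP
    have hle : ∫ x in U, partialDeriv 0 φ x ^ 2 ≤ ∑ i, ∫ x in U, partialDeriv i φ x ^ 2 :=
      Finset.single_le_sum (f := fun i => ∫ x in U, partialDeriv i φ x ^ 2)
        (fun i _ => integral_nonneg fun x => sq_nonneg _) (Finset.mem_univ 0)
    rw [div_mul_eq_mul_div, div_le_iff₀ (by positivity), mul_assoc]
    gcongr
    have : (4 * (R : ℝ) ^ 2) * ∫ x in U, partialDeriv 0 φ x ^ 2 ≤
        4 * (R : ℝ) ^ 2 * ∑ i, ∫ x in U, partialDeriv i φ x ^ 2 := by gcongr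
    linarith
  obtain ⟨v, hv, hveq⟩ := exists_mem_closure_of_coercive (testSubmodule U) b
    (κ := a / (4 * R ^ 2 + 1)) (by positivity) hcoer ℓ
  obtain ⟨s, hs, hsl⟩ := mem_closure_iff_seq_limit.1 hv
  choose φ hφ hsφ using hs
  refine ⟨v 0, fun i => v i.succ, HasGrad0.of_tendsto (Lp.memLp _) (fun i => Lp.memLp _) hφ ?_,
    fun φ hφ => ?_⟩
  · have hk : ∀ k, Tendsto (fun n => ‖v k - s n k‖ₑ) atTop (𝓝 0) := by
      intro k
      have h1 : Tendsto (fun n => v k - s n k) atTop (𝓝 (v k - v k)) :=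
        tendsto_const_nhds.sub (((pr k).continuous.tendsto v).comp hsl)
      have h2 := (continuous_enorm.tendsto _).comp h1
      simpa [Function.comp_def] using h2
    refine ⟨(hk 0).congr fun n => ?_, fun i => (hk i.succ).congr fun n => ?_⟩
    · rw [L2Norm_sub_toLp (Lp.memLp _) ((hφ n).1.memLp _ _), Lp.toLp_coeFn, hsφ]; rfl
    · rw [L2Norm_sub_toLp (Lp.memLp _) (((hφ n).partialDeriv i).1.memLp _ _), Lp.toLp_coeFn, hsφ]
      rfl
  · rw [← hℓ φ hφ, ← hveq _ ⟨φ, hφ, rfl⟩, hb]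

end Existence


/-! ### Boundary charts -/

/-- The cross section variable `x'` of `x = (x', x₃)`. -/
noncomputable def crossSection (x : E3) : E2 := !₂[x 0, x 1]

@[simp] lemma crossSection_point (y : E2) (t : ℝ) : crossSection (point y t) = y := by
  ext i; fin_cases i <;> simp [crossSection, point]

@[simp] lemma point_two (y : E2) (t : ℝ) : point y t 2 = t := by simp [point]

lemma mem_waveguide {ω : Set E2} {x : E3} : x ∈ waveguide ω ↔ crossSection x ∈ ω := by
  simp [waveguide, cylinder, crossSection]

lemma continuous_crossSection : Continuous crossSection := by
  unfold crossSection; fun_prop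

lemma continuous_point : Continuous fun q : E2 × ℝ => point q.1 q.2 := by
  unfold point
  refine (PiLp.continuous_toLp 2 _).comp (continuous_pi fun i => ?_)
  fin_cases i <;> simp <;> fun_prop

lemma measurePreserving_point : MeasurePreserving (fun q : E2 × ℝ => point q.1 q.2)
    (volume.prod volume) volume := by
  have h1 := (volume_preserving_piFinSuccAbove (fun _ : Fin 3 => ℝ) (Fin.last 2)).symm
  have h2 := (PiLp.volume_preserving_toLp (Fin 3)).comp h1
  have h3 : MeasurePreserving (Prod.map id (WithLp.ofLp : E2 → Fin 2 → ℝ))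
      ((volume : Measure ℝ).prod (volume : Measure E2)) (volume.prod volume) :=
    (MeasurePreserving.id _).prod (PiLp.volume_preserving_ofLp (Fin 2))
  have h4 := (h2.comp h3).comp (Measure.measurePreserving_swap (μ := (volume : Measure E2))
    (ν := (volume : Measure ℝ)))
  convert! h4 using 1
  ext q i
  fin_cases i
  · rfl
  · rfl
  · rfl

/-- The point of the plane with coordinates `(a, b)` in the Cartesian frame `e`. -/
noncomputable def chartPoint (e : E2 ≃ᵃⁱ[ℝ] E2) (a b : ℝ) : E2 := e.symm !₂[a, b]

section Chart

variable (e : E2 ≃ᵃⁱ[ℝ] E2)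

@[simp] lemma chart_chartPoint_zero (a b : ℝ) : e (chartPoint e a b) 0 = a := by
  simp [chartPoint]

@[simp] lemma chart_chartPoint_one (a b : ℝ) : e (chartPoint e a b) 1 = b := by
  simp [chartPoint]

@[simp] lemma chartPoint_chart (y : E2) : chartPoint e (e y 0) (e y 1) = y := by
  have : (!₂[e y 0, e y 1] : E2) = e y := by ext i; fin_cases i <;> simp
  rw [chartPoint, this, e.symm_apply_apply]

lemma dist_chartPoint (a b b' : ℝ) : dist (chartPoint e a b) (chartPoint e a b') = |b - b'| := by
  rw [chartPoint, chartPoint, e.symm.dist_map, EuclideanSpace.dist_eq]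
  simp [Real.sqrt_sq_eq_abs, Real.dist_eq]

lemma continuous_chartPoint : Continuous fun q : ℝ × ℝ => chartPoint e q.1 q.2 := by
  unfold chartPoint
  refine e.symm.continuous.comp ((PiLp.continuous_toLp 2 _).comp (continuous_pi fun i => ?_))
  fin_cases i <;> simp <;> fun_prop

lemma measurePreserving_chartPoint : MeasurePreserving (fun q : ℝ × ℝ => chartPoint e q.1 q.2)
    (volume.prod volume) volume := by
  have h1 := (volume_preserving_finTwoArrow ℝ).symm
  have h2 := (PiLp.volume_preserving_toLp (Fin 2)).comp h1
  have h3 : MeasurePreserving e.symm (volume : Measure E2) volume := by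
    have := (measurePreserving_add_right (volume : Measure E2) (e.symm 0)).comp
      (e.symm.linearIsometryEquiv.measurePreserving)
    convert! this using 1
    ext1 x
    have := e.symm.map_vadd 0 x
    simpa using this
  have h4 := h3.comp h2
  convert! h4 using 1

lemma abs_chart_sub_le (y z : E2) (i : Fin 2) : |e y i - e z i| ≤ dist y z := by
  rw [← e.dist_map, dist_eq_norm]
  simpa using PiLp.norm_apply_le (e y - e z) i

/-- The order `(t, a, b)` of the parameters puts the height `b` innermost, where the one-dimensional
trace inequality is applied. -/
lemma measurePreserving_chart_point :
    MeasurePreserving (fun q : ℝ × ℝ × ℝ => point (chartPoint e q.2.1 q.2.2) q.1)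
      (volume.prod (volume.prod volume)) volume := by
  have h1 := (measurePreserving_chartPoint e).prod (MeasurePreserving.id (volume : Measure ℝ))
  have h2 := (measurePreserving_point.comp h1).comp
    (Measure.measurePreserving_swap (μ := (volume : Measure ℝ))
      (ν := (volume : Measure ℝ).prod (volume : Measure ℝ)))
  exact h2

end Chart

/-- The graph chart near a boundary point: `ω` is the region above the graph of `γ` in the
ball of centre `p` and radius `r`. -/
structure IsGraphChart (ω : Set E2) (p : E2) (e : E2 ≃ᵃⁱ[ℝ] E2) (γ : ℝ → ℝ) (L : ℝ≥0) (r : ℝ) :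
    Prop where
  lip : LipschitzWith L γ
  pos : 0 < r
  mem_iff : ∀ x ∈ Metric.ball p r, (x ∈ ω ↔ γ (e x 0) < e x 1)

/-- The parameters of the part of the boundary graph close to `p`. -/
def chartBase (p : E2) (e : E2 ≃ᵃⁱ[ℝ] E2) (γ : ℝ → ℝ) (r : ℝ) : Set ℝ :=
  {a | chartPoint e a (γ a) ∈ Metric.ball p (3 / 4 * r)}

/-! ### Geometry of a graph chart and comparison of measures. -/

section GraphChart

variable {ω : Set E2} {p : E2} {e : E2 ≃ᵃⁱ[ℝ] E2} {γ : ℝ → ℝ} {L : ℝ≥0} {r : ℝ}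

lemma IsGraphChart.isOpen_base (h : IsGraphChart ω p e γ L r) : IsOpen (chartBase p e γ r) := by
  have : Continuous fun a => chartPoint e a (γ a) :=
    (continuous_chartPoint e).comp (continuous_id.prodMk h.lip.continuous)
  exact Metric.isOpen_ball.preimage this

lemma IsGraphChart.notMem (h : IsGraphChart ω p e γ L r) {a : ℝ} (ha : a ∈ chartBase p e γ r) :
    chartPoint e a (γ a) ∉ ω := by
  have h1 : chartPoint e a (γ a) ∈ Metric.ball p r :=
    Metric.ball_subset_ball (by linarith [h.pos]) ha
  rw [h.mem_iff _ h1]; simp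

/-- The base points lie in the ball of radius `3/4 r`, so a height of at most `r/16` stays inside
the ball of radius `r` in which the chart is valid. -/
lemma IsGraphChart.mem_of_lt (h : IsGraphChart ω p e γ L r) {a b : ℝ}
    (ha : a ∈ chartBase p e γ r) (hb : γ a < b) (hb' : b ≤ γ a + r / 16) :
    chartPoint e a b ∈ ω := by
  have h1 : chartPoint e a b ∈ Metric.ball p r := by
    rw [Metric.mem_ball]
    have h2 := dist_triangle (chartPoint e a b) (chartPoint e a (γ a)) p
    rw [dist_chartPoint, abs_of_pos (by linarith)] at h2
    have h3 : dist (chartPoint e a (γ a)) p < 3 / 4 * r := ha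
    linarith [h.pos]
  rw [h.mem_iff _ h1]; simpa using hb

/-- A graph point is not in `ω`, but the points just above it are. -/
lemma IsGraphChart.mem_frontier (h : IsGraphChart ω p e γ L r) {a : ℝ}
    (ha : a ∈ chartBase p e γ r) : chartPoint e a (γ a) ∈ frontier ω := by
  refine ⟨?_, fun hi => h.notMem ha (interior_subset hi)⟩
  rw [Metric.mem_closure_iff]
  intro ε hε
  have hr := h.pos
  set d := min (ε / 2) (r / 16)
  have hd : 0 < d := lt_min (by linarith) (by linarith)
  refine ⟨chartPoint e a (γ a + d), h.mem_of_lt ha (by linarith) ?_, ?_⟩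
  · have := min_le_right (ε / 2) (r / 16); linarith
  · rw [dist_chartPoint]
    have := min_le_left (ε / 2) (r / 16)
    rw [show γ a - (γ a + d) = -d by ring, abs_neg, abs_of_pos hd]; linarith

lemma IsGraphChart.infDist_le (h : IsGraphChart ω p e γ L r) {a b δ : ℝ}
    (ha : a ∈ chartBase p e γ r) (hb : γ a < b) (hb' : b ≤ γ a + δ) :
    Metric.infDist (chartPoint e a b) ωᶜ ≤ δ := by
  refine (Metric.infDist_le_dist_of_mem (h.notMem ha)).trans ?_
  rw [dist_chartPoint, abs_of_pos (by linarith)]; linarith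

/-- A move by `ε` changes the height by at most `ε` and the graph function by at most `L ε`; since
`q` lies on or below the graph, `y` is at most `(1 + L) ε` above it. The projection of `y` to the
graph is within `r/2 + ε + δ < 3/4 r` of `p`, which explains the radius in `chartBase`. -/
lemma IsGraphChart.mem_strip (h : IsGraphChart ω p e γ L r) {y q : E2} (hy : y ∈ ω) (hq : q ∉ ω)
    (hqp : q ∈ Metric.ball p (r / 2)) {ε δ : ℝ} (hyq : dist y q < ε) (hδ : (1 + L) * ε ≤ δ)
    (hδr : δ ≤ r / 16) :
    e y 0 ∈ chartBase p e γ r ∧ γ (e y 0) < e y 1 ∧ e y 1 ≤ γ (e y 0) + δ := by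
  have hr := h.pos
  have hε : 0 < ε := dist_nonneg.trans_lt hyq
  have hεδ : ε ≤ δ := by nlinarith [L.2, mul_nonneg L.2 hε.le]
  have hqp' : dist q p < r / 2 := hqp
  have hyp : dist y p < r / 2 + ε := (dist_triangle y q p).trans_lt (by linarith)
  have h1 := (h.mem_iff y (by rw [Metric.mem_ball]; linarith)).1 hy
  have h2 := not_lt.1 (fun hh => hq ((h.mem_iff q (by rw [Metric.mem_ball]; linarith)).2 hh))
  have h3 := abs_chart_sub_le e y q 1
  have h4 := h.lip.dist_le_mul (e q 0) (e y 0)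
  have h5 := abs_chart_sub_le e q y 0
  rw [Real.dist_eq, Real.dist_eq] at h4
  rw [dist_comm q y] at h5
  have h6 : |γ (e q 0) - γ (e y 0)| ≤ L * ε :=
    h4.trans (by gcongr; exact h5.trans hyq.le)
  have h7 := (abs_le.1 h3).2
  have h8 := (abs_le.1 h6).2
  have h9 : e y 1 ≤ γ (e y 0) + δ := by nlinarith
  refine ⟨?_, h1, h9⟩
  change dist _ _ < _
  have h10 := dist_triangle (chartPoint e (e y 0) (γ (e y 0))) y p
  have h11 : dist (chartPoint e (e y 0) (γ (e y 0))) y ≤ δ := by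
    conv_lhs => rw [← chartPoint_chart e y]
    simp only [chart_chartPoint_zero]
    rw [dist_chartPoint, abs_sub_comm, abs_of_pos (by linarith)]
    linarith
  linarith

/-- The arc length of a graph dominates the Lebesgue measure on its base. -/
lemma IsGraphChart.lintegral_base_le (h : IsGraphChart ω p e γ L r) {g : E2 → ℝ≥0∞}
    (hg : Measurable g) :
    ∫⁻ a in chartBase p e γ r, g (chartPoint e a (γ a)) ≤
      ∫⁻ y in frontier ω, g y ∂(μH[1] : Measure E2) := by
  have hc : Continuous fun a => chartPoint e a (γ a) :=
    (continuous_chartPoint e).comp (continuous_id.prodMk h.lip.continuous)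
  have hle : Measure.map (fun a => chartPoint e a (γ a)) (volume.restrict (chartBase p e γ r)) ≤
      (μH[1] : Measure E2).restrict (frontier ω) := by
    refine Measure.le_iff.2 fun B hB => ?_
    rw [Measure.map_apply hc.measurable hB, Measure.restrict_apply (hc.measurable hB),
      Measure.restrict_apply hB]
    set S := (fun a => chartPoint e a (γ a)) ⁻¹' B ∩ chartBase p e γ r
    set T : Set E2 := B ∩ frontier ω
    -- The first chart coordinate is `1`-Lipschitz and maps the graph piece onto a set containing
    -- `S`; Lipschitz maps with constant `1` do not increase Hausdorff measure, and `μH[1]` is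
    -- Lebesgue measure on the line.
    have hST : S ⊆ (fun y => e y 0) '' T := by
      rintro a ⟨ha, ha'⟩
      exact ⟨chartPoint e a (γ a), ⟨ha, h.mem_frontier ha'⟩, by simp⟩
    have hlip : LipschitzWith 1 (fun y : E2 => e y 0) :=
      LipschitzWith.of_dist_le_mul fun y z => by
        simpa [Real.dist_eq] using abs_chart_sub_le e y z 0
    calc volume S ≤ volume ((fun y => e y 0) '' T) := measure_mono hST
      _ = μH[1] ((fun y => e y 0) '' T) := by rw [hausdorffMeasure_real]
      _ ≤ ((1 : ℝ≥0) : ℝ≥0∞) ^ (1 : ℝ) * μH[1] T :=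
        hlip.hausdorffMeasure_image_le zero_le_one T
      _ = μH[1] T := by simp
  calc _ = ∫⁻ y, g y ∂(Measure.map (fun a => chartPoint e a (γ a))
        (volume.restrict (chartBase p e γ r))) := (lintegral_map hg hc.measurable).symm
    _ ≤ _ := lintegral_mono' hle le_rfl

end GraphChart

/-- A one dimensional trace inequality. -/
lemma lintegral_sq_Ioc_le {h h' : ℝ → ℝ} (hd : ∀ x, HasDerivAt h (h' x) x) (hc : Continuous h')
    (s : ℝ) (δ : ℝ≥0) :
    ∫⁻ b in Ioc s (s + δ), ‖h b‖ₑ ^ 2 ≤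
      2 * δ * ‖h s‖ₑ ^ 2 + 2 * δ ^ 2 * ∫⁻ b in Ioc s (s + δ), ‖h' b‖ₑ ^ 2 := by
  set I := ∫⁻ b in Ioc s (s + δ), ‖h' b‖ₑ ^ 2
  have hvol : (volume.restrict (Ioc s (s + δ))) univ = δ := by simp
  -- The fundamental theorem of calculus and Cauchy–Schwarz on an interval of length at most `δ`;
  -- the factors `2` come from squaring a sum.
  have key : ∀ b ∈ Ioc s (s + δ), ‖h b‖ₑ ^ 2 ≤ 2 * ‖h s‖ₑ ^ 2 + 2 * (δ * I) := by
    intro b hb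
    have h1 : h b = h s + ∫ x in s..b, h' x := by
      rw [intervalIntegral.integral_eq_sub_of_hasDerivAt (fun x _ => hd x)
        (hc.intervalIntegrable _ _)]
      ring
    have h2 : ‖∫ x in s..b, h' x‖ₑ ^ 2 ≤ δ * I := by
      have h3 : ‖∫ x in s..b, h' x‖ₑ ≤ eLpNorm h' 1 (volume.restrict (Ioc s (s + δ))) := by
        rw [intervalIntegral.integral_of_le hb.1.le, eLpNorm_one_eq_lintegral_enorm]
        refine (enorm_integral_le_lintegral_enorm _).trans ?_
        exact lintegral_mono_set (Ioc_subset_Ioc_right hb.2)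
      have h4 := eLpNorm_le_eLpNorm_mul_rpow_measure_univ (p := 1) (q := 2) (by norm_num)
        (hc.aestronglyMeasurable (μ := volume.restrict (Ioc s (s + δ))))
      rw [hvol] at h4
      have h5 : eLpNorm h' 2 (volume.restrict (Ioc s (s + δ))) ^ 2 = I := by
        rw [eLpNorm_eq_lintegral_rpow_enorm_toReal (by simp) (by simp), ← ENNReal.rpow_natCast,
          ← ENNReal.rpow_mul]
        simp [I]
      calc _ ≤ (eLpNorm h' 2 (volume.restrict (Ioc s (s + δ))) *
            (δ : ℝ≥0∞) ^ (1 / (1 : ℝ≥0∞).toReal - 1 / (2 : ℝ≥0∞).toReal)) ^ 2 := by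
              gcongr; exact h3.trans h4
        _ = δ * I := by
          rw [mul_pow, h5, ← ENNReal.rpow_natCast ((δ : ℝ≥0∞) ^ _), ← ENNReal.rpow_mul]
          norm_num [mul_comm]
    rw [h1]
    calc ‖h s + ∫ x in s..b, h' x‖ₑ ^ 2 ≤ (‖h s‖ₑ + ‖∫ x in s..b, h' x‖ₑ) ^ 2 := by
          gcongr; exact enorm_add_le _ _
      _ ≤ 2 * (‖h s‖ₑ ^ 2 + ‖∫ x in s..b, h' x‖ₑ ^ 2) := by
          have := ENNReal.rpow_add_le_mul_rpow_add_rpow ‖h s‖ₑ ‖∫ x in s..b, h' x‖ₑ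
            (p := 2) (by norm_num)
          norm_num at this
          exact_mod_cast this
      _ ≤ _ := by rw [mul_add]; gcongr
  calc _ ≤ ∫⁻ b in Ioc s (s + δ), (2 * ‖h s‖ₑ ^ 2 + 2 * (δ * I)) :=
        setLIntegral_mono measurable_const key
    _ = _ := by
        rw [lintegral_const, hvol]; ring


/-! ### The collar estimate -/

/-- The points of `ω × ℝ` at distance at most `δ` from the lateral boundary. -/
def collar (ω : Set E2) (δ : ℝ) : Set E3 :=
  {x | crossSection x ∈ ω ∧ Metric.infDist (crossSection x) ωᶜ ≤ δ}

lemma measurableSet_collar {ω : Set E2} (hω : IsOpen ω) (δ : ℝ) : MeasurableSet (collar ω δ) := by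
  refine (hω.preimage continuous_crossSection).measurableSet.inter ?_
  exact (isClosed_le ((Metric.continuous_infDist_pt _).comp continuous_crossSection)
    continuous_const).measurableSet

/-- The direction of the second chart axis, as a vector of `ℝ³`. -/
noncomputable def chartDir (e : E2 ≃ᵃⁱ[ℝ] E2) : E3 :=
  point (e.symm.linearIsometryEquiv !₂[0, 1]) 0

lemma abs_chartDir_le (e : E2 ≃ᵃⁱ[ℝ] E2) (i : Fin 3) : |chartDir e i| ≤ 1 := by
  have h1 : ‖e.symm.linearIsometryEquiv (!₂[0, 1] : E2)‖ = 1 := by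
    rw [LinearIsometryEquiv.norm_map]
    simp [EuclideanSpace.norm_eq]
  have h2 := fun j => PiLp.norm_apply_le (e.symm.linearIsometryEquiv (!₂[0, 1] : E2)) j
  rw [h1] at h2
  fin_cases i
  · exact h2 0
  · exact h2 1
  · simp [chartDir, point]

lemma hasDerivAt_point_chartPoint (e : E2 ≃ᵃⁱ[ℝ] E2) (a b t : ℝ) :
    HasDerivAt (fun b => point (chartPoint e a b) t) (chartDir e) b := by
  have h1 : (fun b => point (chartPoint e a b) t) =
      fun b : ℝ => point (chartPoint e a 0) t + b • chartDir e := by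
    ext b i
    have h2 : chartPoint e a b = chartPoint e a 0 +
        b • e.symm.linearIsometryEquiv !₂[0, 1] := by
      rw [chartPoint, chartPoint, ← map_smul, add_comm, ← vadd_eq_add, ← e.symm.map_vadd]
      congr 1
      ext j; fin_cases j <;> simp
    fin_cases i
    · simp [point, h2, chartDir]
    · simp [point, h2, chartDir]
    · simp [point, chartDir]
  rw [h1]
  have := ((hasDerivAt_id b).smul_const (chartDir e)).const_add (point (chartPoint e a 0) t)
  simpa using this

lemma fderiv_apply_eq_sum (φ : E3 → ℝ) (x w : E3) :
    fderiv ℝ φ x w = ∑ i, w i * partialDeriv i φ x := by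
  have : w = ∑ i, w i • EuclideanSpace.single i (1 : ℝ) := by
    ext j
    fin_cases j <;> simp [Fin.sum_univ_three]
  conv_lhs => rw [this, map_sum]
  simp [partialDeriv]

lemma enorm_sq_sum_three_le (f : Fin 3 → ℝ) : ‖∑ i, f i‖ₑ ^ 2 ≤ 3 * ∑ i, ‖f i‖ₑ ^ 2 := by
  have h : (∑ i, f i) ^ 2 ≤ 3 * ∑ i, f i ^ 2 := by
    have := sq_sum_le_card_mul_sum_sq (s := Finset.univ) (f := f)
    simpa using this
  have e : ∀ r : ℝ, ‖r‖ₑ ^ 2 = ENNReal.ofReal (r ^ 2) := fun r => by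
    rw [Real.enorm_eq_ofReal_abs, ← ENNReal.ofReal_pow (abs_nonneg _), sq_abs]
  simp only [e]
  rw [← ENNReal.ofReal_sum_of_nonneg fun i _ => sq_nonneg _]
  refine (ENNReal.ofReal_le_ofReal h).trans (le_of_eq ?_)
  rw [ENNReal.ofReal_mul (by norm_num)]
  norm_num

/-- The region of chart parameters `(t, a, b)` above the base and at height at most `δ` above the
graph. -/
def chartStrip (J : Set ℝ) (γ : ℝ → ℝ) (δ : ℝ) : Set (ℝ × ℝ × ℝ) :=
  {q | q.2.1 ∈ J ∧ q.2.2 ∈ Ioc (γ q.2.1) (γ q.2.1 + δ)}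

lemma measurableSet_chartStrip {J : Set ℝ} {γ : ℝ → ℝ} (hJ : MeasurableSet J)
    (hγ : Continuous γ) (δ : ℝ) : MeasurableSet (chartStrip J γ δ) := by
  refine (hJ.preimage (by fun_prop)).inter ?_
  have h1 : MeasurableSet {q : ℝ × ℝ × ℝ | γ q.2.1 < q.2.2} :=
    (isOpen_lt (by fun_prop) (by fun_prop)).measurableSet
  have h2 : MeasurableSet {q : ℝ × ℝ × ℝ | q.2.2 ≤ γ q.2.1 + δ} :=
    (isClosed_le (by fun_prop) (by fun_prop)).measurableSet
  exact h1.inter h2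

lemma lintegral_chartStrip {J : Set ℝ} {γ : ℝ → ℝ} (hJ : MeasurableSet J)
    (hγ : Continuous γ) (δ : ℝ) {F : ℝ × ℝ × ℝ → ℝ≥0∞} (hF : Measurable F) :
    ∫⁻ q in chartStrip J γ δ, F q ∂(volume.prod (volume.prod volume)) =
      ∫⁻ t, ∫⁻ a in J, ∫⁻ b in Ioc (γ a) (γ a + δ), F (t, a, b) := by
  have hT := measurableSet_chartStrip hJ hγ δ
  have hm := hF.indicator hT
  rw [← lintegral_indicator hT, lintegral_prod _ hm.aemeasurable]
  refine lintegral_congr fun t => ?_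
  rw [lintegral_prod (fun y => (chartStrip J γ δ).indicator F (t, y))
    (hm.comp measurable_prodMk_left).aemeasurable, ← lintegral_indicator hJ]
  refine lintegral_congr fun a => ?_
  by_cases ha : a ∈ J
  · rw [indicator_of_mem ha, ← lintegral_indicator measurableSet_Ioc]
    refine lintegral_congr fun b => ?_
    by_cases hb : b ∈ Ioc (γ a) (γ a + δ)
    · rw [indicator_of_mem hb, indicator_of_mem (show (t, a, b) ∈ chartStrip J γ δ from ⟨ha, hb⟩)]
    · rw [indicator_of_notMem hb, indicator_of_notMem (fun h => hb h.2)]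
  · rw [indicator_of_notMem ha]
    simp only [indicator_of_notMem (fun h : (t, a, _) ∈ chartStrip J γ δ => ha h.1), lintegral_zero]

lemma lintegral_biUnion_finset_le {ι α : Type*} [MeasurableSpace α] (μ : Measure α) (s : Finset ι)
    (t : ι → Set α) (f : α → ℝ≥0∞) :
    ∫⁻ x in ⋃ i ∈ s, t i, f x ∂μ ≤ ∑ i ∈ s, ∫⁻ x in t i, f x ∂μ := by
  have h : ⋃ i ∈ s, t i = ⋃ i : s, t i := by ext x; simp
  rw [h, ← Finset.sum_coe_sort, ← tsum_fintype (L := SummationFilter.unconditional _)]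
  exact lintegral_iUnion_le _ _

/-- Linearity asks for measurability of one summand only, so nothing has to be checked for `g`,
which will itself be an inner integral. -/
lemma lintegral_lintegral_const_mul_add {J : Set ℝ} {f : ℝ → ℝ → ℝ≥0∞} {g : ℝ → ℝ → ℝ≥0∞}
    {c d : ℝ≥0∞} (hf : Measurable fun q : ℝ × ℝ => f q.1 q.2) (hc : c ≠ ∞) (hd : d ≠ ∞) :
    ∫⁻ t, ∫⁻ a in J, (c * f t a + d * g t a) =
      c * (∫⁻ t, ∫⁻ a in J, f t a) + d * ∫⁻ t, ∫⁻ a in J, g t a := by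
  have h1 : ∀ t, ∫⁻ a in J, (c * f t a + d * g t a) =
      c * (∫⁻ a in J, f t a) + d * ∫⁻ a in J, g t a := by
    intro t
    have hft : Measurable (f t) := hf.comp measurable_prodMk_left
    rw [lintegral_add_left (hft.const_mul c), lintegral_const_mul' _ _ hc,
      lintegral_const_mul' _ _ hd]
  simp_rw [h1]
  rw [lintegral_add_left (hf.lintegral_prod_right'.const_mul c), lintegral_const_mul' _ _ hc,
    lintegral_const_mul' _ _ hd]

/-! ### The trace inequality in one chart, then along the whole boundary. -/

section Strip

variable {ω : Set E2} {p : E2} {e : E2 ≃ᵃⁱ[ℝ] E2} {γ : ℝ → ℝ} {L : ℝ≥0} {r : ℝ}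

-- In chart coordinates the set on the left lies between the graph and its translate by `δ`. The
-- one-dimensional trace inequality is integrated over the base and over `x₃`: the values on the
-- graph are controlled by the surface measure, and the derivative term lives in the `δ`-collar. The
-- constant is `6 = 2 · 3`, with `3` from splitting the directional derivative into partial
-- derivatives.
set_option maxHeartbeats 1000000 in
lemma IsGraphChart.lintegral_strip_le (h : IsGraphChart ω p e γ L r)
    {φ : E3 → ℝ} (hφ : IsSmoothCompact φ) {ε : ℝ} {δ : ℝ≥0} (hδ : (1 + L) * ε ≤ δ)
    (hδr : δ ≤ r / 16) :
    ∫⁻ x in {x | crossSection x ∈ ω ∧ ∃ q, q ∉ ω ∧ q ∈ Metric.ball p (r / 2) ∧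
        dist (crossSection x) q < ε}, ‖φ x‖ₑ ^ 2 ≤
      2 * δ * ∫⁻ q, ‖φ (point q.1 q.2)‖ₑ ^ 2 ∂surfaceMeasure ω +
        6 * δ ^ 2 * ∑ i, ∫⁻ x in collar ω δ, ‖partialDeriv i φ x‖ₑ ^ 2 := by
  set J := chartBase p e γ r
  have hJ : MeasurableSet J := h.isOpen_base.measurableSet
  have hγ := h.lip.continuous
  let Φ : ℝ × ℝ × ℝ → E3 := fun q => point (chartPoint e q.2.1 q.2.2) q.1
  have hΦ : MeasurePreserving Φ (volume.prod (volume.prod volume)) volume :=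
    measurePreserving_chart_point e
  have hΦc : Continuous Φ :=
    continuous_point.comp (((continuous_chartPoint e).comp (by fun_prop)).prodMk (by fun_prop))
  -- Pulling the strip back by the left inverse `Ψ` of `Φ` gives a measurable subset of `ℝ³`
  -- directly, without studying images under `Φ`.
  let Ψ : E3 → ℝ × ℝ × ℝ := fun x => (x 2, e (crossSection x) 0, e (crossSection x) 1)
  have hΨ : Measurable Ψ := by
    have h1 : Continuous fun x => e (crossSection x) := e.continuous.comp continuous_crossSection
    have h2 : ∀ i, Continuous fun x => e (crossSection x) i := fun i =>
      (EuclideanSpace.proj i : E2 →L[ℝ] ℝ).continuous.comp h1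
    have h3 : Continuous fun x : E3 => x 2 := (EuclideanSpace.proj 2 : E3 →L[ℝ] ℝ).continuous
    exact (h3.prodMk ((h2 0).prodMk (h2 1))).measurable
  have hΨΦ : ∀ q, Ψ (Φ q) = q := fun q => by simp [Ψ, Φ]
  have hT := measurableSet_chartStrip hJ hγ δ
  have hφm : Measurable φ := hφ.continuous.measurable
  have hdm : ∀ i, Measurable (partialDeriv i φ) := fun i => (hφ.partialDeriv i).continuous.measurable
  have hpre : Φ ⁻¹' (Ψ ⁻¹' chartStrip J γ δ) = chartStrip J γ δ := by
    ext q; simp only [mem_preimage, hΨΦ]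
  have step1 : ∫⁻ x in {x | crossSection x ∈ ω ∧ ∃ q, q ∉ ω ∧ q ∈ Metric.ball p (r / 2) ∧
        dist (crossSection x) q < ε}, ‖φ x‖ₑ ^ 2 ≤
      ∫⁻ t, ∫⁻ a in J, ∫⁻ b in Ioc (γ a) (γ a + δ), ‖φ (point (chartPoint e a b) t)‖ₑ ^ 2 := by
    calc _ ≤ ∫⁻ x in Ψ ⁻¹' chartStrip J γ δ, ‖φ x‖ₑ ^ 2 := by
          refine lintegral_mono_set ?_
          rintro x ⟨hx, q, hq, hqp, hxq⟩
          have := h.mem_strip hx hq hqp hxq hδ hδr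
          exact ⟨this.1, this.2⟩
      _ = ∫⁻ q in Φ ⁻¹' (Ψ ⁻¹' chartStrip J γ δ), ‖φ (Φ q)‖ₑ ^ 2
            ∂(volume.prod (volume.prod volume)) :=
          (hΦ.setLIntegral_comp_preimage (hT.preimage hΨ) (by fun_prop)).symm
      _ = _ := by
          rw [hpre, lintegral_chartStrip hJ hγ δ (F := fun q => ‖φ (Φ q)‖ₑ ^ 2)
            ((hφm.comp hΦc.measurable).enorm.pow_const 2)]
  let ψ : E3 → ℝ := fun x => fderiv ℝ φ x (chartDir e)
  have hψc : Continuous ψ := (hφ.1.continuous_fderiv (by simp)).clm_apply continuous_const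
  have h1d : ∀ t a, ∫⁻ b in Ioc (γ a) (γ a + δ), ‖φ (point (chartPoint e a b) t)‖ₑ ^ 2 ≤
      2 * δ * ‖φ (point (chartPoint e a (γ a)) t)‖ₑ ^ 2 + 2 * δ ^ 2 *
        ∫⁻ b in Ioc (γ a) (γ a + δ), ‖ψ (point (chartPoint e a b) t)‖ₑ ^ 2 := by
    intro t a
    refine lintegral_sq_Ioc_le (h := fun b => φ (point (chartPoint e a b) t))
      (h' := fun b => ψ (point (chartPoint e a b) t)) (fun b => ?_) ?_ (γ a) δ
    · exact (hφ.differentiable _).hasFDerivAt.comp_hasDerivAt b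
        (hasDerivAt_point_chartPoint e a b t)
    · exact hψc.comp (hΦc.comp (by fun_prop : Continuous fun b => (t, a, b)))
  have hψ : ∀ x, ‖ψ x‖ₑ ^ 2 ≤ 3 * ∑ i, ‖partialDeriv i φ x‖ₑ ^ 2 := by
    intro x
    simp only [ψ, fderiv_apply_eq_sum]
    refine (enorm_sq_sum_three_le _).trans ?_
    gcongr with i
    rw [enorm_mul]
    calc ‖chartDir e i‖ₑ * ‖partialDeriv i φ x‖ₑ ≤ 1 * ‖partialDeriv i φ x‖ₑ := by
          gcongr
          rw [Real.enorm_eq_ofReal_abs]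
          exact ENNReal.ofReal_le_one.2 (abs_chartDir_le e i)
      _ = _ := one_mul _
  -- boundary term
  have hbd : ∫⁻ t, ∫⁻ a in J, ‖φ (point (chartPoint e a (γ a)) t)‖ₑ ^ 2 ≤
      ∫⁻ q, ‖φ (point q.1 q.2)‖ₑ ^ 2 ∂surfaceMeasure ω := by
    have hm : Measurable fun q : E2 × ℝ => ‖φ (point q.1 q.2)‖ₑ ^ 2 :=
      (hφm.comp continuous_point.measurable).enorm.pow_const 2
    have hcb : Continuous fun q : ℝ × ℝ => point (chartPoint e q.2 (γ q.2)) q.1 :=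
      hΦc.comp (by fun_prop : Continuous fun q : ℝ × ℝ => (q.1, q.2, γ q.2))
    rw [surfaceMeasure, lintegral_prod _ hm.aemeasurable, lintegral_lintegral_swap]
    · exact h.lintegral_base_le (g := fun y => ∫⁻ t, ‖φ (point y t)‖ₑ ^ 2)
        hm.lintegral_prod_right'
    · exact ((hφm.comp hcb.measurable).enorm.pow_const 2).aemeasurable
  -- interior term
  have hin : ∫⁻ t, ∫⁻ a in J, ∫⁻ b in Ioc (γ a) (γ a + δ),
      ‖ψ (point (chartPoint e a b) t)‖ₑ ^ 2 ≤
        3 * ∑ i, ∫⁻ x in collar ω δ, ‖partialDeriv i φ x‖ₑ ^ 2 := by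
    calc _ = ∫⁻ q in Φ ⁻¹' (Ψ ⁻¹' chartStrip J γ δ), ‖ψ (Φ q)‖ₑ ^ 2
            ∂(volume.prod (volume.prod volume)) := by
          rw [hpre, lintegral_chartStrip hJ hγ δ (F := fun q => ‖ψ (Φ q)‖ₑ ^ 2)
            ((hψc.measurable.comp hΦc.measurable).enorm.pow_const 2)]
      _ = ∫⁻ x in Ψ ⁻¹' chartStrip J γ δ, ‖ψ x‖ₑ ^ 2 :=
          hΦ.setLIntegral_comp_preimage (hT.preimage hΨ) (hψc.measurable.enorm.pow_const 2)
      _ ≤ ∫⁻ x in collar ω δ, ‖ψ x‖ₑ ^ 2 := by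
          refine lintegral_mono_set ?_
          rintro x ⟨ha, hb⟩
          have e1 : chartPoint e (e (crossSection x) 0) (e (crossSection x) 1) = crossSection x :=
            chartPoint_chart e _
          have hm := h.mem_of_lt ha hb.1 (hb.2.trans (add_le_add le_rfl hδr))
          have hd := h.infDist_le ha hb.1 hb.2
          dsimp only [Ψ] at hm hd
          rw [e1] at hm hd
          exact ⟨hm, hd⟩
      _ ≤ ∫⁻ x in collar ω δ, 3 * ∑ i, ‖partialDeriv i φ x‖ₑ ^ 2 := lintegral_mono hψ
      _ = _ := by
          rw [lintegral_const_mul _ (Finset.measurable_sum _ fun i _ => (hdm i).enorm.pow_const 2),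
            lintegral_finsetSum _ fun i _ => (hdm i).enorm.pow_const 2]
  have hm1 : Measurable fun q : ℝ × ℝ => ‖φ (point (chartPoint e q.2 (γ q.2)) q.1)‖ₑ ^ 2 :=
    (hφm.comp (hΦc.comp (by fun_prop : Continuous fun q : ℝ × ℝ =>
      (q.1, q.2, γ q.2))).measurable).enorm.pow_const 2
  calc _ ≤ _ := step1
    _ ≤ ∫⁻ t, ∫⁻ a in J, (2 * δ * ‖φ (point (chartPoint e a (γ a)) t)‖ₑ ^ 2 + 2 * δ ^ 2 *
        ∫⁻ b in Ioc (γ a) (γ a + δ), ‖ψ (point (chartPoint e a b) t)‖ₑ ^ 2) :=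
      lintegral_mono fun t => lintegral_mono fun a => h1d t a
    _ = 2 * δ * (∫⁻ t, ∫⁻ a in J, ‖φ (point (chartPoint e a (γ a)) t)‖ₑ ^ 2) + 2 * δ ^ 2 *
        ∫⁻ t, ∫⁻ a in J, ∫⁻ b in Ioc (γ a) (γ a + δ),
          ‖ψ (point (chartPoint e a b) t)‖ₑ ^ 2 := by
      exact lintegral_lintegral_const_mul_add hm1 (by finiteness) (by finiteness)
    _ ≤ 2 * δ * ∫⁻ q, ‖φ (point q.1 q.2)‖ₑ ^ 2 ∂surfaceMeasure ω + 2 * δ ^ 2 *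
        (3 * ∑ i, ∫⁻ x in collar ω δ, ‖partialDeriv i φ x‖ₑ ^ 2) := by gcongr
    _ = _ := by ring

/-- The collar estimate: a function that is small on the lateral boundary is small, to first order
in `ε`, on the `ε`-collar. -/
lemma exists_lintegral_collar_le (hω : IsOpen ω) (hb : Bornology.IsBounded ω)
    (hlip : HasLipschitzBoundary ω) :
    ∃ (K N : ℝ≥0) (ε₀ : ℝ), 0 < ε₀ ∧ 1 ≤ K ∧ ∀ ε : ℝ≥0, ε < ε₀ → ∀ φ, IsSmoothCompact φ →
      ∫⁻ x in {x | crossSection x ∈ ω ∧ Metric.infDist (crossSection x) ωᶜ < ε}, ‖φ x‖ₑ ^ 2 ≤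
        N * ∫⁻ q, ‖φ (point q.1 q.2)‖ₑ ^ 2 ∂surfaceMeasure ω +
          N * ε ^ 2 * ∑ i, ∫⁻ x in collar ω (K * ε), ‖partialDeriv i φ x‖ₑ ^ 2 := by
  have hcpt : IsCompact (frontier ω) :=
    Metric.isCompact_of_isClosed_isBounded isClosed_frontier
      (hb.closure.subset frontier_subset_closure)
  choose! e γ L r hL hr hmem using hlip
  have hchart : ∀ p ∈ frontier ω, IsGraphChart ω p (e p) (γ p) (L p) (r p) :=
    fun p hp => ⟨hL p hp, hr p hp, hmem p hp⟩
  obtain ⟨s, hs, hcov⟩ := hcpt.elim_nhds_subcover (fun p => Metric.ball p (r p / 2))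
    fun p hp => Metric.ball_mem_nhds p (half_pos (hr p hp))
  -- `K` dominates `1 + L p` for all charts of the finite cover, so a single height `K ε` serves
  -- every chart.
  set K : ℝ≥0 := 1 + ∑ p ∈ s, L p with hK
  have hLK : ∀ p ∈ s, 1 + L p ≤ K := fun p hp =>
    add_le_add le_rfl (Finset.single_le_sum (f := L) (fun _ _ => zero_le) hp)
  have hK1 : 1 ≤ K := le_self_add
  obtain ⟨ρ, hρ, hρs⟩ : ∃ ρ : ℝ, 0 < ρ ∧ ∀ p ∈ s, ρ ≤ r p := by
    by_cases hse : s.Nonempty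
    · obtain ⟨p0, hp0, hmin⟩ := s.exists_min_image r hse
      exact ⟨r p0, hr p0 (hs p0 hp0), hmin⟩
    · exact ⟨1, one_pos, fun p hp => (hse ⟨p, hp⟩).elim⟩
  have hKpos : (0 : ℝ) < K := by
    have : (1 : ℝ) ≤ K := by exact_mod_cast hK1
    linarith
  have hne : ω ≠ univ := by
    rintro rfl
    exact NormedSpace.unbounded_univ ℝ E2 hb
  -- One chart contributes `2 K ε`, bounded through `ε < ρ / (16 K)`, in front of the boundary term
  -- and `6 K² ε²` in front of the gradient; `N` adds this over the cover. The threshold on `ε`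
  -- ensures `K ε ≤ r p / 16` for every chart.
  set N : ℝ≥0 := s.card * (2 * K * (ρ / (16 * K)).toNNReal + 6 * K ^ 2) with hN
  refine ⟨K, N, ρ / (16 * K), by positivity, hK1, fun ε hε φ hφ => ?_⟩
  have hKε : (K : ℝ) * ε ≤ ρ / 16 := by
    have := mul_le_mul_of_nonneg_left hε.le hKpos.le
    calc (K : ℝ) * ε ≤ K * (ρ / (16 * K)) := this
      _ = ρ / 16 := by field_simp
  have hsub : {x | crossSection x ∈ ω ∧ Metric.infDist (crossSection x) ωᶜ < ε} ⊆
      ⋃ p ∈ s, {x | crossSection x ∈ ω ∧ ∃ q, q ∉ ω ∧ q ∈ Metric.ball p (r p / 2) ∧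
        dist (crossSection x) q < ε} := by
    rintro x ⟨hx, hxd⟩
    -- A nearest point of the complement lies on the boundary, hence in one of the covering balls of
    -- radius `r p / 2`.
    obtain ⟨q, hq, hdq⟩ := exists_mem_frontier_infDist_compl_eq_dist hx hne
    obtain ⟨p, hp, hqp⟩ := mem_iUnion₂.1 (hcov hq)
    refine mem_iUnion₂.2 ⟨p, hp, hx, q, ?_, hqp, by rwa [← hdq]⟩
    rw [frontier, hω.interior_eq] at hq
    exact hq.2
  set Bd := ∫⁻ q, ‖φ (point q.1 q.2)‖ₑ ^ 2 ∂surfaceMeasure ω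
  set In := ∑ i, ∫⁻ x in collar ω (K * ε), ‖partialDeriv i φ x‖ₑ ^ 2
  have hone : ∀ p ∈ s, ∫⁻ x in {x | crossSection x ∈ ω ∧ ∃ q, q ∉ ω ∧
      q ∈ Metric.ball p (r p / 2) ∧ dist (crossSection x) q < ε}, ‖φ x‖ₑ ^ 2 ≤
      2 * (K * ε) * Bd + 6 * (K * ε) ^ 2 * In := by
    intro p hp
    have := (hchart p (hs p hp)).lintegral_strip_le hφ (ε := ε) (δ := K * ε) ?_ ?_
    · simpa using this
    · have : (1 + L p : ℝ) ≤ K := by exact_mod_cast hLK p hp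
      push_cast
      gcongr
    · push_cast
      linarith [hρs p hp]
  have hε' : ε ≤ (ρ / (16 * K)).toNNReal := by
    rw [← NNReal.coe_le_coe, Real.coe_toNNReal _ (by positivity)]
    exact hε.le
  calc _ ≤ ∫⁻ x in ⋃ p ∈ s, {x | crossSection x ∈ ω ∧ ∃ q, q ∉ ω ∧
          q ∈ Metric.ball p (r p / 2) ∧ dist (crossSection x) q < ε}, ‖φ x‖ₑ ^ 2 :=
        lintegral_mono_set hsub
    _ ≤ ∑ p ∈ s, ∫⁻ x in {x | crossSection x ∈ ω ∧ ∃ q, q ∉ ω ∧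
          q ∈ Metric.ball p (r p / 2) ∧ dist (crossSection x) q < ε}, ‖φ x‖ₑ ^ 2 :=
        lintegral_biUnion_finset_le _ _ _ _
    _ ≤ ∑ p ∈ s, (2 * (K * ε) * Bd + 6 * (K * ε) ^ 2 * In) := Finset.sum_le_sum hone
    _ = (s.card * (2 * K * ε)) * Bd + s.card * (6 * K ^ 2) * ε ^ 2 * In := by
        rw [Finset.sum_const, nsmul_eq_mul]; ring
    _ ≤ N * Bd + N * ε ^ 2 * In := by
        gcongr
        · rw [hN]; push_cast
          gcongr
          refine le_add_right ?_
          gcongr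
        · rw [hN]; push_cast
          gcongr
          exact le_add_self

end Strip


/-! ### Products with cutoff functions -/

section Cutoff

variable {U V S : Set E3} {u : E3 → ℝ} {p : Fin 3 → E3 → ℝ}

lemma L2Norm_le_of_support (hU : MeasurableSet U) (hS : MeasurableSet S) {f g : E3 → ℝ} {c : ℝ≥0}
    (h1 : ∀ x ∈ U, x ∈ S → |f x| ≤ c * |g x|) (h2 : ∀ x ∈ U, x ∉ S → f x = 0) :
    L2Norm U f ≤ c * L2Norm S g := by
  have e : L2Norm U f ≤ c * L2Norm U (S.indicator g) := by
    have := eLpNorm_le_nnreal_smul_eLpNorm_of_ae_le_mul (μ := volume.restrict U)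
      (f := f) (g := S.indicator g) (c := c) ?_ 2
    · simpa [L2Norm, ENNReal.smul_def] using this
    · filter_upwards [ae_restrict_mem hU] with x hx
      by_cases hxS : x ∈ S
      · rw [indicator_of_mem hxS]
        exact_mod_cast h1 x hx hxS
      · rw [h2 x hx hxS]; simp
  refine e.trans ?_
  gcongr
  rw [L2Norm, eLpNorm_indicator_eq_eLpNorm_restrict hS]
  exact eLpNorm_mono_measure _ (by
    rw [Measure.restrict_restrict hS]
    exact Measure.restrict_mono inter_subset_left le_rfl)

lemma contDiff_partialDeriv_continuous {θ : E3 → ℝ}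
    (hθ : ContDiff ℝ ((⊤ : ℕ∞) : WithTop ℕ∞) θ) (i : Fin 3) : Continuous (partialDeriv i θ) :=
  (contDiff_partialDeriv hθ i).continuous

lemma HasGrad.mul_smooth (hU : IsOpen U) (h : HasGrad U u p) {θ : E3 → ℝ}
    (hθ : ContDiff ℝ ((⊤ : ℕ∞) : WithTop ℕ∞) θ) {c : ℝ≥0} (hc : ∀ x, |θ x| ≤ c)
    (hc' : ∀ i x, |partialDeriv i θ x| ≤ c) :
    HasGrad U (fun x => θ x * u x) (fun i x => θ x * p i x + partialDeriv i θ x * u x) where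
  memLp := by
    refine MemLp.of_le_mul (c := c) h.memLp (hθ.continuous.aestronglyMeasurable.mul h.memLp.1)
      (Eventually.of_forall fun x => ?_)
    rw [norm_mul]; gcongr; exact hc x
  memLp_grad i := by
    refine MemLp.add ?_ ?_
    · refine MemLp.of_le_mul (c := c) (h.memLp_grad i)
        (hθ.continuous.aestronglyMeasurable.mul (h.memLp_grad i).1)
        (Eventually.of_forall fun x => ?_)
      rw [norm_mul]; gcongr; exact hc x
    · refine MemLp.of_le_mul (c := c) h.memLp
        ((contDiff_partialDeriv_continuous hθ i).aestronglyMeasurable.mul h.memLp.1)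
        (Eventually.of_forall fun x => ?_)
      rw [norm_mul]; gcongr; exact hc' i x
  weak i := by
    have l1 : LocallyIntegrableOn (fun x => θ x * u x) U :=
      (h.weak i).1.continuousOn_mul hθ.continuous.continuousOn hU.isLocallyClosed
    have l2 : LocallyIntegrableOn (fun x => θ x * p i x) U :=
      (h.weak i).2.1.continuousOn_mul hθ.continuous.continuousOn hU.isLocallyClosed
    have l3 : LocallyIntegrableOn (fun x => partialDeriv i θ x * u x) U :=
      (h.weak i).1.continuousOn_mul (contDiff_partialDeriv_continuous hθ i).continuousOn
        hU.isLocallyClosed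
    refine ⟨l1, l2.add l3, fun φ hφ => ?_⟩
    have key := (h.weak i).2.2 _ (hφ.mul_left hθ)
    have hd : ∀ x, partialDeriv i (fun x => θ x * φ x) x =
        θ x * partialDeriv i φ x + partialDeriv i θ x * φ x := fun x =>
      partialDeriv_mul i (hθ.differentiable (by simp) x) (hφ.1.differentiable x)
    have e1 : ∫ x in U, u x * partialDeriv i (fun x => θ x * φ x) x =
        (∫ x in U, θ x * u x * partialDeriv i φ x) + ∫ x in U, partialDeriv i θ x * u x * φ x := by
      rw [← integral_add (l1.integrable_mul_test (hφ.partialDeriv i)).integrableOn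
        (l3.integrable_mul_test hφ).integrableOn]
      congr 1; ext x; rw [hd]; ring
    have e2 : ∫ x in U, p i x * (θ x * φ x) = ∫ x in U, θ x * p i x * φ x := by
      congr 1; ext x; ring
    rw [e1, e2] at key
    simp only [add_mul]
    rw [integral_add (l2.integrable_mul_test hφ).integrableOn
      (l3.integrable_mul_test hφ).integrableOn]
    linarith

lemma H1Tendsto.mul_smooth (hV : MeasurableSet V) (hVU : V ⊆ U) {φ : ℕ → E3 → ℝ}
    (hφ : ∀ n, IsSmoothCompact (φ n)) (h : HasGrad U u p) (hl : H1Tendsto U φ u p) {θ : E3 → ℝ}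
    (hθ : ContDiff ℝ ((⊤ : ℕ∞) : WithTop ℕ∞) θ) {c : ℝ≥0} (hc : ∀ x, |θ x| ≤ c)
    (hc' : ∀ i x, |partialDeriv i θ x| ≤ c) :
    H1Tendsto V (fun n x => θ x * φ n x) (fun x => θ x * u x)
      (fun i x => θ x * p i x + partialDeriv i θ x * u x) := by
  have t0 : Tendsto (fun n => c * L2Norm U (fun x => u x - φ n x)) atTop (𝓝 0) := by
    simpa using ENNReal.Tendsto.const_mul (a := (c : ℝ≥0∞)) hl.1 (Or.inr (by simp))
  refine ⟨tendsto_of_tendsto_of_tendsto_of_le_of_le tendsto_const_nhds t0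
    (fun _ => zero_le) fun n => ?_, fun i => ?_⟩
  · simp only [← mul_sub]
    refine (L2Norm_mul_le hV fun x _ => hc x).trans ?_
    gcongr
    exact L2Norm_mono_set hVU _
  · have t1 : Tendsto (fun n => c * L2Norm U (fun x => p i x - partialDeriv i (φ n) x)) atTop
        (𝓝 0) := by
      simpa using ENNReal.Tendsto.const_mul (a := (c : ℝ≥0∞)) (hl.2 i) (Or.inr (by simp))
    have t2 := t1.add t0
    rw [add_zero] at t2
    refine tendsto_of_tendsto_of_tendsto_of_le_of_le tendsto_const_nhds t2
      (fun _ => zero_le) fun n => ?_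
    have e : ∀ x, θ x * p i x + partialDeriv i θ x * u x - partialDeriv i (fun x => θ x * φ n x) x =
        θ x * (p i x - partialDeriv i (φ n) x) + partialDeriv i θ x * (u x - φ n x) := by
      intro x
      rw [partialDeriv_mul i (hθ.differentiable (by simp) x) ((hφ n).differentiable x)]
      ring
    simp only [e]
    have hm := Measure.restrict_mono (μ := (volume : Measure E3)) hVU le_rfl
    refine (L2Norm_add_le ?_ ?_).trans (add_le_add ?_ ?_)
    · exact hθ.continuous.aestronglyMeasurable.mul
        (((h.memLp_grad i).sub (((hφ n).partialDeriv i).memLp 2 _)).1.mono_measure hm)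
    · exact (contDiff_partialDeriv_continuous hθ i).aestronglyMeasurable.mul
        ((h.memLp.sub ((hφ n).memLp 2 _)).1.mono_measure hm)
    · refine (L2Norm_mul_le hV fun x _ => hc x).trans ?_
      gcongr
      exact L2Norm_mono_set hVU _
    · refine (L2Norm_mul_le hV fun x _ => hc' i x).trans ?_
      gcongr
      exact L2Norm_mono_set hVU _

lemma tendsto_L2Norm (hSU : S ⊆ U) {φ : ℕ → E3 → ℝ} (hu : MemLp u 2 (volume.restrict U))
    (hφ : ∀ n, MemLp (φ n) 2 (volume.restrict U))
    (hl : Tendsto (fun n => L2Norm U (fun x => u x - φ n x)) atTop (𝓝 0)) :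
    Tendsto (fun n => L2Norm S (φ n)) atTop (𝓝 (L2Norm S u)) := by
  have hm := Measure.restrict_mono (μ := (volume : Measure E3)) hSU le_rfl
  have hfin : L2Norm S u ≠ ∞ := (hu.mono_measure hm).2.ne
  have l1 := ENNReal.Tendsto.sub (tendsto_const_nhds (x := L2Norm S u)) hl (Or.inl hfin)
  have l2 := (tendsto_const_nhds (x := L2Norm S u)).add hl
  rw [tsub_zero] at l1
  rw [add_zero] at l2
  refine tendsto_of_tendsto_of_tendsto_of_le_of_le l1 l2 (fun n => ?_) fun n => ?_
  · rw [tsub_le_iff_right]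
    calc L2Norm S u = L2Norm S (fun x => φ n x + (u x - φ n x)) := by simp
      _ ≤ L2Norm S (φ n) + L2Norm S (fun x => u x - φ n x) :=
        L2Norm_add_le ((hφ n).mono_measure hm).1 ((hu.sub (hφ n)).mono_measure hm).1
      _ ≤ _ := by gcongr; exact L2Norm_mono_set hSU _
  · calc L2Norm S (φ n) = L2Norm S (fun x => u x - (u x - φ n x)) := by simp
      _ ≤ L2Norm S u + L2Norm S (fun x => u x - φ n x) :=
        L2Norm_sub_le (hu.mono_measure hm).1 ((hu.sub (hφ n)).mono_measure hm).1
      _ ≤ _ := by gcongr; exact L2Norm_mono_set hSU _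

end Cutoff

/-! ### Functions with zero trace -/

lemma lipschitzWith_crossSection : LipschitzWith 1 crossSection := by
  refine LipschitzWith.of_dist_le_mul fun x y => ?_
  rw [NNReal.coe_one, one_mul, EuclideanSpace.dist_eq, EuclideanSpace.dist_eq]
  refine Real.sqrt_le_sqrt ?_
  simp only [crossSection, Fin.sum_univ_two, Fin.sum_univ_three]
  simp

/-- Smooth cutoff functions equal to `1` away from the lateral boundary and to `0` near it. -/
lemma exists_boundary_cutoff (ω : Set E2) : ∃ C : ℝ≥0, ∀ ε : ℝ≥0, 0 < ε → ∃ η : E3 → ℝ,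
    ContDiff ℝ ((⊤ : ℕ∞) : WithTop ℕ∞) η ∧ (∀ x, |η x| ≤ 1) ∧ (∀ x, |1 - η x| ≤ 1) ∧
      (∀ i x, |partialDeriv i η x| ≤ C / ε) ∧
      (∀ x, ε ≤ Metric.infDist (crossSection x) ωᶜ → η x = 1) ∧
      ∀ x, Metric.infDist (crossSection x) ωᶜ ≤ ε / 8 → η x = 0 := by
  let χ : ContDiffBump (0 : ℝ) := ⟨1 / 4, 3 / 4, by norm_num, by norm_num⟩
  have hχs : ContDiff ℝ ((⊤ : ℕ∞) : WithTop ℕ∞) χ := χ.contDiff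
  obtain ⟨C, hC⟩ : ∃ C, LipschitzWith C χ :=
    ContDiff.lipschitzWith_of_hasCompactSupport χ.hasCompactSupport hχs (by simp)
  refine ⟨C, fun ε hε => ?_⟩
  have hε' : (0 : ℝ) < ε := hε
  have hd : LipschitzWith 1 fun x : E3 => Metric.infDist (crossSection x) ωᶜ := by
    simpa [Function.comp_def] using (Metric.lipschitz_infDist_pt ωᶜ).comp lipschitzWith_crossSection
  -- The distance to the complement is only Lipschitz, so it is smoothed with error at most `ε / 8`.
  -- Distance at least `ε` then gives `g / ε ≥ 7/8`, where `χ = 0`, and distance at most `ε / 8`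
  -- gives `|g / ε| ≤ 1/4`, where `χ = 1`.
  obtain ⟨g, hgs, hgl, hga⟩ := exists_contDiff_lipschitz_approx hd
    (show (0 : ℝ) < ε / 8 by positivity)
  have hηs : ContDiff ℝ ((⊤ : ℕ∞) : WithTop ℕ∞) fun x => 1 - χ (g x / ε) :=
    contDiff_const.sub (hχs.comp (hgs.div_const _))
  have h01 : ∀ t, 0 ≤ χ t ∧ χ t ≤ 1 := fun t => ⟨χ.nonneg, χ.le_one⟩
  refine ⟨fun x => 1 - χ (g x / ε), hηs, fun x => ?_, fun x => ?_, fun i x => ?_, fun x hx => ?_,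
    fun x hx => ?_⟩
  · have := h01 (g x / ε)
    rw [abs_le]; constructor <;> linarith
  · have := h01 (g x / ε)
    rw [abs_le]; constructor <;> linarith
  · have hl : LipschitzWith (C / ε) fun x => 1 - χ (g x / ε) := by
      refine LipschitzWith.of_dist_le_mul fun x y => ?_
      have h1 := hC.dist_le_mul (g x / ε) (g y / ε)
      have h2 := hgl.dist_le_mul x y
      rw [Real.dist_eq] at h1 h2 ⊢
      rw [Real.dist_eq, ← sub_div, abs_div, abs_of_pos hε'] at h1
      calc |1 - χ (g x / ε) - (1 - χ (g y / ε))| = |χ (g x / ε) - χ (g y / ε)| := by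
            rw [abs_sub_comm]; ring_nf
        _ ≤ C * (|g x - g y| / ε) := h1
        _ ≤ C * (((1 : ℝ≥0) : ℝ) * dist x y / ε) := by gcongr
        _ = _ := by push_cast; ring
    simpa using abs_partialDeriv_le_of_lipschitz hl i x
  · have h1 := (abs_le.1 (hga x)).1
    have : χ (g x / ε) = 0 := by
      refine χ.zero_of_le_dist ?_
      change 3 / 4 ≤ dist _ _
      rw [Real.dist_eq, sub_zero]
      refine le_trans ?_ (le_abs_self _)
      rw [le_div_iff₀ hε']
      linarith
    simp [this]
  · have h1 := abs_le.1 (hga x)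
    have h2 : 0 ≤ Metric.infDist (crossSection x) ωᶜ := Metric.infDist_nonneg
    have : χ (g x / ε) = 1 := by
      refine χ.one_of_mem_closedBall ?_
      change dist _ _ ≤ 1 / 4
      rw [Real.dist_eq, sub_zero, abs_div, abs_of_pos hε', div_le_iff₀ hε', abs_le]
      constructor <;> linarith
    simp [this]

lemma isOpen_waveguide {ω : Set E2} (hω : IsOpen ω) : IsOpen (waveguide ω) := by
  have : waveguide ω = crossSection ⁻¹' ω := by ext x; exact mem_waveguide
  rw [this]
  exact hω.preimage continuous_crossSection

lemma collar_subset (ω : Set E2) (δ : ℝ) : collar ω δ ⊆ waveguide ω :=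
  fun _ hx => mem_waveguide.2 hx.1

lemma infDist_compl_pos {ω : Set E2} (hω : IsOpen ω) (hb : Bornology.IsBounded ω) {y : E2}
    (hy : y ∈ ω) : 0 < Metric.infDist y ωᶜ := by
  have hne : (ωᶜ).Nonempty := by
    rw [nonempty_compl]
    rintro rfl
    exact NormedSpace.unbounded_univ ℝ E2 hb
  exact (hω.isClosed_compl.notMem_iff_infDist_pos hne).1 (fun h => h hy)

/-- Every point of the open set `ω` has positive distance to the complement, so the collars shrink
to the empty set and dominated convergence applies. -/
lemma tendsto_L2Norm_collar {ω : Set E2} (hω : IsOpen ω) (hb : Bornology.IsBounded ω)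
    {g : E3 → ℝ} (hg : MemLp g 2 (volume.restrict (waveguide ω))) {δ : ℕ → ℝ}
    (hδ : Tendsto δ atTop (𝓝 0)) :
    Tendsto (fun n => L2Norm (collar ω (δ n)) g ^ 2) atTop (𝓝 0) := by
  have hms := fun n => measurableSet_collar hω (δ n)
  have e : ∀ n, L2Norm (collar ω (δ n)) g ^ 2 =
      ∫⁻ x in waveguide ω, (collar ω (δ n)).indicator (fun x => ‖g x‖ₑ ^ 2) x := by
    intro n
    rw [L2Norm_sq, lintegral_indicator (hms n), Measure.restrict_restrict (hms n),
      inter_eq_left.2 (collar_subset _ _)]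
  simp only [e]
  have hgm : AEMeasurable (fun x => ‖g x‖ₑ ^ 2) (volume.restrict (waveguide ω)) :=
    hg.1.enorm.pow_const 2
  have := tendsto_lintegral_of_dominated_convergence' (μ := volume.restrict (waveguide ω))
    (F := fun n => (collar ω (δ n)).indicator (fun x => ‖g x‖ₑ ^ 2)) (f := fun _ => 0)
    (fun x => ‖g x‖ₑ ^ 2) (fun n => hgm.indicator (hms n))
    (fun n => Eventually.of_forall fun x => indicator_le_self _ _ x) ?_ ?_
  · simpa using this
  · rw [← L2Norm_sq]
    exact ENNReal.pow_ne_top hg.2.ne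
  · filter_upwards [ae_restrict_mem (isOpen_waveguide hω).measurableSet] with x hx
    have hpos := infDist_compl_pos hω hb (mem_waveguide.1 hx)
    refine tendsto_const_nhds.congr' ?_
    filter_upwards [hδ.eventually (gt_mem_nhds hpos)] with n hn
    rw [indicator_of_notMem]
    exact fun h => absurd h.2 (not_le.2 hn)

/-- A function of `H¹(Ω)` with vanishing trace on the lateral boundary belongs to `H¹₀(Ω)`. -/
theorem HasGrad.hasGrad0_of_trace_zero {ω : Set E2} (hω : IsOpen ω) (hb : Bornology.IsBounded ω)
    (hlip : HasLipschitzBoundary ω) {v : E3 → ℝ} {p : Fin 3 → E3 → ℝ}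
    (h : HasGrad (waveguide ω) v p) {φ : ℕ → E3 → ℝ} (hφ : ∀ n, IsSmoothCompact (φ n))
    (hl : H1Tendsto (waveguide ω) φ v p)
    (htr : Tendsto (fun n => eLpNorm (fun q : E2 × ℝ => φ n (point q.1 q.2)) 2
      (surfaceMeasure ω)) atTop (𝓝 0)) : HasGrad0 (waveguide ω) v p := by
  have hΩ := isOpen_waveguide hω
  obtain ⟨K, N, ε₀, hε₀, hK1, hcol⟩ := exists_lintegral_collar_le hω hb hlip
  obtain ⟨C, hcut⟩ := exists_boundary_cutoff ω
  let S : ℝ≥0 → Set E3 := fun ε =>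
    {x | crossSection x ∈ ω ∧ Metric.infDist (crossSection x) ωᶜ < ε}
  have hSm : ∀ ε, MeasurableSet (S ε) := fun ε =>
    ((hω.preimage continuous_crossSection).inter (isOpen_lt
      ((Metric.continuous_infDist_pt _).comp continuous_crossSection) continuous_const)).measurableSet
  have hSΩ : ∀ ε, S ε ⊆ waveguide ω := fun ε x hx => mem_waveguide.2 hx.1
  let G : ℝ≥0 → ℝ≥0∞ := fun δ => ∑ i, L2Norm (collar ω δ) (p i) ^ 2
  -- the collar estimate for `v`
  have hv : ∀ ε : ℝ≥0, ε < ε₀ → L2Norm (S ε) v ^ 2 ≤ N * ε ^ 2 * G (K * ε) := by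
    intro ε hε
    have hsurf : ∀ n, ∫⁻ q, ‖φ n (point q.1 q.2)‖ₑ ^ 2 ∂surfaceMeasure ω =
        eLpNorm (fun q : E2 × ℝ => φ n (point q.1 q.2)) 2 (surfaceMeasure ω) ^ 2 := by
      intro n
      rw [eLpNorm_eq_lintegral_rpow_enorm_toReal (by simp) (by simp), ← ENNReal.rpow_natCast,
        ← ENNReal.rpow_mul]
      simp
    have l1 := ENNReal.Tendsto.pow (n := 2) (tendsto_L2Norm (hSΩ ε) h.memLp
      (fun n => (hφ n).memLp 2 _) hl.1)
    have l2 : Tendsto (fun n => N * eLpNorm (fun q : E2 × ℝ => φ n (point q.1 q.2)) 2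
        (surfaceMeasure ω) ^ 2 + N * ε ^ 2 *
          ∑ i, L2Norm (collar ω (K * ε)) (partialDeriv i (φ n)) ^ 2) atTop
        (𝓝 (N * 0 ^ 2 + N * ε ^ 2 * ∑ i, L2Norm (collar ω (K * ε)) (p i) ^ 2)) := by
      refine Tendsto.add (ENNReal.Tendsto.const_mul (ENNReal.Tendsto.pow htr)
        (Or.inr (by finiteness))) (ENNReal.Tendsto.const_mul
          (tendsto_finsetSum _ fun i _ => ENNReal.Tendsto.pow (tendsto_L2Norm (collar_subset _ _)
            (h.memLp_grad i) (fun n => ((hφ n).partialDeriv i).memLp 2 _) (hl.2 i)))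
          (Or.inr (by finiteness)))
    have := le_of_tendsto_of_tendsto' l1 l2 fun n => by
      rw [← hsurf n]
      simp only [L2Norm_sq]
      exact hcol ε hε (φ n) (hφ n)
    simpa [G] using this
  have hScol : ∀ ε : ℝ≥0, S ε ⊆ collar ω (2 * K * ε) := by
    intro ε x hx
    refine ⟨hx.1, hx.2.le.trans ?_⟩
    have : (1 : ℝ) ≤ K := by exact_mod_cast hK1
    nlinarith [ε.2]
  -- the cutoff error
  have herr : ∀ ε : ℝ≥0, 0 < ε → ε ≤ 1 → 2 * ε < ε₀ → ∃ η : E3 → ℝ,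
      ContDiff ℝ ((⊤ : ℕ∞) : WithTop ℕ∞) η ∧ (∃ c : ℝ≥0, (∀ x, |η x| ≤ c) ∧
        ∀ i x, |partialDeriv i η x| ≤ c) ∧
      (∀ x, Metric.infDist (crossSection x) ωᶜ ≤ ε / 8 → η x = 0) ∧
      L2Norm (waveguide ω) (fun x => v x - η x * v x) ^ 2 ≤ 4 * N * G (2 * K * ε) ∧
      ∀ i, L2Norm (waveguide ω) (fun x => p i x - (η x * p i x + partialDeriv i η x * v x)) ^ 2 ≤
        (2 + 8 * N * C ^ 2) * G (2 * K * ε) := by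
    intro ε hε hε1 hε2
    obtain ⟨η, hηs, hη1, hη1', hηd, hη, hη0⟩ := hcut ε hε
    have hS2 : L2Norm (S (2 * ε)) v ^ 2 ≤ N * (2 * ε) ^ 2 * G (2 * K * ε) := by
      have := hv (2 * ε) (by push_cast; exact hε2)
      rwa [show K * (2 * ε) = 2 * K * ε by ring, ENNReal.coe_mul, ENNReal.coe_ofNat] at this
    have hSS : S ε ⊆ S (2 * ε) := fun x hx => ⟨hx.1, hx.2.trans_le (by
      push_cast; linarith [ε.2])⟩
    refine ⟨η, hηs, ⟨max 1 (C / ε), fun x => (hη1 x).trans ?_, fun i x => (hηd i x).trans ?_⟩, hη0,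
      ?_, fun i => ?_⟩
    · exact_mod_cast le_max_left _ _
    · exact_mod_cast le_max_right 1 (C / ε)
    · have h1 : L2Norm (waveguide ω) (fun x => v x - η x * v x) ≤ (1 : ℝ≥0) * L2Norm (S (2 * ε)) v := by
        refine L2Norm_le_of_support hΩ.measurableSet (hSm _) (fun x _ _ => ?_) fun x hx hxS => ?_
        · rw [← one_sub_mul, abs_mul]
          gcongr
          exact hη1' x
        · have : η x = 1 := hη x (not_lt.1 fun hlt => hxS (hSS ⟨mem_waveguide.1 hx, hlt⟩))
          rw [this]; ring
      calc _ ≤ ((1 : ℝ≥0) * L2Norm (S (2 * ε)) v) ^ 2 := by gcongr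
        _ = L2Norm (S (2 * ε)) v ^ 2 := by simp
        _ ≤ N * (2 * ε) ^ 2 * G (2 * K * ε) := hS2
        _ ≤ N * (2 * 1) ^ 2 * G (2 * K * ε) := by gcongr; exact_mod_cast hε1
        _ = _ := by ring
    · have h1 : L2Norm (waveguide ω) (fun x => (1 - η x) * p i x) ≤
          (1 : ℝ≥0) * L2Norm (S ε) (p i) := by
        refine L2Norm_le_of_support hΩ.measurableSet (hSm _) (fun x _ _ => ?_) fun x hx hxS => ?_
        · rw [abs_mul]
          gcongr
          exact hη1' x
        · have : η x = 1 := hη x (not_lt.1 fun hlt => hxS ⟨mem_waveguide.1 hx, hlt⟩)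
          rw [this]; ring
      have h2 : L2Norm (waveguide ω) (fun x => partialDeriv i η x * v x) ≤
          (C / ε : ℝ≥0) * L2Norm (S (2 * ε)) v := by
        refine L2Norm_le_of_support hΩ.measurableSet (hSm _) (fun x _ _ => ?_) fun x hx hxS => ?_
        · rw [abs_mul]
          gcongr
          exact_mod_cast hηd i x
        -- Doubling the width ensures that off `S (2 * ε)` the cutoff equals `1` on a whole
        -- neighbourhood, so its derivative vanishes there.
        · have hge : (2 * ε : ℝ) ≤ Metric.infDist (crossSection x) ωᶜ :=
            not_lt.1 fun hlt => hxS ⟨mem_waveguide.1 hx, by push_cast; exact hlt⟩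
          have hev : η =ᶠ[𝓝 x] fun _ => 1 := by
            have ho : IsOpen {x : E3 | (ε : ℝ) < Metric.infDist (crossSection x) ωᶜ} :=
              isOpen_lt continuous_const
                ((Metric.continuous_infDist_pt _).comp continuous_crossSection)
            have hε' : (0 : ℝ) < ε := hε
            filter_upwards [ho.mem_nhds (show (ε : ℝ) < Metric.infDist (crossSection x) ωᶜ by
              linarith)] with y hy using hη y hy.le
          have : partialDeriv i η x = 0 := by
            rw [partialDeriv, hev.fderiv_eq]; simp
          rw [this, zero_mul]
      have h3 : L2Norm (waveguide ω)
          (fun x => p i x - (η x * p i x + partialDeriv i η x * v x)) ≤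
          L2Norm (waveguide ω) (fun x => (1 - η x) * p i x) +
            L2Norm (waveguide ω) (fun x => partialDeriv i η x * v x) := by
        refine le_trans (le_of_eq ?_) (L2Norm_sub_le ?_ ?_)
        · congr 1; ext x; ring
        · exact (continuous_const.sub hηs.continuous).aestronglyMeasurable.mul (h.memLp_grad i).1
        · exact (contDiff_partialDeriv_continuous hηs i).aestronglyMeasurable.mul h.memLp.1
      have h4 : L2Norm (S ε) (p i) ^ 2 ≤ G (2 * K * ε) := by
        calc _ ≤ L2Norm (collar ω (2 * K * ε)) (p i) ^ 2 := by
              gcongr; exact L2Norm_mono_set (hScol ε) _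
          _ ≤ G (2 * K * ε) := by
              have := Finset.single_le_sum
                (f := fun i => L2Norm (collar ω ((2 * K * ε : ℝ≥0) : ℝ)) (p i) ^ 2)
                (fun _ _ => zero_le) (Finset.mem_univ i)
              simpa [G] using this
      calc _ ≤ ((1 : ℝ≥0) * L2Norm (S ε) (p i) + (C / ε : ℝ≥0) * L2Norm (S (2 * ε)) v) ^ 2 := by
            gcongr
            exact h3.trans (add_le_add h1 h2)
        _ ≤ 2 * (((1 : ℝ≥0) * L2Norm (S ε) (p i)) ^ 2 +
            ((C / ε : ℝ≥0) * L2Norm (S (2 * ε)) v) ^ 2) := by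
          have := ENNReal.rpow_add_le_mul_rpow_add_rpow ((1 : ℝ≥0) * L2Norm (S ε) (p i))
            ((C / ε : ℝ≥0) * L2Norm (S (2 * ε)) v) (p := 2) (by norm_num)
          norm_num at this ⊢
          exact_mod_cast this
        _ ≤ 2 * (G (2 * K * ε) + (C / ε : ℝ≥0) ^ 2 * (N * (2 * ε) ^ 2 * G (2 * K * ε))) := by
          rw [mul_pow, mul_pow]
          gcongr
          simpa using h4
        _ = _ := by
          have : ((C / ε : ℝ≥0) : ℝ≥0∞) ^ 2 * (N * (2 * ε) ^ 2) = 4 * N * C ^ 2 := by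
            have : (C / ε) ^ 2 * (N * (2 * ε) ^ 2) = 4 * N * C ^ 2 := by
              field_simp; ring
            exact_mod_cast this
          rw [← mul_assoc, this]; ring
  -- choice of the parameters
  refine h.hasGrad0_of_forall fun κ hκ => ?_
  -- `D` dominates both constants in `herr`. The collar energy tends to zero, so a small `ε` brings
  -- the cutoff error below `κ / 2`; with `η` then fixed, a late `φ m` costs the other `κ / 2`.
  set D : ℝ≥0 := 4 * N + (2 + 8 * N * C ^ 2) with hD
  have hGlim : Tendsto (fun n : ℕ => D * G (2 * K * ((n : ℝ≥0) + 1)⁻¹)) atTop (𝓝 0) := by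
    have h0 : Tendsto (fun n : ℕ => ((2 * K * ((n : ℝ≥0) + 1)⁻¹ : ℝ≥0) : ℝ)) atTop (𝓝 0) := by
      have := (tendsto_one_div_add_atTop_nhds_zero_nat (𝕜 := ℝ)).const_mul (2 * (K : ℝ))
      simpa using this
    have h1 := tendsto_finsetSum Finset.univ fun i (_ : i ∈ Finset.univ) =>
      tendsto_L2Norm_collar hω hb (h.memLp_grad i) h0
    have h2 := ENNReal.Tendsto.const_mul (a := (D : ℝ≥0∞)) h1 (Or.inr (by simp))
    simpa [G] using h2
  obtain ⟨n, hn1, hn2⟩ : ∃ n : ℕ, D * G (2 * K * ((n : ℝ≥0) + 1)⁻¹) < (κ / 2) ^ 2 ∧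
      2 * (((n : ℝ≥0) + 1)⁻¹ : ℝ≥0) < ε₀ := by
    have e1 := hGlim.eventually (gt_mem_nhds (show (0 : ℝ≥0∞) < (κ / 2) ^ 2 from
      ENNReal.pow_pos (ENNReal.half_pos hκ.ne') 2))
    have e2 : ∀ᶠ n : ℕ in atTop, (2 * (((n : ℝ≥0) + 1)⁻¹ : ℝ≥0) : ℝ) < ε₀ := by
      have := (tendsto_one_div_add_atTop_nhds_zero_nat (𝕜 := ℝ)).const_mul 2
      rw [mul_zero] at this
      filter_upwards [this.eventually (gt_mem_nhds hε₀)] with n hn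
      simpa using hn
    exact (e1.and e2).exists
  set ε : ℝ≥0 := ((n : ℝ≥0) + 1)⁻¹ with hεdef
  have hεpos : 0 < ε := by positivity
  obtain ⟨η, hηs, ⟨c, hc, hc'⟩, hη0, hE0, hE1⟩ := herr ε hεpos
    (inv_le_one_of_one_le₀ (by simp)) hn2
  have hbig : ∀ {a : ℝ≥0∞}, a ^ 2 ≤ D * G (2 * K * ε) → a ≤ κ / 2 := by
    intro a ha
    exact (ENNReal.pow_le_pow_left_iff two_ne_zero).1 (ha.trans hn1.le)
  have hE0' : L2Norm (waveguide ω) (fun x => v x - η x * v x) ≤ κ / 2 := by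
    refine hbig (hE0.trans ?_)
    gcongr
    rw [hD]; push_cast
    exact le_self_add
  have hE1' : ∀ i, L2Norm (waveguide ω)
      (fun x => p i x - (η x * p i x + partialDeriv i η x * v x)) ≤ κ / 2 := by
    intro i
    refine hbig ((hE1 i).trans ?_)
    gcongr
    rw [hD]; push_cast
    exact le_add_self
  have hlη := H1Tendsto.mul_smooth hΩ.measurableSet subset_rfl hφ h hl hηs hc hc'
  have hgη := h.mul_smooth hΩ hηs hc hc'
  have hκ2 : (0 : ℝ≥0∞) < κ / 2 := ENNReal.half_pos hκ.ne'
  obtain ⟨m, hm0, hm1⟩ := ((hlη.1.eventually (gt_mem_nhds hκ2)).and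
    (eventually_all.2 fun i => (hlη.2 i).eventually (gt_mem_nhds hκ2))).exists
  -- The support stays at distance at least `ε / 8` from the complement, hence inside the waveguide.
  have hsupp : tsupport (fun x => η x * φ m x) ⊆ waveguide ω := by
    have hcl : IsClosed {x : E3 | (ε : ℝ) / 8 ≤ Metric.infDist (crossSection x) ωᶜ} :=
      isClosed_le continuous_const ((Metric.continuous_infDist_pt _).comp continuous_crossSection)
    have h1 : tsupport (fun x => η x * φ m x) ⊆
        {x : E3 | (ε : ℝ) / 8 ≤ Metric.infDist (crossSection x) ωᶜ} := by
      refine closure_minimal (fun x hx => ?_) hcl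
      by_contra hlt
      exact hx (by simp [hη0 x (not_le.1 hlt).le])
    intro x hx
    have h2 : (ε : ℝ) / 8 ≤ Metric.infDist (crossSection x) ωᶜ := h1 hx
    rw [mem_waveguide]
    by_contra hxω
    rw [Metric.infDist_zero_of_mem (show crossSection x ∈ ωᶜ from hxω)] at h2
    have : (0 : ℝ) < ε := hεpos
    linarith
  have htest : IsTest (waveguide ω) (fun x => η x * φ m x) := ⟨(hφ m).mul_left hηs, hsupp⟩
  refine ⟨_, htest, ?_, fun i => ?_⟩
  · calc L2Norm (waveguide ω) (fun x => v x - η x * φ m x) =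
          L2Norm (waveguide ω) (fun x => (v x - η x * v x) + (η x * v x - η x * φ m x)) := by
          congr 1; ext x; ring
      _ ≤ _ := L2Norm_add_le (h.memLp.sub hgη.memLp).1 (hgη.memLp.sub (htest.1.memLp 2 _)).1
      _ ≤ κ / 2 + κ / 2 := add_le_add hE0' hm0.le
      _ = κ := ENNReal.add_halves κ
  · calc L2Norm (waveguide ω) (fun x => p i x - partialDeriv i (fun x => η x * φ m x) x) =
          L2Norm (waveguide ω) (fun x => (p i x - (η x * p i x + partialDeriv i η x * v x)) +
            ((η x * p i x + partialDeriv i η x * v x) -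
              partialDeriv i (fun x => η x * φ m x) x)) := by
          congr 1; ext x; ring
      _ ≤ _ := L2Norm_add_le ((h.memLp_grad i).sub (hgη.memLp_grad i)).1
        ((hgη.memLp_grad i).sub ((htest.1.partialDeriv i).memLp 2 _)).1
      _ ≤ κ / 2 + κ / 2 := add_le_add (hE1' i) (hm1 i).le
      _ = κ := ENNReal.add_halves κ


/-! ### Local regularity -/

lemma isOpen_cylinder {ω : Set E2} (hω : IsOpen ω) {I : Set ℝ} (hI : IsOpen I) :
    IsOpen (cylinder ω I) := by
  have h3 : Continuous fun x : E3 => x 2 := (EuclideanSpace.proj 2 : E3 →L[ℝ] ℝ).continuous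
  exact (hω.preimage continuous_crossSection).inter (hI.preimage h3)

lemma cylinder_subset_waveguide (ω : Set E2) (I : Set ℝ) : cylinder ω I ⊆ waveguide ω :=
  fun _ hx => ⟨hx.1, mem_univ _⟩

lemma setIntegral_mul_test_eq {U : Set E3} {φ : E3 → ℝ} (hφ : IsTest U φ) (f : E3 → ℝ) :
    ∫ x in U, f x * φ x = ∫ x, f x * φ x := by
  rw [setIntegral_eq_integral_of_forall_compl_eq_zero]
  intro x hx
  rw [image_eq_zero_of_notMem_tsupport fun h => hx (hφ.2 h), mul_zero]

lemma setIntegral_mul_test_of_subset {U V : Set E3} {φ : E3 → ℝ} (hφ : IsTest V φ) (h : V ⊆ U)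
    (f : E3 → ℝ) : ∫ x in V, f x * φ x = ∫ x in U, f x * φ x := by
  rw [setIntegral_mul_test_eq hφ, setIntegral_mul_test_eq (hφ.mono h)]

/-- A smooth cutoff function of the variable `x₃`. -/
lemma exists_slab_cutoff : ∃ (θ : E3 → ℝ) (c : ℝ≥0), ContDiff ℝ ((⊤ : ℕ∞) : WithTop ℕ∞) θ ∧
    (∀ x, |θ x| ≤ c) ∧ (∀ i, BLip univ c (partialDeriv i θ)) ∧
    (∀ x : E3, |x 2| ≤ 3 / 4 → θ x = 1) ∧
    (∀ i, ∀ x : E3, |x 2| < 3 / 4 → partialDeriv i θ x = 0) ∧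
    ∀ x : E3, 7 / 8 ≤ |x 2| → θ x = 0 := by
  let χ : ContDiffBump (0 : ℝ) := ⟨3 / 4, 7 / 8, by norm_num, by norm_num⟩
  have hχs : ContDiff ℝ ((⊤ : ℕ∞) : WithTop ℕ∞) χ := χ.contDiff
  have hds : ContDiff ℝ ((⊤ : ℕ∞) : WithTop ℕ∞) (deriv χ) :=
    (contDiff_infty_iff_deriv.1 hχs).2
  have hdc : HasCompactSupport (deriv χ) := χ.hasCompactSupport.deriv
  obtain ⟨C, hC⟩ : ∃ C, LipschitzWith C (deriv χ) :=
    ContDiff.lipschitzWith_of_hasCompactSupport hdc hds (by simp)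
  obtain ⟨B, hB⟩ := hdc.exists_bound_of_continuous hds.continuous
  let π : E3 →L[ℝ] ℝ := EuclideanSpace.proj 2
  have hsm : ContDiff ℝ ((⊤ : ℕ∞) : WithTop ℕ∞) (fun x : E3 => χ (π x)) := hχs.comp π.contDiff
  have hpd : ∀ i x, partialDeriv i (fun x : E3 => χ (π x)) x =
      π (EuclideanSpace.single i 1) * deriv χ (π x) := by
    intro i x
    have h1 : HasDerivAt χ (deriv χ (π x)) (π x) :=
      (hχs.differentiable (by simp) _).hasDerivAt
    have h2 := h1.comp_hasFDerivAt x π.hasFDerivAt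
    rw [partialDeriv]
    erw [h2.fderiv]
    simp [mul_comm]
  have hπ1 : ∀ i, |π (EuclideanSpace.single i 1)| ≤ 1 := by
    intro i
    fin_cases i <;> simp [π]
  have hπl : ∀ x y, |π x - π y| ≤ dist x y := by
    intro x y
    rw [dist_eq_norm]
    exact PiLp.norm_apply_le (x - y) 2
  refine ⟨fun x => χ (π x), max 1 (max C B.toNNReal), hsm, fun x => ?_, fun i => ⟨fun x _ => ?_, ?_⟩,
    fun x hx => ?_, fun i x hx => ?_, fun x hx => ?_⟩
  · rw [abs_of_nonneg χ.nonneg]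
    exact χ.le_one.trans (by exact_mod_cast le_max_left _ _)
  · rw [hpd, abs_mul]
    have h1 : |deriv χ (π x)| ≤ B.toNNReal := (hB _).trans (Real.le_coe_toNNReal B)
    have h2 : (B.toNNReal : ℝ) ≤ (max 1 (max C B.toNNReal) : ℝ≥0) := by
      exact_mod_cast (le_max_right _ _).trans (le_max_right _ _)
    calc _ ≤ 1 * |deriv χ (π x)| := by gcongr; exact hπ1 i
      _ ≤ _ := by rw [one_mul]; exact h1.trans h2
  · refine LipschitzOnWith.of_dist_le_mul fun x _ y _ => ?_
    rw [hpd, hpd, Real.dist_eq, ← mul_sub, abs_mul]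
    have h1 := hC.dist_le_mul (π x) (π y)
    rw [Real.dist_eq, Real.dist_eq] at h1
    have h2 : (C : ℝ) ≤ (max 1 (max C B.toNNReal) : ℝ≥0) := by
      exact_mod_cast (le_max_left C _).trans (le_max_right _ _)
    calc _ ≤ 1 * (C * |π x - π y|) := by gcongr; exact hπ1 i
      _ ≤ _ := by rw [one_mul]; gcongr; exact hπl x y
  · refine χ.one_of_mem_closedBall ?_
    rw [mem_closedBall_zero_iff]
    exact hx
  · have hev : (fun x : E3 => χ (π x)) =ᶠ[𝓝 x] fun _ => 1 := by
      have ho : IsOpen {x : E3 | |π x| < 3 / 4} :=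
        isOpen_lt (continuous_abs.comp π.continuous) continuous_const
      filter_upwards [ho.mem_nhds hx] with y hy
      refine χ.one_of_mem_closedBall ?_
      rw [mem_closedBall_zero_iff]
      exact le_of_lt hy
    rw [partialDeriv, hev.fderiv_eq]; simp
  · refine χ.zero_of_le_dist ?_
    rw [dist_zero_right]
    exact hx

lemma MemH2.hasGrad {U : Set E3} (hU : IsOpen U) {w : E3 → ℝ} (h : MemH2 U w) :
    HasGrad U w (fun i => weakPartial U i w) :=
  h.1.hasGrad hU

lemma H2Norm_sq (U : Set E3) (u : E3 → ℝ) : H2Norm U u ^ 2 =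
    L2Norm U u ^ 2 + ∑ i, L2Norm U (weakPartial U i u) ^ 2 +
      ∑ i, ∑ j, L2Norm U (weakPartial U j (weakPartial U i u)) ^ 2 := by
  rw [H2Norm, ← ENNReal.rpow_natCast, ← ENNReal.rpow_mul]
  simp

lemma L2Norm_sum_le {ι : Type*} {U : Set E3} (s : Finset ι) {f : ι → E3 → ℝ}
    (hf : ∀ i ∈ s, AEStronglyMeasurable (f i) (volume.restrict U)) :
    L2Norm U (fun x => ∑ i ∈ s, f i x) ≤ ∑ i ∈ s, L2Norm U (f i) := by
  have := eLpNorm_sum_le (p := 2) hf (by norm_num)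
  refine le_trans (le_of_eq ?_) this
  rw [L2Norm]
  congr 1
  ext x
  simp

lemma ENNReal_sum_sq_le (a b : ℝ≥0∞) (f : Fin 3 → ℝ≥0∞) :
    (a + b + ∑ i, f i) ^ 2 ≤ 5 * (a ^ 2 + b ^ 2 + ∑ i, f i ^ 2) := by
  have := ENNReal.rpow_sum_le_const_mul_sum_rpow (Finset.univ : Finset (Fin 5))
    ![a, b, f 0, f 1, f 2] (p := 2) (by norm_num)
  simp only [Fin.sum_univ_five, Finset.card_univ, Fintype.card_fin] at this
  norm_num at this
  change (a + b + f 0 + f 1 + f 2) ^ 2 ≤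
    5 * (a ^ 2 + b ^ 2 + f 0 ^ 2 + f 1 ^ 2 + f 2 ^ 2) at this
  simp only [Fin.sum_univ_three, ← add_assoc]
  exact this

/-! ### Cutoff in the variable x₃ and H² regularity in one slab. -/

section Localization

variable {ω : Set E2} {a : ℝ} {c : ℝ≥0}

/-- The equation satisfied by the product of a solution with a cutoff function. -/
lemma exists_localized_weakEq {U V : Set E3} (hU : IsOpen U) (hV : IsOpen V) (hVU : V ⊆ U)
    {A : E3 → Matrix (Fin 3) (Fin 3) ℝ} (hA : Admissible U a c A) {v F : E3 → ℝ}
    {p : Fin 3 → E3 → ℝ} (hv : HasGrad U v p) (hF : MemLp F 2 (volume.restrict U))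
    (heq : WeakEq U A p F) {θ : E3 → ℝ} {cθ : ℝ≥0}
    (hθ : ContDiff ℝ ((⊤ : ℕ∞) : WithTop ℕ∞) θ) (hc : ∀ x, |θ x| ≤ cθ)
    (hc' : ∀ i, BLip univ cθ (partialDeriv i θ)) :
    ∃ F' : E3 → ℝ, MemLp F' 2 (volume.restrict U) ∧
      WeakEq V A (fun i x => θ x * p i x + partialDeriv i θ x * v x) F' ∧
      L2Norm V F' ≤ (cθ + 36 * c * cθ : ℝ≥0) *
        (L2Norm V F + L2Norm V v + ∑ i, L2Norm V (p i)) := by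
  -- With `b = A ∇θ`, symmetry of `A` gives `div (A ∇(θ v)) = θ F + 2 b · ∇v + (div b) v`. As `b` is
  -- Lipschitz, `div b` is bounded and no second derivative of `v` appears.
  let b : Fin 3 → E3 → ℝ := flux A (fun j => partialDeriv j θ)
  set cb : ℝ≥0 := 3 * (2 * c * cθ) with hcb
  have hb : ∀ i, BLip U cb (b i) := fun i => by
    have := BLip.sum (U := U) (Finset.univ : Finset (Fin 3)) (c := 2 * c * cθ)
      (f := fun j x => A x i j * partialDeriv j θ x)
      fun j _ => (hA.blip i j).mul ((hc' j).mono_set (subset_univ _))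
    change BLip U cb (fun x => ∑ j, A x i j * partialDeriv j θ x)
    simpa [hcb] using this
  choose b' hb'm hb'b hb' using fun i => (hb i).exists_hasWeakPartial_mul hU i
  have mθF : MemLp (fun x => θ x * F x) 2 (volume.restrict U) :=
    MemLp.of_le_mul (c := cθ) hF (hθ.continuous.aestronglyMeasurable.mul hF.1)
      (Eventually.of_forall fun x => by rw [norm_mul]; gcongr; exact hc x)
  have mbp : ∀ i, MemLp (fun x => b i x * p i x) 2 (volume.restrict U) :=
    fun i => (hb i).memLp_mul hU.measurableSet (hv.memLp_grad i)
  have mbv : ∀ i, MemLp (fun x => b' i x * v x) 2 (volume.restrict U) := fun i =>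
    MemLp.of_le_mul (c := cb) hv.memLp ((hb'm i).aestronglyMeasurable.mul hv.memLp.1)
      (Eventually.of_forall fun x => by rw [norm_mul]; gcongr; exact hb'b i x)
  have mS : MemLp (fun x => ∑ i, (2 * (b i x * p i x) + b' i x * v x)) 2 (volume.restrict U) :=
    memLp_finsetSum _ fun i _ => ((mbp i).const_mul 2).add (mbv i)
  refine ⟨fun x => θ x * F x + ∑ i, (2 * (b i x * p i x) + b' i x * v x), mθF.add mS, ?_, ?_⟩
  · intro φ hφ
    have hφU := hφ.mono hVU
    have hθφ : IsTest U (fun x => θ x * φ x) := hφU.mul_left hθ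
    have mφ := hφ.1.memLp 2 (volume.restrict U)
    have mdφ := fun i => (hφ.partialDeriv i).1.memLp 2 (volume.restrict U)
    have mfl := hA.memLp_flux hU hv.memLp_grad
    have mdθφ : ∀ i, MemLp (partialDeriv i (fun x => θ x * φ x)) 2 (volume.restrict U) :=
      fun i => (hθφ.partialDeriv i).1.memLp 2 _
    have mθd : ∀ i, MemLp (fun x => partialDeriv i θ x * φ x) 2 (volume.restrict U) := fun i =>
      ((hφ.mul_left (contDiff_partialDeriv hθ i)).1.memLp 2 _)
    have mbv0 : ∀ i, MemLp (fun x => b i x * v x) 2 (volume.restrict U) :=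
      fun i => (hb i).memLp_mul hU.measurableSet hv.memLp
    simp only [fun i => setIntegral_mul_test_of_subset (hφ.partialDeriv i) hVU,
      setIntegral_mul_test_of_subset hφ hVU]
    have e1 : ∀ i, ∫ x in U, flux A (fun i x => θ x * p i x + partialDeriv i θ x * v x) i x *
        partialDeriv i φ x = (∫ x in U, flux A p i x * partialDeriv i (fun x => θ x * φ x) x) -
          (∫ x in U, flux A p i x * (partialDeriv i θ x * φ x)) +
            ∫ x in U, b i x * v x * partialDeriv i φ x := by
      intro i
      have i1 : Integrable (fun x => flux A p i x * partialDeriv i (fun x => θ x * φ x) x -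
          flux A p i x * (partialDeriv i θ x * φ x)) (volume.restrict U) :=
        ((mfl i).integrable_mul_two (mdθφ i)).sub ((mfl i).integrable_mul_two (mθd i))
      rw [← integral_sub ((mfl i).integrable_mul_two (mdθφ i))
        ((mfl i).integrable_mul_two (mθd i)), ← integral_add i1
        ((mbv0 i).integrable_mul_two (mdφ i))]
      congr 1
      ext x
      rw [partialDeriv_mul i (hθ.differentiable (by simp) x) (hφ.1.differentiable x)]
      simp only [flux, b, Fin.sum_univ_three]
      ring
    have e2 : ∀ i, ∫ x in U, b i x * v x * partialDeriv i φ x =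
        - ∫ x in U, (b i x * p i x + b' i x * v x) * φ x :=
      fun i => (hb' i v (p i) (hv.weak i)).2.2 φ hφU
    -- The symmetry of `A` is used here: `A p · ∇θ = A ∇θ · p`.
    have e3 : ∑ i, ∫ x in U, flux A p i x * (partialDeriv i θ x * φ x) =
        ∑ i, ∫ x in U, b i x * p i x * φ x := by
      rw [← integral_finsetSum _ fun i _ => (mfl i).integrable_mul_two (mθd i),
        ← integral_finsetSum _ fun i _ => (mbp i).integrable_mul_two mφ]
      refine setIntegral_congr_fun hU.measurableSet fun x hx => ?_
      have hs : ∀ i j, A x i j = A x j i := fun i j => (hA.symm x hx).apply j i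
      simp only [flux, b, Fin.sum_univ_three]
      rw [hs 1 0, hs 2 0, hs 2 1]
      ring
    have e4 : ∫ x in U, (θ x * F x + ∑ i, (2 * (b i x * p i x) + b' i x * v x)) * φ x =
        (∫ x in U, F x * (θ x * φ x)) + ∑ i, ((∫ x in U, b i x * p i x * φ x) +
          ∫ x in U, (b i x * p i x + b' i x * v x) * φ x) := by
      have i1 := fun i => (mbp i).integrable_mul_two mφ
      have i2 : ∀ i, Integrable (fun x => (b i x * p i x + b' i x * v x) * φ x)
          (volume.restrict U) := fun i => ((mbp i).add (mbv i)).integrable_mul_two mφ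
      have i12 : ∀ i, Integrable (fun x => b i x * p i x * φ x +
          (b i x * p i x + b' i x * v x) * φ x) (volume.restrict U) := fun i => (i1 i).add (i2 i)
      have i3 : Integrable (fun x => F x * (θ x * φ x)) (volume.restrict U) :=
        hF.integrable_mul_two (hθφ.1.memLp 2 _)
      simp_rw [fun i => (integral_add (i1 i) (i2 i)).symm]
      rw [← integral_finsetSum _ fun i _ => i12 i,
        ← integral_add i3 (integrable_finsetSum _ fun i _ => i12 i)]
      congr 1
      ext x
      simp only [Fin.sum_univ_three]
      ring
    rw [e4, Finset.sum_congr rfl fun i _ => (e1 i).trans (by rw [e2 i])]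
    rw [Finset.sum_add_distrib, Finset.sum_sub_distrib, e3, heq _ hθφ, Finset.sum_neg_distrib,
      Finset.sum_add_distrib]
    ring
  · have hm := Measure.restrict_mono (μ := (volume : Measure E3)) hVU le_rfl
    have hV' := hV.measurableSet
    have n1 : L2Norm V (fun x => θ x * F x) ≤ cθ * L2Norm V F :=
      L2Norm_mul_le hV' fun x _ => hc x
    have n2 : ∀ i, L2Norm V (fun x => 2 * (b i x * p i x) + b' i x * v x) ≤
        2 * (cb * L2Norm V (p i)) + cb * L2Norm V v := by
      intro i
      refine (L2Norm_add_le (((mbp i).const_mul 2).1.mono_measure hm)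
        ((mbv i).1.mono_measure hm)).trans (add_le_add ?_ ?_)
      · refine (L2Norm_mul_le (f := fun _ => 2) (c := 2) hV' fun x _ => by simp).trans ?_
        gcongr
        · simp
        · exact ((hb i).mono_set hVU).L2Norm_mul_le hV'
      · exact L2Norm_mul_le hV' fun x _ => hb'b i x
    calc _ ≤ L2Norm V (fun x => θ x * F x) +
          ∑ i, L2Norm V (fun x => 2 * (b i x * p i x) + b' i x * v x) := by
          refine (L2Norm_add_le (mθF.1.mono_measure hm) (mS.1.mono_measure hm)).trans ?_
          gcongr
          exact L2Norm_sum_le _ fun i _ => (((mbp i).const_mul 2).add (mbv i)).1.mono_measure hm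
      _ ≤ cθ * L2Norm V F + ∑ i, (2 * (cb * L2Norm V (p i)) + cb * L2Norm V v) := by
          gcongr with i
          exact n2 i
      _ = cθ * L2Norm V F + 3 * cb * L2Norm V v + 2 * cb * ∑ i, L2Norm V (p i) := by
          simp only [Fin.sum_univ_three]; ring
      _ ≤ (cθ + 36 * c * cθ : ℝ≥0) * L2Norm V F + (cθ + 36 * c * cθ : ℝ≥0) * L2Norm V v +
          (cθ + 36 * c * cθ : ℝ≥0) * ∑ i, L2Norm V (p i) := by
          have h1 : (cθ : ℝ≥0∞) ≤ (cθ + 36 * c * cθ : ℝ≥0) := by exact_mod_cast le_self_add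
          have h2 : 3 * cb ≤ cθ + 36 * c * cθ := by
            refine le_add_of_nonneg_of_le zero_le ?_
            rw [hcb, ← NNReal.coe_le_coe]; push_cast
            nlinarith [mul_nonneg c.2 cθ.2]
          have h3 : 2 * cb ≤ cθ + 36 * c * cθ :=
            le_trans (by gcongr; norm_num) h2
          have h2' : 3 * (cb : ℝ≥0∞) ≤ (cθ + 36 * c * cθ : ℝ≥0) := by exact_mod_cast h2
          have h3' : 2 * (cb : ℝ≥0∞) ≤ (cθ + 36 * c * cθ : ℝ≥0) := by exact_mod_cast h3
          gcongr
      _ = _ := by ring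

/-- Interior (in the variable `x₃`) `H²` regularity of weak solutions. -/
lemma HasH2Regularity.exists_local (hω : IsOpen ω) {R : ℝ≥0} (hR0 : 0 < R)
    (hR : ∀ x ∈ waveguide ω, |x 0| ≤ R) (hreg : HasH2Regularity (cylinder ω (Ioo (-1) 1)))
    (ha : 0 < a) (c : ℝ≥0) : ∃ C : ℝ≥0, ∀ A, Admissible (waveguide ω) a c A → ∀ v p F,
      HasGrad0 (waveguide ω) v p → MemLp F 2 (volume.restrict (waveguide ω)) →
      WeakEq (waveguide ω) A p F → ∀ i j, ∃ D : E3 → ℝ,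
        MemLp D 2 (volume.restrict (cylinder ω (Ioo (-1) 1))) ∧
        L2Norm (cylinder ω (Ioo (-1) 1)) D ^ 2 ≤
          C * (L2Norm (cylinder ω (Ioo (-1) 1)) F ^ 2 + L2Norm (cylinder ω (Ioo (-1) 1)) v ^ 2 +
            ∑ i, L2Norm (cylinder ω (Ioo (-1) 1)) (p i) ^ 2) ∧
        ∀ φ, IsTest (cylinder ω (Ioo (-(3 / 4)) (3 / 4))) φ →
          ∫ x in waveguide ω, p i x * partialDeriv j φ x =
            - ∫ x in cylinder ω (Ioo (-1) 1), D x * φ x := by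
  obtain ⟨θ, cθ, hθ, hc, hc', hθ1, hθd, hθ0⟩ := exists_slab_cutoff
  -- The bound `4 * c` is the `W^{1,∞}` bound of `BLip.memW1_top`.
  obtain ⟨K, hK⟩ := hreg a (4 * c) ha
  set U := cylinder ω (Ioo (-1) 1) with hUdef
  have hU : IsOpen U := isOpen_cylinder hω isOpen_Ioo
  have hΩ := isOpen_waveguide hω
  have hUΩ : U ⊆ waveguide ω := cylinder_subset_waveguide _ _
  refine ⟨(K * (cθ + 36 * c * cθ)) ^ 2 * 5, fun A hA v p F hv hF heq i j => ?_⟩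
  obtain ⟨F', hF', heq', hF'n⟩ := exists_localized_weakEq hΩ hU hUΩ hA hv.toHasGrad hF heq hθ hc hc'
  have hF'U : MemLp F' 2 (volume.restrict U) :=
    hF'.mono_measure (Measure.restrict_mono hUΩ le_rfl)
  have hAU := hA.mono hUΩ
  obtain ⟨w, ⟨hw2, hw0, hweq⟩, -, hwn⟩ := hK A (fun x hx => ⟨hAU.symm x hx, hAU.coercive x hx⟩)
    (fun i j => by simpa using (hAU.blip i j).memW1_top hU) F' hF'U
  have hwg := hw2.hasGrad hU
  have hwg0 := hw0.hasGrad0 hU hwg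
  set q : Fin 3 → E3 → ℝ := fun i x => θ x * p i x + partialDeriv i θ x * v x with hq
  have hc'' : ∀ i x, |partialDeriv i θ x| ≤ cθ := fun i x => (hc' i).1 x (mem_univ _)
  -- Multiplying the approximating test functions of `v` by `θ` confines their supports to `|x₃| ≤
  -- 7/8`, so `θ v` vanishes at the ends of the slab as well.
  have hθv : HasGrad0 U (fun x => θ x * v x) q := by
    refine ⟨(hv.toHasGrad.mul_smooth hΩ hθ hc hc'').mono hUΩ, ?_⟩
    obtain ⟨φ, hφ, hl⟩ := hv.exists_seq
    refine ⟨fun n x => θ x * φ n x, fun n => ⟨(hφ n).1.mul_left hθ, fun x hx => ?_⟩,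
      H1Tendsto.mul_smooth hU.measurableSet hUΩ (fun n => (hφ n).1) hv.toHasGrad hl hθ hc hc''⟩
    have h1 : x ∈ waveguide ω := (hφ n).2 (tsupport_mul_subset_right hx)
    have h2 : x ∈ tsupport θ := tsupport_mul_subset_left hx
    have h3 : |x 2| ≤ 7 / 8 := by
      have hcl : IsClosed {x : E3 | |x 2| ≤ 7 / 8} :=
        isClosed_le (continuous_abs.comp (EuclideanSpace.proj 2 : E3 →L[ℝ] ℝ).continuous)
          continuous_const
      refine closure_minimal (fun y hy => ?_) hcl h2
      by_contra hlt
      exact hy (hθ0 y (not_le.1 hlt).le)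
    have h4 := abs_le.1 h3
    exact ⟨h1.1, by constructor <;> linarith⟩
  have hww := (hAU.divEq_iff hU hwg).1 hweq
  -- Uniqueness in `H¹₀(U)` identifies `θ v` with the `H²` solution `w` supplied by the hypothesis.
  have hae := hθv.ae_eq hAU hU ha hR0 (fun x hx => hR x (hUΩ hx)) hwg0 hF'U heq' hww
  have hgrad : ∀ i, q i =ᵐ[volume.restrict U] weakPartial U i w := fun i =>
    ((hθv.weak i).congr hU hae EventuallyEq.rfl).unique hU (hwg.weak i)
  have hD := (hw2.2 i).hasGrad hU
  refine ⟨weakPartial U j (weakPartial U i w), hD.memLp_grad j, ?_, fun φ hφ => ?_⟩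
  · have h1 : L2Norm U (weakPartial U j (weakPartial U i w)) ^ 2 ≤ H2Norm U w ^ 2 := by
      rw [H2Norm_sq]
      refine le_trans ?_ le_add_self
      exact (Finset.single_le_sum (f := fun j => L2Norm U (weakPartial U j (weakPartial U i w)) ^ 2)
        (fun _ _ => zero_le) (Finset.mem_univ j)).trans (Finset.single_le_sum
        (f := fun i => ∑ j, L2Norm U (weakPartial U j (weakPartial U i w)) ^ 2)
        (fun _ _ => zero_le) (Finset.mem_univ i))
    calc _ ≤ H2Norm U w ^ 2 := h1
      _ ≤ (K * ((cθ + 36 * c * cθ : ℝ≥0) *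
          (L2Norm U F + L2Norm U v + ∑ i, L2Norm U (p i)))) ^ 2 := by
          gcongr
          exact hwn.trans (by gcongr)
      _ = (K * (cθ + 36 * c * cθ : ℝ≥0)) ^ 2 *
          (L2Norm U F + L2Norm U v + ∑ i, L2Norm U (p i)) ^ 2 := by ring
      _ ≤ (K * (cθ + 36 * c * cθ : ℝ≥0)) ^ 2 *
          (5 * (L2Norm U F ^ 2 + L2Norm U v ^ 2 + ∑ i, L2Norm U (p i) ^ 2)) := by
          gcongr
          exact ENNReal_sum_sq_le _ _ _
      _ = _ := by push_cast; ring
  · have hsub : cylinder ω (Ioo (-(3 / 4)) (3 / 4)) ⊆ U := fun x hx =>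
      ⟨hx.1, by constructor <;> linarith [hx.2.1, hx.2.2]⟩
    have hφU := hφ.mono hsub
    rw [← (hD.weak j).2.2 φ hφU, ← setIntegral_mul_test_of_subset (hφU.partialDeriv j) hUΩ]
    -- The test function lives where `θ = 1` and `∇θ = 0`, so the gradient of `θ v` is that of `v`
    -- there.
    refine integral_congr_ae ?_
    filter_upwards [hgrad i] with x hx
    rw [← hx]
    by_cases hxs : partialDeriv j φ x = 0
    · rw [hxs]; simp
    · have hxm : x ∈ cylinder ω (Ioo (-(3 / 4)) (3 / 4)) :=
        (hφ.partialDeriv j).2 (subset_tsupport _ hxs)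
      have habs : |x 2| < 3 / 4 := abs_lt.2 hxm.2
      simp only [hq, hθ1 x habs.le, hθd i x habs]
      ring

end Localization


/-! ### Translations -/

section Translation

variable {s : E3} {V : Set E3}

lemma partialDeriv_comp_add_right (s : E3) (i : Fin 3) (φ : E3 → ℝ) (x : E3) :
    partialDeriv i (fun y => φ (y + s)) x = partialDeriv i φ (x + s) := by
  rw [partialDeriv, partialDeriv, fderiv_comp_add_right]

lemma IsTest.comp_add_right {φ : E3 → ℝ} (hφ : IsTest V φ) (s : E3) :
    IsTest ((· + s) ⁻¹' V) (fun y => φ (y + s)) := by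
  refine ⟨⟨hφ.1.1.comp (contDiff_id.add contDiff_const), ?_⟩, ?_⟩
  · exact hφ.1.2.comp_homeomorph (Homeomorph.addRight s)
  · intro x hx
    have := tsupport_comp_eq_preimage φ (Homeomorph.addRight s)
    exact hφ.2 (this.subset hx)

lemma measurePreserving_add_right_restrict (s : E3) (V : Set E3) :
    MeasurePreserving (· + s) ((volume : Measure E3).restrict ((· + s) ⁻¹' V))
      (volume.restrict V) :=
  (measurePreserving_add_right volume s).restrict_preimage_emb (measurableEmbedding_addRight s) V

lemma setIntegral_comp_add_right (s : E3) (V : Set E3) (f : E3 → ℝ) :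
    ∫ x in (· + s) ⁻¹' V, f (x + s) = ∫ x in V, f x :=
  (measurePreserving_add_right_restrict s V).integral_comp (measurableEmbedding_addRight s) f

lemma setLIntegral_comp_add_right (s : E3) (V : Set E3) (f : E3 → ℝ≥0∞) :
    ∫⁻ x in (· + s) ⁻¹' V, f (x + s) = ∫⁻ x in V, f x :=
  (measurePreserving_add_right_restrict s V).lintegral_comp_emb (measurableEmbedding_addRight s) f

lemma L2Norm_comp_add_right (s : E3) (V : Set E3) (f : E3 → ℝ) :
    L2Norm ((· + s) ⁻¹' V) (fun x => f (x + s)) ^ 2 = L2Norm V f ^ 2 := by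
  rw [L2Norm_sq, L2Norm_sq]
  exact setLIntegral_comp_add_right s V fun x => ‖f x‖ₑ ^ 2

lemma L2Norm_comp_add_right' (s : E3) (V : Set E3) (f : E3 → ℝ) :
    L2Norm ((· + s) ⁻¹' V) (fun x => f (x + s)) = L2Norm V f := by
  rw [L2Norm, L2Norm, ← (measurePreserving_add_right_restrict s V).map_eq,
    (measurableEmbedding_addRight s).eLpNorm_map_measure]
  rfl

lemma memLp_comp_add_right {f : E3 → ℝ} {q : ℝ≥0∞} (hf : MemLp f q (volume.restrict V)) (s : E3) :
    MemLp (fun x => f (x + s)) q (volume.restrict ((· + s) ⁻¹' V)) :=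
  hf.comp_measurePreserving (measurePreserving_add_right_restrict s V)

lemma HasGrad0.comp_add_right {v : E3 → ℝ} {p : Fin 3 → E3 → ℝ} (h : HasGrad0 V v p) (s : E3) :
    HasGrad0 ((· + s) ⁻¹' V) (fun x => v (x + s)) (fun i x => p i (x + s)) := by
  obtain ⟨φ, hφ, hl⟩ := h.exists_seq
  refine HasGrad0.of_tendsto (memLp_comp_add_right h.memLp s)
    (fun i => memLp_comp_add_right (h.memLp_grad i) s) (fun n => (hφ n).comp_add_right s) ⟨?_, ?_⟩
  · simpa only [← L2Norm_comp_add_right' s V] using hl.1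
  · intro i
    simp only [partialDeriv_comp_add_right]
    simpa only [← L2Norm_comp_add_right' s V] using hl.2 i

lemma WeakEq.comp_add_right {A : E3 → Matrix (Fin 3) (Fin 3) ℝ} {p : Fin 3 → E3 → ℝ} {F : E3 → ℝ}
    (h : WeakEq V A p F) (s : E3) :
    WeakEq ((· + s) ⁻¹' V) (fun x => A (x + s)) (fun i x => p i (x + s)) (fun x => F (x + s)) := by
  intro φ hφ
  have h1 : IsTest V (fun y => φ (y + -s)) := by
    have := hφ.comp_add_right (-s)
    refine this.mono fun x hx => ?_
    simpa using hx
  have h2 := h _ h1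
  rw [← setIntegral_comp_add_right s] at h2
  simp only [← setIntegral_comp_add_right s V, partialDeriv_comp_add_right,
    add_neg_cancel_right] at h2
  exact h2

lemma Admissible.comp_add_right {A : E3 → Matrix (Fin 3) (Fin 3) ℝ} {a : ℝ} {c : ℝ≥0}
    (h : Admissible V a c A) (s : E3) : Admissible ((· + s) ⁻¹' V) a c (fun x => A (x + s)) where
  symm x hx := h.symm _ hx
  blip i j := by
    refine ⟨fun x hx => (h.blip i j).1 _ hx, LipschitzOnWith.of_dist_le_mul fun x hx y hy => ?_⟩
    have := (h.blip i j).2.dist_le_mul _ hx _ hy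
    simpa using this
  coercive x hx := h.coercive _ hx

lemma preimage_add_single_cylinder (ω : Set E2) (t a b : ℝ) :
    (fun x : E3 => x + EuclideanSpace.single 2 t) ⁻¹' cylinder ω (Ioo (a + t) (b + t)) =
      cylinder ω (Ioo a b) := by
  ext x
  simp [cylinder]

lemma preimage_add_single_waveguide (ω : Set E2) (t : ℝ) :
    (fun x : E3 => x + EuclideanSpace.single 2 t) ⁻¹' waveguide ω = waveguide ω := by
  ext x
  simp [waveguide, cylinder]

end Translation

/-- `H²` regularity of weak solutions in slabs, with estimates uniform in the slab. -/
lemma HasH2Regularity.exists_slab {ω : Set E2} {a : ℝ} (hω : IsOpen ω) {R : ℝ≥0} (hR0 : 0 < R)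
    (hR : ∀ x ∈ waveguide ω, |x 0| ≤ R) (hreg : HasH2Regularity (cylinder ω (Ioo (-1) 1)))
    (ha : 0 < a) (c : ℝ≥0) : ∃ C : ℝ≥0, ∀ A, Admissible (waveguide ω) a c A → ∀ v p F,
      HasGrad0 (waveguide ω) v p → MemLp F 2 (volume.restrict (waveguide ω)) →
      WeakEq (waveguide ω) A p F → ∀ (k : ℤ) (i j : Fin 3), ∃ D : E3 → ℝ,
        MemLp D 2 (volume.restrict (cylinder ω (Ioo (k - 1) (k + 1)))) ∧
        L2Norm (cylinder ω (Ioo (k - 1) (k + 1))) D ^ 2 ≤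
          C * (L2Norm (cylinder ω (Ioo (k - 1) (k + 1))) F ^ 2 +
            L2Norm (cylinder ω (Ioo (k - 1) (k + 1))) v ^ 2 +
            ∑ i, L2Norm (cylinder ω (Ioo (k - 1) (k + 1))) (p i) ^ 2) ∧
        ∀ φ, IsTest (cylinder ω (Ioo (k - 3 / 4) (k + 3 / 4))) φ →
          ∫ x in waveguide ω, p i x * partialDeriv j φ x =
            - ∫ x in cylinder ω (Ioo (k - 1) (k + 1)), D x * φ x := by
  obtain ⟨C, hC⟩ := hreg.exists_local hω hR0 hR ha c
  refine ⟨C, fun A hA v p F hv hF heq k i j => ?_⟩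
  -- Translating the slab to the origin changes `A` but neither its ellipticity constant nor its
  -- bounds, so the same `C` serves every `k`.
  set s : E3 := EuclideanSpace.single 2 (k : ℝ) with hs
  have eW : (· + s) ⁻¹' waveguide ω = waveguide ω := preimage_add_single_waveguide ω k
  have eU : (· + s) ⁻¹' cylinder ω (Ioo (k - 1) (k + 1)) = cylinder ω (Ioo (-1) 1) := by
    have := preimage_add_single_cylinder ω k (-1) 1
    rwa [neg_add_eq_sub, add_comm] at this
  have eU' : (· + -s) ⁻¹' cylinder ω (Ioo (-1) 1) = cylinder ω (Ioo (k - 1) (k + 1)) := by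
    rw [← eU, preimage_preimage]; simp
  have eT : (· + s) ⁻¹' cylinder ω (Ioo (k - 3 / 4) (k + 3 / 4)) =
      cylinder ω (Ioo (-(3 / 4)) (3 / 4)) := by
    have := preimage_add_single_cylinder ω k (-(3 / 4)) (3 / 4)
    rwa [neg_add_eq_sub, add_comm] at this
  have hA' := hA.comp_add_right s
  have hv' := hv.comp_add_right s
  have hF' := memLp_comp_add_right hF s
  have heq' := heq.comp_add_right s
  rw [eW] at hA' hv' hF' heq'
  obtain ⟨D, hD, hDn, hDi⟩ := hC _ hA' _ _ _ hv' hF' heq' i j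
  refine ⟨fun x => D (x + -s), ?_, ?_, fun φ hφ => ?_⟩
  · have := memLp_comp_add_right hD (-s)
    rwa [eU'] at this
  · rw [← eU', L2Norm_comp_add_right, eU']
    rw [← eU] at hDn
    simp only [L2Norm_comp_add_right] at hDn
    rwa [eU] at hDn
  · have h1 := hφ.comp_add_right s
    rw [eT] at h1
    have h2 := hDi _ h1
    rw [← setIntegral_comp_add_right s, eW, ← setIntegral_comp_add_right s _ (fun x => _ * φ x), eU]
    simpa only [partialDeriv_comp_add_right, add_neg_cancel_right] using h2


/-! ### Gluing of weak derivatives over slabs -/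

section Gluing

variable {ω : Set E2}

/-- A partition of unity in `x₃` whose transition takes place in the middle third of the overlap
`(c, b)`, so that both closed supports stay inside their slabs. -/
lemma IsTest.exists_split {a b c d : ℝ} (hcb : c < b) {φ : E3 → ℝ}
    (hφ : IsTest (cylinder ω (Ioo a d)) φ) :
    ∃ φ₁ φ₂ : E3 → ℝ, IsTest (cylinder ω (Ioo a b)) φ₁ ∧ IsTest (cylinder ω (Ioo c d)) φ₂ ∧
      φ = fun x => φ₁ x + φ₂ x := by
  have hc2 : Continuous fun x : E3 => x 2 := (EuclideanSpace.proj 2 : E3 →L[ℝ] ℝ).continuous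
  let θ : E3 → ℝ := fun x => Real.smoothTransition (((c + 2 * b) / 3 - x 2) / ((b - c) / 3))
  have hθ : ContDiff ℝ ((⊤ : ℕ∞) : WithTop ℕ∞) θ := by
    have : ContDiff ℝ ((⊤ : ℕ∞) : WithTop ℕ∞) fun x : E3 => x 2 :=
      (EuclideanSpace.proj 2 : E3 →L[ℝ] ℝ).contDiff
    exact Real.smoothTransition.contDiff.comp ((contDiff_const.sub this).div_const _)
  have h1θ : ContDiff ℝ ((⊤ : ℕ∞) : WithTop ℕ∞) (fun x => 1 - θ x) := contDiff_const.sub hθ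
  have hbc : 0 < (b - c) / 3 := by linarith
  have s1 : tsupport θ ⊆ {x : E3 | x 2 ≤ (c + 2 * b) / 3} := by
    refine closure_minimal (fun x hx => ?_) (isClosed_le hc2 continuous_const)
    by_contra h
    refine hx (Real.smoothTransition.zero_of_nonpos ?_)
    exact div_nonpos_of_nonpos_of_nonneg (by simp at h; linarith) hbc.le
  have s2 : tsupport (fun x => 1 - θ x) ⊆ {x : E3 | (2 * c + b) / 3 ≤ x 2} := by
    refine closure_minimal (fun x hx => ?_) (isClosed_le continuous_const hc2)
    by_contra h
    refine hx ?_
    have : θ x = 1 := Real.smoothTransition.one_of_one_le (by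
      rw [le_div_iff₀ hbc]; simp at h; linarith)
    simp [this]
  refine ⟨fun x => θ x * φ x, fun x => (1 - θ x) * φ x, ⟨(hφ.1.mul_left hθ), fun x hx => ?_⟩,
    ⟨hφ.1.mul_left h1θ, fun x hx => ?_⟩, by ext x; ring⟩
  · have h1 := hφ.2 (tsupport_mul_subset_right hx)
    have h2 : x 2 ≤ _ := s1 (tsupport_mul_subset_left hx)
    exact ⟨h1.1, h1.2.1, by linarith⟩
  · have h1 := hφ.2 (tsupport_mul_subset_right hx)
    have h2 : _ ≤ x 2 := s2 (tsupport_mul_subset_left hx)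
    exact ⟨h1.1, by linarith, h1.2.2⟩

/-- Integration by parts for `g` and `D` against test functions supported in a slab. -/
def SlabIdentity (ω : Set E2) (j : Fin 3) (g D : E3 → ℝ) (I : Set ℝ) : Prop :=
  ∀ φ, IsTest (cylinder ω I) φ →
    ∫ x in waveguide ω, g x * partialDeriv j φ x = - ∫ x in waveguide ω, D x * φ x

lemma SlabIdentity.glue {j : Fin 3} {g D : E3 → ℝ} (hg : MemLp g 2 (volume.restrict (waveguide ω)))
    (hD : MemLp D 2 (volume.restrict (waveguide ω))) {a b c d : ℝ} (hcb : c < b)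
    (h : SlabIdentity ω j g D (Ioo a b)) (h' : SlabIdentity ω j g D (Ioo c d)) :
    SlabIdentity ω j g D (Ioo a d) := by
  intro φ hφ
  obtain ⟨φ₁, φ₂, h1, h2, rfl⟩ := hφ.exists_split hcb
  simp only [partialDeriv_add j (h1.1.differentiable _) (h2.1.differentiable _), mul_add]
  rw [integral_add (hg.integrable_mul_two ((h1.partialDeriv j).1.memLp 2 _))
    (hg.integrable_mul_two ((h2.partialDeriv j).1.memLp 2 _)),
    integral_add (hD.integrable_mul_two (h1.1.memLp 2 _))
    (hD.integrable_mul_two (h2.1.memLp 2 _)), h _ h1, h' _ h2]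
  ring

lemma SlabIdentity.of_forall_int {j : Fin 3} {g D : E3 → ℝ}
    (hg : MemLp g 2 (volume.restrict (waveguide ω)))
    (hD : MemLp D 2 (volume.restrict (waveguide ω)))
    (h : ∀ k : ℤ, SlabIdentity ω j g D (Ioo (k - 3 / 4) (k + 3 / 4))) :
    HasWeakPartial (waveguide ω) j g D := by
  -- Consecutive slabs of half-width `3/4` overlap, so one more slab is glued on at each end; a
  -- compact support fits into some finite union.
  have key : ∀ n : ℕ, SlabIdentity ω j g D (Ioo (-n - 3 / 4) (n + 3 / 4)) := by
    intro n
    induction n with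
    | zero => simpa using h 0
    | succ n ih =>
      have h1 := ih.glue hg hD (by push_cast; linarith) (h (n + 1))
      have h2 := (h (-(n + 1))).glue hg hD (by push_cast; linarith) h1
      convert h2 using 2 <;> push_cast <;> ring
  refine ⟨hg.locallyIntegrableOn (by norm_num), hD.locallyIntegrableOn (by norm_num),
    fun φ hφ => ?_⟩
  obtain ⟨r, hr⟩ := hφ.1.2.isBounded.exists_norm_le
  obtain ⟨n, hn⟩ := exists_nat_ge r
  refine key n φ ⟨hφ.1, fun x hx => ⟨(hφ.2 hx).1, ?_⟩⟩
  have := (PiLp.norm_apply_le x 2).trans ((hr x hx).trans hn)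
  rw [Real.norm_eq_abs, abs_le] at this
  constructor <;> linarith

lemma exists_measurable_round : ∃ ρ : E3 → ℤ, Measurable ρ ∧ ∀ x, |x 2 - ρ x| ≤ 1 / 2 := by
  have hc2 : Continuous fun x : E3 => x 2 := (EuclideanSpace.proj 2 : E3 →L[ℝ] ℝ).continuous
  refine ⟨fun x => ⌊x 2 + 1 / 2⌋, (hc2.measurable.add_const _).floor, fun x => ?_⟩
  have := abs_sub_round (x 2)
  rwa [round_eq] at this

lemma measurable_selection {e : ℤ → E3 → ℝ} (he : ∀ k, Measurable (e k)) {ρ : E3 → ℤ}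
    (hρ : Measurable ρ) : Measurable fun x => e (ρ x) x := by
  have h : Measurable fun q : ℤ × E3 => e q.1 q.2 := measurable_from_prod_countable_right he
  exact h.comp (hρ.prodMk measurable_id)

/-- On the level set `ρ = k` the integral is bounded by that of `H` over `U k`, which meets only
three consecutive level sets; in the sum over `k` each level set is counted three times. -/
lemma lintegral_selection_le {Ω : Set E3} (hΩ : MeasurableSet Ω) {ρ : E3 → ℤ} (hρ : Measurable ρ)
    {U : ℤ → Set E3} (hSU : ∀ x ∈ Ω, x ∈ U (ρ x))
    (hUS : ∀ k, ∀ x ∈ U k, x ∈ Ω ∧ (ρ x = k - 1 ∨ ρ x = k ∨ ρ x = k + 1))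
    {e : ℤ → E3 → ℝ≥0∞} {H : E3 → ℝ≥0∞} (he : ∀ k, ∫⁻ x in U k, e k x ≤ ∫⁻ x in U k, H x) :
    ∫⁻ x in Ω, e (ρ x) x ≤ 3 * ∫⁻ x in Ω, H x := by
  let S : ℤ → Set E3 := fun k => Ω ∩ ρ ⁻¹' {k}
  have hS : ∀ k, MeasurableSet (S k) := fun k => hΩ.inter (hρ (measurableSet_singleton k))
  have hSd : Pairwise (Function.onFun Disjoint S) := fun k l hkl =>
    disjoint_left.2 fun x hx hx' => hkl ((mem_singleton_iff.1 hx.2).symm.trans hx'.2)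
  have hSΩ : ⋃ k, S k = Ω := by
    ext x
    simp [S]
  have hsum : ∀ f : E3 → ℝ≥0∞, ∑' k, ∫⁻ x in S k, f x = ∫⁻ x in Ω, f x := fun f => by
    rw [← lintegral_iUnion hS hSd, hSΩ]
  have hle : ∀ k, ∫⁻ x in S k, e (ρ x) x ≤
      (∫⁻ x in S (k - 1), H x) + (∫⁻ x in S k, H x) + ∫⁻ x in S (k + 1), H x := by
    intro k
    calc ∫⁻ x in S k, e (ρ x) x = ∫⁻ x in S k, e k x :=
          setLIntegral_congr_fun (hS k) fun x hx => by rw [mem_singleton_iff.1 hx.2]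
      _ ≤ ∫⁻ x in U k, e k x := lintegral_mono_set fun x hx =>
          mem_singleton_iff.1 hx.2 ▸ hSU x hx.1
      _ ≤ ∫⁻ x in U k, H x := he k
      _ ≤ ∫⁻ x in S (k - 1) ∪ S k ∪ S (k + 1), H x := lintegral_mono_set fun x hx => by
          obtain ⟨h1, h | h | h⟩ := hUS k x hx
          · exact Or.inl (Or.inl ⟨h1, h⟩)
          · exact Or.inl (Or.inr ⟨h1, h⟩)
          · exact Or.inr ⟨h1, h⟩
      _ ≤ _ := (lintegral_union_le _ _ _).trans (add_le_add (lintegral_union_le _ _ _) le_rfl)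
  rw [← hsum]
  refine (ENNReal.tsum_le_tsum hle).trans (le_of_eq ?_)
  have h1 := (Equiv.subRight (1 : ℤ)).tsum_eq (fun k => ∫⁻ x in S k, H x)
  have h2 := (Equiv.addRight (1 : ℤ)).tsum_eq (fun k => ∫⁻ x in S k, H x)
  simp only [Equiv.subRight_apply, Equiv.coe_addRight] at h1 h2
  rw [ENNReal.tsum_add, ENNReal.tsum_add, h1, h2, hsum]
  ring

/-- Weak derivatives on slabs with a uniform control define a weak derivative on the waveguide. -/
lemma exists_hasWeakPartial_of_slabs (hω : IsOpen ω) {g : E3 → ℝ} {j : Fin 3} {E : ℤ → E3 → ℝ}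
    (hg : MemLp g 2 (volume.restrict (waveguide ω)))
    (hE : ∀ k : ℤ, MemLp (E k) 2 (volume.restrict (cylinder ω (Ioo (k - 1) (k + 1)))))
    (hid : ∀ (k : ℤ) φ, IsTest (cylinder ω (Ioo (k - 3 / 4) (k + 3 / 4))) φ →
      ∫ x in waveguide ω, g x * partialDeriv j φ x =
        - ∫ x in cylinder ω (Ioo (k - 1) (k + 1)), E k x * φ x) {H : E3 → ℝ≥0∞}
    (hH : ∀ k : ℤ, L2Norm (cylinder ω (Ioo (k - 1) (k + 1))) (E k) ^ 2 ≤
      ∫⁻ x in cylinder ω (Ioo (k - 1) (k + 1)), H x) (hfin : ∫⁻ x in waveguide ω, H x ≠ ∞) :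
    ∃ D, MemLp D 2 (volume.restrict (waveguide ω)) ∧
      L2Norm (waveguide ω) D ^ 2 ≤ 3 * ∫⁻ x in waveguide ω, H x ∧
      HasWeakPartial (waveguide ω) j g D := by
  let U : ℤ → Set E3 := fun k => cylinder ω (Ioo (k - 1) (k + 1))
  let T : ℤ → Set E3 := fun k => cylinder ω (Ioo (k - 3 / 4) (k + 3 / 4))
  have hU : ∀ k, IsOpen (U k) := fun k => isOpen_cylinder hω isOpen_Ioo
  have hT : ∀ k, IsOpen (T k) := fun k => isOpen_cylinder hω isOpen_Ioo
  have hTU : ∀ k, T k ⊆ U k := fun k x hx =>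
    ⟨hx.1, by constructor <;> linarith [hx.2.1, hx.2.2]⟩
  have hUΩ : ∀ k, U k ⊆ waveguide ω := fun k => cylinder_subset_waveguide _ _
  have hΩ := isOpen_waveguide hω
  obtain ⟨ρ, hρ, hρr⟩ := exists_measurable_round
  have hρT : ∀ x ∈ waveguide ω, x ∈ T (ρ x) := by
    intro x hx
    have := abs_le.1 (hρr x)
    exact ⟨hx.1, by constructor <;> linarith⟩
  -- Genuinely measurable representatives are needed for the selection `x ↦ E' (ρ x) x` to be
  -- measurable.
  obtain ⟨E', hE'm, hEE'⟩ : ∃ E' : ℤ → E3 → ℝ, (∀ k, Measurable (E' k)) ∧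
      ∀ k, E k =ᵐ[volume.restrict (U k)] E' k :=
    ⟨fun k => (hE k).1.mk (E k), fun k => (hE k).1.stronglyMeasurable_mk.measurable,
      fun k => (hE k).1.ae_eq_mk⟩
  have hE' : ∀ k, MemLp (E' k) 2 (volume.restrict (U k)) := fun k => (hE k).ae_eq (hEE' k)
  have hid' : ∀ k φ, IsTest (T k) φ →
      ∫ x in waveguide ω, g x * partialDeriv j φ x = - ∫ x in U k, E' k x * φ x := by
    intro k φ hφ
    rw [hid k φ hφ]
    congr 1
    refine integral_congr_ae ?_
    filter_upwards [hEE' k] with x hx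
    rw [hx]
  have hw : ∀ k l, HasWeakPartial (T k ∩ T l) j g (E' k) := fun k l => by
    have hs : T k ∩ T l ⊆ U k := fun x hx => hTU k hx.1
    refine ⟨(hg.mono_measure (Measure.restrict_mono (hs.trans (hUΩ k)) le_rfl)).locallyIntegrableOn
      (by norm_num), ((hE' k).mono_measure (Measure.restrict_mono hs le_rfl)).locallyIntegrableOn
      (by norm_num), fun φ hφ => ?_⟩
    rw [setIntegral_mul_test_of_subset hφ hs,
      setIntegral_mul_test_of_subset (hφ.partialDeriv j) (hs.trans (hUΩ k)),
      hid' k φ (hφ.mono inter_subset_left)]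
  -- Local derivatives agree almost everywhere on overlaps by uniqueness; as there are countably
  -- many pairs of slabs, one null set suffices.
  have hae : ∀ᵐ x, ∀ k l, x ∈ T k → x ∈ T l → E' k x = E' l x := by
    rw [ae_all_iff]; intro k
    rw [ae_all_iff]; intro l
    have h1 := (hw k l).unique ((hT k).inter (hT l)) (inter_comm (T l) (T k) ▸ hw l k)
    rw [Filter.EventuallyEq, ae_restrict_iff' ((hT k).inter (hT l)).measurableSet] at h1
    filter_upwards [h1] with x hx hk hl using hx ⟨hk, hl⟩
  let D : E3 → ℝ := fun x => E' (ρ x) x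
  have hDm : Measurable D := measurable_selection hE'm hρ
  have hUS : ∀ k, ∀ x ∈ U k, x ∈ waveguide ω ∧ (ρ x = k - 1 ∨ ρ x = k ∨ ρ x = k + 1) := by
    intro k x hx
    have h1 := abs_le.1 (hρr x)
    have h2 : ((ρ x : ℤ) : ℝ) < (k + 2 : ℤ) := by push_cast; linarith [hx.2.2]
    have h3 : ((k - 2 : ℤ) : ℝ) < (ρ x : ℤ) := by push_cast; linarith [hx.2.1]
    have h2' := Int.cast_lt.1 h2
    have h3' := Int.cast_lt.1 h3
    exact ⟨hUΩ k hx, by omega⟩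
  have hDn : L2Norm (waveguide ω) D ^ 2 ≤ 3 * ∫⁻ x in waveguide ω, H x := by
    rw [L2Norm_sq]
    refine lintegral_selection_le hΩ.measurableSet hρ (e := fun k x => ‖E' k x‖ₑ ^ 2)
      (fun x hx => hTU _ (hρT x hx)) hUS fun k => ?_
    rw [← L2Norm_sq, ← L2Norm_congr (hEE' k)]
    exact hH k
  have hD : MemLp D 2 (volume.restrict (waveguide ω)) := by
    refine ⟨hDm.aestronglyMeasurable, ?_⟩
    have : L2Norm (waveguide ω) D ^ 2 < ∞ :=
      hDn.trans_lt (ENNReal.mul_lt_top (by simp) hfin.lt_top)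
    exact (ENNReal.pow_lt_top_iff.1 this).resolve_right two_ne_zero
  refine ⟨D, hD, hDn, SlabIdentity.of_forall_int hg hD fun k φ hφ => ?_⟩
  rw [hid' k φ hφ, setIntegral_mul_test_of_subset (hφ.mono (hTU k)) (hUΩ k)]
  congr 1
  refine integral_congr_ae (ae_restrict_of_ae ?_)
  filter_upwards [hae] with x hx
  by_cases h0 : φ x = 0
  · rw [h0, mul_zero, mul_zero]
  · have hk : x ∈ T k := hφ.2 (subset_tsupport _ h0)
    rw [hx k (ρ x) hk (hρT x (hUΩ k (hTU k hk)))]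

end Gluing


/-! ### Second derivatives -/

section Hessian

variable {U : Set E3} {u v : E3 → ℝ} {p q : Fin 3 → E3 → ℝ} {D D' : Fin 3 → Fin 3 → E3 → ℝ}

/-- `u ∈ H²(U)` with gradient `p` and Hessian `D`. -/
structure HasHess (U : Set E3) (u : E3 → ℝ) (p : Fin 3 → E3 → ℝ) (D : Fin 3 → Fin 3 → E3 → ℝ) :
    Prop extends HasGrad U u p where
  hess : ∀ i, HasGrad U (p i) (D i)

lemma MemH2.hasHess (hU : IsOpen U) (h : MemH2 U u) : HasHess U u (fun i => weakPartial U i u)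
    (fun i j => weakPartial U j (weakPartial U i u)) :=
  ⟨h.hasGrad hU, fun i => (h.2 i).hasGrad hU⟩

lemma HasHess.hasGrad_weakPartial (hU : IsOpen U) (h : HasHess U u p D) (i : Fin 3) :
    HasGrad U (weakPartial U i u) (D i) :=
  (h.hess i).congr hU (h.weakPartial_ae hU i).symm fun _ => EventuallyEq.rfl

lemma HasHess.memH2 (hU : IsOpen U) (h : HasHess U u p D) : MemH2 U u :=
  ⟨h.memH1, fun i => (h.hasGrad_weakPartial hU i).memH1⟩

lemma HasHess.H2Norm_sq (hU : IsOpen U) (h : HasHess U u p D) : H2Norm U u ^ 2 =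
    L2Norm U u ^ 2 + ∑ i, L2Norm U (p i) ^ 2 + ∑ i, ∑ j, L2Norm U (D i j) ^ 2 := by
  rw [Waveguide.H2Norm_sq]
  simp only [fun i => L2Norm_congr (h.weakPartial_ae hU i),
    fun i j => L2Norm_congr ((h.hasGrad_weakPartial hU i).weakPartial_ae hU j)]

lemma HasHess.sub (h : HasHess U u p D) (h' : HasHess U v q D') :
    HasHess U (fun x => u x - v x) (fun i x => p i x - q i x) (fun i j x => D i j x - D' i j x) :=
  ⟨h.toHasGrad.sub h'.toHasGrad, fun i => (h.hess i).sub (h'.hess i)⟩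

lemma HasHess.congr (hU : IsOpen U) (h : HasHess U u p D) (huv : u =ᵐ[volume.restrict U] v) :
    HasHess U v p D :=
  ⟨h.toHasGrad.congr hU huv fun _ => EventuallyEq.rfl, h.hess⟩

/-- The representatives chosen by `weakPartial` for two functions equal almost everywhere may
differ, so both norms are computed from one common Hessian. -/
lemma H2Norm_congr (hU : IsOpen U) (hu : MemH2 U u) (huv : u =ᵐ[volume.restrict U] v) :
    H2Norm U u = H2Norm U v := by
  have h := hu.hasHess hU
  have h1 := h.H2Norm_sq hU
  have h2 := (h.congr hU huv).H2Norm_sq hU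
  rw [H2Norm, H2Norm, ← Waveguide.H2Norm_sq, ← Waveguide.H2Norm_sq, h1, h2, L2Norm_congr huv]

lemma L2Norm_sub_sq_le {f g : E3 → ℝ} (hf : MemLp f 2 (volume.restrict U))
    (hg : MemLp g 2 (volume.restrict U)) :
    L2Norm U (fun x => f x - g x) ^ 2 ≤ 2 * L2Norm U f ^ 2 + 2 * L2Norm U g ^ 2 := by
  have h := ENNReal.rpow_add_le_mul_rpow_add_rpow (L2Norm U f) (L2Norm U g) (p := 2) (by norm_num)
  norm_num at h
  rw [← mul_add]
  exact (pow_le_pow_left₀ zero_le (L2Norm_sub_le hf.1 hg.1) 2).trans h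

lemma HasHess.H2Norm_sub_sq_le (hU : IsOpen U) (h : HasHess U u p D) (h' : HasHess U v q D') :
    H2Norm U (fun x => u x - v x) ^ 2 ≤ 2 * H2Norm U u ^ 2 + 2 * H2Norm U v ^ 2 := by
  rw [(h.sub h').H2Norm_sq hU, h.H2Norm_sq hU, h'.H2Norm_sq hU]
  calc _ ≤ (2 * L2Norm U u ^ 2 + 2 * L2Norm U v ^ 2) +
        ∑ i, (2 * L2Norm U (p i) ^ 2 + 2 * L2Norm U (q i) ^ 2) +
        ∑ i, ∑ j, (2 * L2Norm U (D i j) ^ 2 + 2 * L2Norm U (D' i j) ^ 2) := by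
        gcongr with i _ i _ j
        · exact L2Norm_sub_sq_le h.memLp h'.memLp
        · exact L2Norm_sub_sq_le (h.memLp_grad i) (h'.memLp_grad i)
        · exact L2Norm_sub_sq_le ((h.hess i).memLp_grad j) ((h'.hess i).memLp_grad j)
    _ = _ := by
        simp only [Finset.sum_add_distrib, ← Finset.mul_sum]
        ring

end Hessian

/-- Global `H²` regularity of weak solutions in the waveguide. -/
lemma HasH2Regularity.exists_hasHess {ω : Set E2} {a : ℝ} (hω : IsOpen ω) {R : ℝ≥0} (hR0 : 0 < R)
    (hR : ∀ x ∈ waveguide ω, |x 0| ≤ R) (hreg : HasH2Regularity (cylinder ω (Ioo (-1) 1)))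
    (ha : 0 < a) (c : ℝ≥0) : ∃ C : ℝ≥0, ∀ A, Admissible (waveguide ω) a c A → ∀ F,
      MemLp F 2 (volume.restrict (waveguide ω)) → ∃ v p D, HasGrad0 (waveguide ω) v p ∧
        WeakEq (waveguide ω) A p F ∧ HasHess (waveguide ω) v p D ∧
        H2Norm (waveguide ω) v ^ 2 ≤ C * L2Norm (waveguide ω) F ^ 2 := by
  obtain ⟨C, hC⟩ := hreg.exists_slab hω hR0 hR ha c
  have hΩ := isOpen_waveguide hω
  set Ω := waveguide ω with hΩdef
  obtain ⟨e, he⟩ : ∃ e : ℝ≥0, (e : ℝ≥0∞) = ENNReal.ofReal (4 * R ^ 2 / a ^ 2) := ⟨_, rfl⟩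
  obtain ⟨d, hd⟩ : ∃ d : ℝ≥0, (d : ℝ≥0∞) = C * (1 + (2 * R) ^ 2 * e + e) :=
    ⟨C * (1 + (2 * R) ^ 2 * e + e), by push_cast; rfl⟩
  -- The first two terms bound the function and its gradient; the last bounds nine second
  -- derivatives, each with the overlap factor `3`.
  refine ⟨(2 * R) ^ 2 * e + e + 9 * (3 * d), fun A hA F hF => ?_⟩
  obtain ⟨v, p, hv, heq⟩ := exists_weak_solution hA hΩ ha hR hF
  -- The slab estimates are written as integrals of one density `H`, so that they can be summed over
  -- the overlapping slabs.
  let H : E3 → ℝ≥0∞ := fun x => C * (‖F x‖ₑ ^ 2 + ‖v x‖ₑ ^ 2 + ∑ i, ‖p i x‖ₑ ^ 2)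
  have hHI : ∀ V ⊆ Ω, ∫⁻ x in V, H x =
      C * (L2Norm V F ^ 2 + L2Norm V v ^ 2 + ∑ i, L2Norm V (p i) ^ 2) := by
    intro V hV
    have hm := Measure.restrict_mono (μ := (volume : Measure E3)) hV le_rfl
    have m1 : AEMeasurable (fun x => ‖F x‖ₑ ^ 2) (volume.restrict V) :=
      (hF.1.mono_measure hm).enorm.pow_const 2
    have m2 : AEMeasurable (fun x => ‖v x‖ₑ ^ 2) (volume.restrict V) :=
      (hv.memLp.1.mono_measure hm).enorm.pow_const 2
    have m12 : AEMeasurable (fun x => ‖F x‖ₑ ^ 2 + ‖v x‖ₑ ^ 2) (volume.restrict V) := m1.add m2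
    have m3 : ∀ i ∈ Finset.univ, AEMeasurable (fun x => ‖p i x‖ₑ ^ 2) (volume.restrict V) :=
      fun i _ => ((hv.memLp_grad i).1.mono_measure hm).enorm.pow_const 2
    simp only [H, L2Norm_sq]
    rw [lintegral_const_mul' _ _ ENNReal.coe_ne_top, lintegral_add_left' m12,
      lintegral_add_left' m1, lintegral_finsetSum' _ m3]
  choose E hEm hEn hEi using hC A hA v p F hv hF heq
  have en := hv.energy_le hA hΩ ha hR0 hR hF heq
  have vn := hv.L2Norm_le hA hΩ ha hR0 hR hF heq
  rw [← he] at en vn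
  have hHΩ : ∫⁻ x in Ω, H x ≤ d * L2Norm Ω F ^ 2 := by
    rw [hHI Ω subset_rfl, hd, mul_assoc]
    gcongr
    calc _ ≤ L2Norm Ω F ^ 2 + (2 * R) ^ 2 * (e * L2Norm Ω F ^ 2) + e * L2Norm Ω F ^ 2 := by
          gcongr
      _ = _ := by ring
  have hFt : L2Norm Ω F ^ 2 < ∞ := ENNReal.pow_lt_top hF.2
  have hfin : ∫⁻ x in Ω, H x ≠ ∞ :=
    (hHΩ.trans_lt (ENNReal.mul_lt_top ENNReal.coe_lt_top hFt)).ne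
  have key : ∀ i j, ∃ D, MemLp D 2 (volume.restrict Ω) ∧ L2Norm Ω D ^ 2 ≤ 3 * ∫⁻ x in Ω, H x ∧
      HasWeakPartial Ω j (p i) D := fun i j =>
    exists_hasWeakPartial_of_slabs hω (hv.memLp_grad i) (fun k => hEm k i j)
      (fun k => hEi k i j)
      (fun k => (hEn k i j).trans_eq (hHI _ (cylinder_subset_waveguide _ _)).symm) hfin
  choose D hDm hDn hDw using key
  have hH : HasHess Ω v p D := ⟨hv.toHasGrad, fun i => ⟨hv.memLp_grad i, hDm i, hDw i⟩⟩
  refine ⟨v, p, D, hv, heq, hH, ?_⟩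
  rw [hH.H2Norm_sq hΩ]
  calc _ ≤ (2 * R) ^ 2 * (e * L2Norm Ω F ^ 2) + e * L2Norm Ω F ^ 2 +
        ∑ i : Fin 3, ∑ j : Fin 3, 3 * (d * L2Norm Ω F ^ 2) := by
        gcongr with i _ j
        exact (hDn i j).trans (by gcongr)
    _ = _ := by
        simp only [Finset.sum_const, Finset.card_univ, Fintype.card_fin, nsmul_eq_mul]
        push_cast
        ring


/-! ### The conductivity of a twisted waveguide -/

section Conductivity

lemma abs_le_of_C01Norm_le {α : ℝ → ℝ} {M : ℝ≥0} (h : C01Norm α ≤ M) (t : ℝ) : |α t| ≤ M := by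
  have h1 : ‖α t‖ₑ ≤ M :=
    (le_iSup (fun t => ‖α t‖ₑ) t).trans ((le_add_right le_rfl).trans h)
  rw [enorm_eq_nnnorm, ENNReal.coe_le_coe] at h1
  exact h1

lemma lipschitzWith_of_C01Norm_le {α : ℝ → ℝ} {M : ℝ≥0} (h : C01Norm α ≤ M) :
    LipschitzWith M α := by
  intro s t
  rcases eq_or_ne s t with rfl | hst
  · simp
  have h1 : edist (α s) (α t) / edist s t ≤ M :=
    (le_iSup₂ (f := fun s t => edist (α s) (α t) / edist s t) s t).trans
      ((le_add_left le_rfl).trans h)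
  rwa [ENNReal.div_le_iff (edist_pos.2 hst).ne' (edist_ne_top _ _)] at h1

lemma exists_abs_coord_le {ω : Set E2} (hb : Bornology.IsBounded ω) :
    ∃ R : ℝ≥0, 1 ≤ R ∧ ∀ x ∈ waveguide ω, |x 0| ≤ R ∧ |x 1| ≤ R := by
  obtain ⟨r, hr⟩ := hb.exists_norm_le
  refine ⟨max 1 r.toNNReal, le_max_left _ _, fun x hx => ?_⟩
  have h1 := hr _ (mem_waveguide.1 hx)
  have h2 : r ≤ (max 1 r.toNNReal : ℝ≥0) :=
    (Real.le_coe_toNNReal r).trans (by exact_mod_cast le_max_right _ _)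
  have h3 : ∀ i, |crossSection x i| ≤ (max 1 r.toNNReal : ℝ≥0) := fun i =>
    (PiLp.norm_apply_le (crossSection x) i).trans (h1.trans h2)
  exact ⟨by simpa [crossSection] using h3 0, by simpa [crossSection] using h3 1⟩

lemma bLip_coord {U : Set E3} {d : ℝ≥0} (hd : 1 ≤ d) (i : Fin 3) (h : ∀ x ∈ U, |x i| ≤ d) :
    BLip U d (fun x => x i) := by
  refine ⟨h, LipschitzOnWith.of_dist_le_mul fun x _ y _ => ?_⟩
  rw [dist_eq_norm, dist_eq_norm]
  have h1 := PiLp.norm_apply_le (x - y) i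
  have h2 : (1 : ℝ) ≤ d := by exact_mod_cast hd
  exact h1.trans (le_mul_of_one_le_left (norm_nonneg _) h2)

lemma bLip_comp_coord {α : ℝ → ℝ} {M : ℝ≥0} (h : C01Norm α ≤ M) (U : Set E3) (i : Fin 3) :
    BLip U M (fun x => α (x i)) := by
  refine ⟨fun x _ => abs_le_of_C01Norm_le h _, LipschitzOnWith.of_dist_le_mul fun x _ y _ => ?_⟩
  refine ((lipschitzWith_of_C01Norm_le h).dist_le_mul _ _).trans ?_
  gcongr
  rw [dist_eq_norm, dist_eq_norm]
  exact PiLp.norm_apply_le (x - y) i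

/-- With `w = X b - Y a`, `z² ≤ 2 (z + w)² + 2 w²` and `w² ≤ 2 d (a² + b²)`. The right-hand factor
is the quadratic form of the conductivity, so `(2 + 4 d)⁻¹` is an ellipticity constant. -/
lemma conductivity_coercive_aux {X Y d a b z : ℝ} (hX : X ^ 2 ≤ d) (hY : Y ^ 2 ≤ d) :
    a ^ 2 + b ^ 2 + z ^ 2 ≤ (2 + 4 * d) * (a ^ 2 + b ^ 2 + (z + (X * b - Y * a)) ^ 2) := by
  have hd : 0 ≤ d := (sq_nonneg X).trans hX
  have h1 : (X * b - Y * a) ^ 2 ≤ 2 * d * (a ^ 2 + b ^ 2) := by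
    nlinarith [sq_nonneg (X * b + Y * a), mul_le_mul_of_nonneg_right hX (sq_nonneg b),
      mul_le_mul_of_nonneg_right hY (sq_nonneg a), mul_nonneg hd (sq_nonneg a),
      mul_nonneg hd (sq_nonneg b)]
  have h2 : z ^ 2 ≤ 2 * (z + (X * b - Y * a)) ^ 2 + 2 * (X * b - Y * a) ^ 2 := by
    nlinarith [sq_nonneg (z + 2 * (X * b - Y * a))]
  nlinarith [mul_nonneg hd (sq_nonneg (z + (X * b - Y * a))), sq_nonneg a, sq_nonneg b]

lemma conductivity_symm (α : ℝ → ℝ) (x : E3) : (conductivity α x).IsSymm := by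
  ext i j
  fin_cases i <;> fin_cases j <;> simp [conductivity, conductivity₀]

/-- All entries are polynomials in `x₁ α` and `x₂ α`, which are bounded and Lipschitz with constant
`2 R M`. Both constants depend on `ω` and `M` only, which makes the final constant uniform in `α`.
-/
lemma exists_admissible_conductivity {ω : Set E2} (hb : Bornology.IsBounded ω) (M : ℝ≥0) :
    ∃ (a : ℝ) (c : ℝ≥0), 0 < a ∧
      ∀ α, C01Norm α ≤ M → Admissible (waveguide ω) a c (conductivity α) := by
  obtain ⟨R, hR1, hR⟩ := exists_abs_coord_le hb
  set d : ℝ≥0 := 2 * R * M with hd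
  refine ⟨(2 + 4 * (d : ℝ) ^ 2)⁻¹, 1 + 2 * d * d + d, by positivity, fun α hα => ?_⟩
  have ht := bLip_comp_coord hα (waveguide ω) 2
  have hX : BLip (waveguide ω) d (fun x => x 0 * α (x 2)) :=
    (bLip_coord hR1 0 fun x hx => (hR x hx).1).mul ht
  have hY : BLip (waveguide ω) d (fun x => x 1 * α (x 2)) :=
    (bLip_coord hR1 1 fun x hx => (hR x hx).2).mul ht
  have h1 : BLip (waveguide ω) 1 (fun _ => (1 : ℝ)) := by
    simpa using BLip.const (waveguide ω) 1
  have l1 : 1 + 2 * d * d ≤ 1 + 2 * d * d + d := le_self_add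
  have l2 : 2 * d * d ≤ 1 + 2 * d * d + d := (le_add_self).trans l1
  have l3 : d ≤ 1 + 2 * d * d + d := le_add_self
  have l4 : 1 ≤ 1 + 2 * d * d + d := le_self_add.trans l1
  refine ⟨fun x _ => conductivity_symm α x, fun i j => ?_, fun x hx ζ => ?_⟩
  · have e00 := (h1.add (hY.mul hY)).mono_const l1
    have e11 := (h1.add (hX.mul hX)).mono_const l1
    have e01 := (hY.mul hX).neg.mono_const l2
    have e02 := hY.neg.mono_const l3
    have e12 := hX.mono_const l3
    have e22 := h1.mono_const l4
    fin_cases i <;> fin_cases j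
    all_goals simp only [conductivity, conductivity₀]
    · convert e00 using 2 with x; simp; ring
    · convert e01 using 2 with x; simp; ring
    · convert e02 using 2 with x; simp
    · convert e01 using 2 with x; simp; ring
    · convert e11 using 2 with x; simp; ring
    · convert e12 using 2 with x; simp
    · convert e02 using 2 with x; simp
    · convert e12 using 2 with x; simp
    · convert e22 using 2 with x; simp
  · have b1 : (x 0 * α (x 2)) ^ 2 ≤ (d : ℝ) ^ 2 := sq_le_sq' (abs_le.1 (hX.1 x hx)).1
      (abs_le.1 (hX.1 x hx)).2
    have b2 : (x 1 * α (x 2)) ^ 2 ≤ (d : ℝ) ^ 2 := sq_le_sq' (abs_le.1 (hY.1 x hx)).1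
      (abs_le.1 (hY.1 x hx)).2
    have key := conductivity_coercive_aux (a := ζ 0) (b := ζ 1) (z := ζ 2) b1 b2
    rw [inv_mul_le_iff₀ (by positivity)]
    refine (le_of_eq ?_).trans (key.trans_eq ?_)
    · simp only [dotProduct, Fin.sum_univ_three]; ring
    · congr 1
      simp [dotProduct, Matrix.mulVec, Fin.sum_univ_three, conductivity, conductivity₀]
      ring

end Conductivity

/-! ### The divergence of the flux of an `H²` function -/

/-- The product rule gives `F = ∑ᵢⱼ (Aᵢⱼ ∂ᵢpⱼ + ∂ᵢAᵢⱼ pⱼ)`: nine pairs of terms, each bounded by `c`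
times the norm, hence `18 c`. -/
lemma HasHess.exists_weakEq {U : Set E3} (hU : IsOpen U) {a : ℝ} {c : ℝ≥0}
    {A : E3 → Matrix (Fin 3) (Fin 3) ℝ} (hA : Admissible U a c A) {G : E3 → ℝ}
    {p : Fin 3 → E3 → ℝ} {D : Fin 3 → Fin 3 → E3 → ℝ} (h : HasHess U G p D) :
    ∃ F, MemLp F 2 (volume.restrict U) ∧ WeakEq U A p F ∧
      L2Norm U F ≤ (18 * c : ℝ≥0) * H2Norm U G := by
  choose A' hA'm hA'b hA' using fun i j => (hA.blip i j).exists_hasWeakPartial_mul hU i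
  have hD := fun i j => (h.hess j).memLp_grad i
  have m1 : ∀ i j, MemLp (fun x => A x i j * D j i x) 2 (volume.restrict U) := fun i j =>
    (hA.blip i j).memLp_mul hU.measurableSet (hD i j)
  have m2 : ∀ i j, MemLp (fun x => A' i j x * p j x) 2 (volume.restrict U) := fun i j =>
    MemLp.of_le_mul (c := c) (h.memLp_grad j)
      ((hA'm i j).aestronglyMeasurable.mul (h.memLp_grad j).1)
      (Eventually.of_forall fun x => by rw [norm_mul]; gcongr; exact hA'b i j x)
  have m12 : ∀ i j, MemLp (fun x => A x i j * D j i x + A' i j x * p j x) 2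
    (volume.restrict U) := fun i j => (m1 i j).add (m2 i j)
  have m3 : ∀ i, MemLp (fun x => ∑ j, (A x i j * D j i x + A' i j x * p j x)) 2
    (volume.restrict U) := fun i => memLp_finsetSum _ fun j _ => m12 i j
  refine ⟨fun x => ∑ i, ∑ j, (A x i j * D j i x + A' i j x * p j x),
    memLp_finsetSum _ fun i _ => m3 i, fun φ hφ => ?_, ?_⟩
  · have mφ := hφ.1.memLp 2 (volume.restrict U)
    simp only [flux, Finset.sum_mul]
    rw [integral_finsetSum _ fun i _ => integrable_finsetSum _ fun j _ =>
      (m12 i j).integrable_mul_two mφ, ← Finset.sum_neg_distrib]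
    refine Finset.sum_congr rfl fun i _ => ?_
    rw [integral_finsetSum _ fun j _ => (m12 i j).integrable_mul_two mφ,
      integral_finsetSum _ fun j _ => ((hA.blip i j).memLp_mul hU.measurableSet
        (h.memLp_grad j)).integrable_mul_two ((hφ.partialDeriv i).1.memLp 2 _),
      ← Finset.sum_neg_distrib]
    exact Finset.sum_congr rfl fun j _ => (hA' i j _ _ ((h.hess j).weak i)).2.2 φ hφ
  · have hH := h.H2Norm_sq hU
    have n1 : ∀ j, L2Norm U (p j) ≤ H2Norm U G := fun j => by
      rw [← ENNReal.pow_le_pow_left_iff two_ne_zero, hH]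
      exact (Finset.single_le_sum (f := fun j => L2Norm U (p j) ^ 2) (fun _ _ => zero_le)
        (Finset.mem_univ j)).trans (le_add_self.trans le_self_add)
    have n2 : ∀ i j, L2Norm U (D j i) ≤ H2Norm U G := fun i j => by
      rw [← ENNReal.pow_le_pow_left_iff two_ne_zero, hH]
      exact ((Finset.single_le_sum (f := fun i => L2Norm U (D j i) ^ 2) (fun _ _ => zero_le)
        (Finset.mem_univ i)).trans (Finset.single_le_sum
          (f := fun j => ∑ i, L2Norm U (D j i) ^ 2) (fun _ _ => zero_le)
          (Finset.mem_univ j))).trans le_add_self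
    calc _ ≤ ∑ i : Fin 3, ∑ j : Fin 3, (c * H2Norm U G + c * H2Norm U G) := by
          refine (L2Norm_sum_le _ fun i _ => (m3 i).1).trans (Finset.sum_le_sum fun i _ => ?_)
          refine (L2Norm_sum_le _ fun j _ => (m12 i j).1).trans (Finset.sum_le_sum fun j _ => ?_)
          refine (L2Norm_add_le (m1 i j).1 (m2 i j).1).trans (add_le_add ?_ ?_)
          · refine ((hA.blip i j).L2Norm_mul_le hU.measurableSet).trans ?_
            gcongr
            exact n2 i j
          · refine (L2Norm_mul_le hU.measurableSet fun x _ => hA'b i j x).trans ?_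
            gcongr
            exact n1 j
      _ = _ := by
          simp only [Finset.sum_const, Finset.card_univ, Fintype.card_fin, nsmul_eq_mul]
          push_cast
          ring

/-! ### Traces -/

section Trace

variable {ω : Set E2} {G G' v : E3 → ℝ} {g g' : E2 × ℝ → ℝ} {p : Fin 3 → E3 → ℝ}

lemma HasTrace.sub (hω : IsOpen ω) (h : HasTrace ω G g) (h' : HasTrace ω G' g') :
    HasTrace ω (fun x => G x - G' x) (fun q => g q - g' q) := by
  have hΩ := isOpen_waveguide hω
  obtain ⟨h1, h2, φ, hφ, hl, ht⟩ := h
  obtain ⟨h1', h2', φ', hφ', hl', ht'⟩ := h'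
  have k := h1.hasGrad hΩ
  have k' := h1'.hasGrad hΩ
  refine ⟨(k.sub k').memH1, h2.sub h2', fun n x => φ n x - φ' n x, fun n => (hφ n).sub (hφ' n),
    ((k.sub k').H1Norm_tendsto_iff hΩ fun n => (hφ n).sub (hφ' n)).2
      (H1Tendsto.sub hφ hφ' k k' ((k.H1Norm_tendsto_iff hΩ hφ).1 hl)
        ((k'.H1Norm_tendsto_iff hΩ hφ').1 hl')), ?_⟩
  have hm : ∀ {ψ : E3 → ℝ}, IsSmoothCompact ψ →
      AEStronglyMeasurable (fun q : E2 × ℝ => ψ (point q.1 q.2)) (surfaceMeasure ω) :=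
    fun hψ => (hψ.continuous.comp continuous_point).aestronglyMeasurable
  refine tendsto_of_tendsto_of_tendsto_of_le_of_le tendsto_const_nhds
    (by simpa using ht.add ht') (fun _ => zero_le) fun n => ?_
  refine le_trans (le_of_eq ?_) (eLpNorm_sub_le (h2.1.sub (hm (hφ n))) (h2'.1.sub (hm (hφ' n)))
    (by norm_num))
  congr 1
  ext q
  simp
  ring

/-- Test functions of `Ω` vanish on `∂ω × ℝ`, because the open set `ω` does not meet its boundary.
-/
lemma HasGrad0.hasTrace_zero (hω : IsOpen ω) (h : HasGrad0 (waveguide ω) v p) :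
    HasTrace ω v (fun _ => 0) := by
  obtain ⟨φ, hφ, hl⟩ := h.exists_seq
  refine ⟨h.memH1, MemLp.zero, φ, fun n => (hφ n).1,
    (h.H1Norm_tendsto_iff (isOpen_waveguide hω) fun n => (hφ n).1).2 hl, ?_⟩
  have : ∀ n, eLpNorm (fun q : E2 × ℝ => (0 : ℝ) - φ n (point q.1 q.2)) 2 (surfaceMeasure ω) = 0 := by
    intro n
    have hae : (fun q : E2 × ℝ => (0 : ℝ) - φ n (point q.1 q.2)) =ᵐ[surfaceMeasure ω] 0 := by
      have hf : ∀ᵐ q ∂(surfaceMeasure ω), q.1 ∈ frontier ω :=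
        Measure.quasiMeasurePreserving_fst.ae (ae_restrict_mem isClosed_frontier.measurableSet)
      filter_upwards [hf] with q hq
      rw [image_eq_zero_of_notMem_tsupport (f := φ n), sub_zero, Pi.zero_apply]
      intro hmem
      have := mem_waveguide.1 ((hφ n).2 hmem)
      rw [crossSection_point] at this
      rw [hω.frontier_eq] at hq
      exact hq.2 this
    rw [eLpNorm_congr_ae hae, eLpNorm_zero]
  simp only [this, tendsto_const_nhds_iff]

lemma HasTrace.hasGrad0 (hω : IsOpen ω) (hb : Bornology.IsBounded ω)
    (hlip : HasLipschitzBoundary ω) (h : HasTrace ω v (fun _ => 0))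
    (hv : HasGrad (waveguide ω) v p) : HasGrad0 (waveguide ω) v p := by
  obtain ⟨-, -, φ, hφ, hl, ht⟩ := h
  refine hv.hasGrad0_of_trace_zero hω hb hlip hφ
    ((hv.H1Norm_tendsto_iff (isOpen_waveguide hω) hφ).1 hl) (ht.congr fun n => ?_)
  rw [← eLpNorm_neg]
  congr 1
  ext q
  simp

end Trace

/-! ### The boundary value problem -/

/-- Uniqueness for the Dirichlet problem in the class `H²`. -/
lemma IsH2Solution.ae_eq {ω : Set E2} (hω : IsOpen ω) (hb : Bornology.IsBounded ω)
    (hlip : HasLipschitzBoundary ω) {α : ℝ → ℝ} {a : ℝ} {c : ℝ≥0} (ha : 0 < a)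
    (hA : Admissible (waveguide ω) a c (conductivity α)) {f : E2 × ℝ → ℝ} {u v : E3 → ℝ}
    (hu : IsH2Solution ω α f u) (hv : IsH2Solution ω α f v) :
    u =ᵐ[volume.restrict (waveguide ω)] v := by
  have hΩ := isOpen_waveguide hω
  obtain ⟨R, hR1, hR⟩ := exists_abs_coord_le hb
  obtain ⟨hu2, hue, hut⟩ := hu
  obtain ⟨hv2, hve, hvt⟩ := hv
  have ku := hu2.hasGrad hΩ
  have kv := hv2.hasGrad hΩ
  have ht := hut.sub hω hvt
  simp only [sub_self] at ht
  have h0 := ht.hasGrad0 hω hb hlip (ku.sub kv)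
  have hz : MemLp (0 : E3 → ℝ) 2 (volume.restrict (waveguide ω)) := MemLp.zero
  have he := WeakEq.sub hA hΩ ku.memLp_grad kv.memLp_grad hz hz ((hA.divEq_iff hΩ ku).1 hue)
    ((hA.divEq_iff hΩ kv).1 hve)
  have hn := h0.L2Norm_le hA hΩ ha (zero_lt_one.trans_le hR1) (fun x hx => (hR x hx).1)
    (hz.sub hz) he
  have hz' : L2Norm (waveguide ω) ((0 : E3 → ℝ) - 0) = 0 := by
    simp [L2Norm]
  rw [hz'] at hn
  have hn' : L2Norm (waveguide ω) (fun x => u x - v x) = 0 := by simpa using hn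
  filter_upwards [(L2Norm_eq_zero_iff (ku.memLp.sub kv.memLp).1).1 hn'] with x hx
  exact sub_eq_zero.1 hx

/-- Existence for the Dirichlet problem, with an estimate by any lift of the boundary values. -/
lemma HasH2Regularity.exists_isH2Solution {ω : Set E2} (hω : IsOpen ω)
    (hb : Bornology.IsBounded ω) (hreg : HasH2Regularity (cylinder ω (Ioo (-1) 1))) {a : ℝ}
    (ha : 0 < a) (c : ℝ≥0) : ∃ C : ℝ≥0, 0 < C ∧ ∀ α,
      Admissible (waveguide ω) a c (conductivity α) → ∀ f G, MemH2 (waveguide ω) G →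
        HasTrace ω G f → ∃ u, IsH2Solution ω α f u ∧
          H2Norm (waveguide ω) u ≤ C * H2Norm (waveguide ω) G := by
  have hΩ := isOpen_waveguide hω
  obtain ⟨R, hR1, hR⟩ := exists_abs_coord_le hb
  obtain ⟨C, hC⟩ := hreg.exists_hasHess hω (zero_lt_one.trans_le hR1) (fun x hx => (hR x hx).1)
    ha c
  -- The estimate is proved for squares with this factor; since the factor is at least `1`, it is
  -- dominated by its own square, which avoids a square root.
  refine ⟨2 + 2 * C * (18 * c) ^ 2, by positivity, fun α hA f G hG hGf => ?_⟩
  have kG := hG.hasHess hΩ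
  obtain ⟨F, hF, hFe, hFn⟩ := kG.exists_weakEq hΩ hA
  obtain ⟨v, p, D, hv0, hve, hv, hvn⟩ := hC _ hA F hF
  have hu := kG.sub hv
  -- `G` and `v` have the same divergence `F`, and `v` has zero trace, so the difference solves the
  -- homogeneous equation with the boundary values of `G`.
  refine ⟨fun x => G x - v x, ⟨hu.memH2 hΩ, (hA.divEq_iff hΩ hu.toHasGrad).2 ?_, ?_⟩, ?_⟩
  · have := WeakEq.sub hA hΩ kG.memLp_grad hv.memLp_grad hF hF hFe hve
    simp only [sub_self] at this
    exact this
  · simpa using hGf.sub hω (hv0.hasTrace_zero hω)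
  · rw [← ENNReal.pow_le_pow_left_iff two_ne_zero]
    have hone : (1 : ℝ≥0∞) ≤ (2 + 2 * C * (18 * c) ^ 2 : ℝ≥0) := by
      exact_mod_cast (one_le_two.trans le_self_add : (1 : ℝ≥0) ≤ 2 + 2 * C * (18 * c) ^ 2)
    calc _ ≤ 2 * H2Norm (waveguide ω) G ^ 2 + 2 * H2Norm (waveguide ω) v ^ 2 :=
          kG.H2Norm_sub_sq_le hΩ hv
      _ ≤ 2 * H2Norm (waveguide ω) G ^ 2 +
          2 * (C * ((18 * c : ℝ≥0) * H2Norm (waveguide ω) G) ^ 2) := by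
          gcongr
          exact hvn.trans (by gcongr)
      _ = (2 + 2 * C * (18 * c) ^ 2 : ℝ≥0) * H2Norm (waveguide ω) G ^ 2 := by
          push_cast; ring
      _ ≤ (2 + 2 * C * (18 * c) ^ 2 : ℝ≥0) ^ 2 * H2Norm (waveguide ω) G ^ 2 := by
          gcongr
          exact le_self_pow₀ hone two_ne_zero
      _ = _ := (mul_pow _ _ _).symm

end Waveguide


theorem mainTheorem3 (ω : Set E2) (hω_open : IsOpen ω) (hω_conn : IsConnected ω)
    (hω_bdd : Bornology.IsBounded ω) (hω_lip : HasLipschitzBoundary ω)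
    (hreg : HasH2Regularity (cylinder ω (Ioo (-1) 1))) :
    ∀ M : ℝ≥0, ∃ C : ℝ≥0, 0 < C ∧ ∀ α : ℝ → ℝ, C01Norm α ≤ M →
      ∀ f : E2 × ℝ → ℝ, MemHTilde ω f →
        ∃ u : E3 → ℝ, IsH2Solution ω α f u ∧
          (∀ v : E3 → ℝ, IsH2Solution ω α f v → v =ᵐ[volume.restrict (waveguide ω)] u) ∧
          H2Norm (waveguide ω) u ≤ C * HTildeNorm ω f := by
  intro M
  obtain ⟨a, c, ha, hA⟩ := exists_admissible_conductivity hω_bdd M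
  obtain ⟨C, hC0, hC⟩ := hreg.exists_isH2Solution hω_open hω_bdd ha c
  refine ⟨C, hC0, fun α hα f ⟨G, hG, hGf⟩ => ?_⟩
  obtain ⟨u, hu, -⟩ := hC α (hA α hα) f G hG hGf
  have huniq : ∀ v, IsH2Solution ω α f v → v =ᵐ[volume.restrict (waveguide ω)] u :=
    fun v hv => hv.ae_eq hω_open hω_bdd hω_lip ha (hA α hα) hu
  refine ⟨u, hu, huniq, ?_⟩
  rw [HTildeNorm, ENNReal.mul_iInf_of_ne (by exact_mod_cast hC0.ne') ENNReal.coe_ne_top]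
  refine le_iInf fun G' => ?_
  rw [ENNReal.mul_iInf_of_ne (by exact_mod_cast hC0.ne') ENNReal.coe_ne_top]
  refine le_iInf fun hG' => ?_
  -- Any other lift `G'` yields a solution bounded by `G'`; by uniqueness it is `u`, so the bound
  -- holds for `u` with every lift and passes to the infimum.
  obtain ⟨u', hu', hn⟩ := hC α (hA α hα) f G' hG'.1 hG'.2
  rw [← H2Norm_congr (isOpen_waveguide hω_open) hu'.1 (huniq u' hu')]
  exact hn
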